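/- Let $k$ be a field of characteristic zero. Let $\mathcal A$ be the tensor category of topologically free, $h$-adically complete $k[[h]]$-modules, with $V\otimes W:=\varprojlim_n (V/h^nV)\otimes_{k[[h]]/(h^n)}(W/h^nW)$, and let $H$ be a Hopf algebra in $\mathcal A$, with coproduct $\Delta$, counit $\epsilon$ and antipode $S$. Let $\sigma$ be the flip of $H\otimes H$ and $\Delta^{op}=\sigma\circ\Delta$. Let $R\in H\otimes H$ be an $R$-matrix, i.e. an invertible element with $R\,\Delta(a)\,R^{-1}=\Delta^{op}(a)$ for all $a\in H$, $(\Delta\otimes \mathrm{id})(R)=R_{13}R_{23}$ and $(\mathrm{id}\otimes\Delta)(R)=R_{13}R_{12}$, and suppose that $R\equiv 1\otimes 1 \pmod h$. Put $\Delta^0=\epsilon$, $\Delta^1=\mathrm{id}$, $\Delta^2=\Delta$, $\Delta^{n}=(\Delta\otimes\mathrm{id}^{\otimes(n-2)})\circ\Delta^{n-1}$ for $n>2$. For $\Sigma\subseteq\{1,\dots,n\}$ let $\Delta_\Sigma=j_\Sigma\circ\Delta^{|\Sigma|}:H\to H^{\otimes n}$, where $j_\Sigma:H^{\otimes|\Sigma|}\to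 H^{\otimes n}$ places the tensor factors, in order, at the places in $\Sigma$ and $1$ at the other places; let $\delta_n=\sum_{\Sigma\subseteq\{1,\dots,n\}}(-1)^{n-|\Sigma|}\Delta_\Sigma$ and $$H'=\{a\in H:\ \delta_n(a)\in h^nH^{\otimes n}\text{ for all } n\},$$ with the topology induced by that of $H$. Define $(H\otimes H)'\subseteq H\otimes H$ in the same way from the Hopf algebra $H\otimes H$. For a subalgebra $K$ of $H$, the tensor power $K^{\otimes n}$ is taken for the induced topology: it is the closure in $H^{\otimes n}$ of the span of the tensors $a_1\otimes\cdots\otimes a_n$ with all $a_i\in K$. Then: 1. $R\,a\,R^{-1}\in(H\otimes H)'$ for every $a\in(H\otimes H)'$. 2. $H'$ is a subalgebra of $H$, and $(H\otimes H)'=H'\otimes H'$. 3. The inner automorphism $\mathrm{Ad}(R):x\mapsto RxR^{-1}$ of $H\otimes H$ restricts to an algebra automorphism $\mathfrak R$ of $H'\otimes H'$, and $(H',\mathfrak R)$ is a braided Hopf algebra. That is: $H'$ is closed in $H$, is topologically free and $h$-adically complete as a $k[[h]]$-module, and satisfies $\Delta(H')\subseteq H'\otimes H'$ and $S(H')\subseteq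 H'$; $\mathfrak R$ and $\mathfrak R^{-1}$ are continuous; $\mathfrak R\neq\sigma$ on $H'\otimes H'$ unless $H'=k[[h]]\cdot 1$; $\mathfrak R\circ\Delta=\Delta^{op}$ on $H'$; there are continuous automorphisms (with continuous inverses) $\mathfrak R_{12}$, $\mathfrak R_{13}$, $\mathfrak R_{23}$ of the algebra $H'\otimes H'\otimes H'$ acting as $\mathfrak R$ on the two indicated factors and as the identity on the third; and on $H'\otimes H'$ $$(\Delta\otimes\mathrm{id})\circ\mathfrak R=\mathfrak R_{13}\circ\mathfrak R_{23}\circ(\Delta\otimes\mathrm{id}),\qquad(\mathrm{id}\otimes\Delta)\circ\mathfrak R=\mathfrak R_{13}\circ\mathfrak R_{12}\circ(\mathrm{id}\otimes\Delta).$$ -/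

import Mathlib

open scoped PowerSeries TensorProduct

noncomputable section

namespace HAdic

/-! ### `h`-adic completions of (not necessarily commutative) `k⟦h⟧`-algebras

The formal parameter `h` is `PowerSeries.X : k⟦X⟧`. -/

section Completion

variable (k : Type*) [Field k] (A : Type*) [Ring A] [Algebra k⟦X⟧ A]

/-- The two-sided ideal `hⁿ A`. -/
def hIdeal (n : ℕ) : Ideal A where
  carrier := {a | ∃ b : A, a = (PowerSeries.X ^ n : k⟦X⟧) • b}
  zero_mem' := ⟨0, by simp⟩
  add_mem' := by
    rintro _ _ ⟨b, rfl⟩ ⟨c, rfl⟩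
    exact ⟨b + c, by rw [smul_add]⟩
  smul_mem' := by
    rintro c _ ⟨b, rfl⟩
    exact ⟨c * b, by simp only [smul_eq_mul, mul_smul_comm]⟩

instance (n : ℕ) : (hIdeal k A n).IsTwoSided where
  mul_mem_of_left := by
    rintro _ c ⟨b, rfl⟩
    exact ⟨b * c, by rw [smul_mul_assoc]⟩

theorem hIdeal_anti {m n : ℕ} (h : m ≤ n) : hIdeal k A n ≤ hIdeal k A m := by
  rintro _ ⟨b, rfl⟩
  refine ⟨(PowerSeries.X ^ (n - m) : k⟦X⟧) • b, ?_⟩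
  rw [smul_smul, ← pow_add, Nat.add_sub_cancel' h]

/-- The inverse limit of the algebras `A / hⁿ A`, as a subalgebra of their product. -/
def hComplSubalgebra : Subalgebra k⟦X⟧ (∀ n, A ⧸ hIdeal k A n) where
  carrier := {x | ∀ m n (h : m ≤ n), Ideal.Quotient.factor (hIdeal_anti k A h) (x n) = x m}
  mul_mem' := by
    intro x y hx hy m n h
    simp only [Pi.mul_apply, map_mul, hx m n h, hy m n h]
  add_mem' := by
    intro x y hx hy m n h
    simp only [Pi.add_apply, map_add, hx m n h, hy m n h]
  algebraMap_mem' := by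
    intro r m n h
    rfl

/-- The `h`-adic completion `lim A / hⁿ A` of a `k⟦h⟧`-algebra `A`. -/
def HCompl : Type _ := hComplSubalgebra k A

instance : Ring (HCompl k A) := inferInstanceAs (Ring (hComplSubalgebra k A))

instance : Algebra k⟦X⟧ (HCompl k A) :=
  inferInstanceAs (Algebra k⟦X⟧ (hComplSubalgebra k A))

variable {k A}

/-- The projection of the completion of `A` onto `A / hⁿ A`. -/
def HCompl.proj (n : ℕ) : HCompl k A →ₐ[k⟦X⟧] (A ⧸ hIdeal k A n) :=
  (Pi.evalAlgHom k⟦X⟧ (fun n => A ⧸ hIdeal k A n) n).comp (hComplSubalgebra k A).val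

variable (k A) in
/-- The canonical map from `A` to its completion. -/
def HCompl.of : A →ₐ[k⟦X⟧] HCompl k A :=
  AlgHom.codRestrict (AlgHom.pi
    (fun n => Ideal.Quotient.mkₐ k⟦X⟧ (hIdeal k A n))) (hComplSubalgebra k A)
    (fun _ _ _ _ => rfl)

variable {B : Type*} [Ring B] [Algebra k⟦X⟧ B]

/-- The map `A / hⁿ A → B / hⁿ B` induced by a `k⟦h⟧`-linear map from `A` to the completion
of `B`. -/
def HCompl.levelMap (f : A →ₗ[k⟦X⟧] HCompl k B) (n : ℕ) :
    (A ⧸ hIdeal k A n) →ₗ[k⟦X⟧] (B ⧸ hIdeal k B n) :=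
  (Submodule.liftQ ((hIdeal k A n).restrictScalars k⟦X⟧)
    ((HCompl.proj n).toLinearMap ∘ₗ f) (by
      rintro _ ⟨b, rfl⟩
      rw [LinearMap.mem_ker, map_smul]
      obtain ⟨c, hc⟩ := Ideal.Quotient.mk_surjective
        (((HCompl.proj n).toLinearMap ∘ₗ f) b)
      rw [← hc]
      exact Ideal.Quotient.eq_zero_iff_mem.2 ⟨c, rfl⟩)) ∘ₗ
    (Submodule.Quotient.restrictScalarsEquiv k⟦X⟧ (hIdeal k A n)).symm.toLinearMap

theorem HCompl.levelMap_mk (f : A →ₗ[k⟦X⟧] HCompl k B) (n : ℕ) (a : A) :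
    HCompl.levelMap f n (Ideal.Quotient.mk _ a) = HCompl.proj n (f a) := rfl

/-- The extension by continuity, from `A` to its completion, of a `k⟦h⟧`-linear map from `A` to
the completion of `B`. -/
def HCompl.lift (f : A →ₗ[k⟦X⟧] HCompl k B) : HCompl k A →ₗ[k⟦X⟧] HCompl k B :=
  LinearMap.codRestrict (Subalgebra.toSubmodule (hComplSubalgebra k B))
    (LinearMap.pi fun n => HCompl.levelMap f n ∘ₗ (HCompl.proj n).toLinearMap) (by
      intro x m n h
      obtain ⟨a, ha⟩ := Ideal.Quotient.mk_surjective (HCompl.proj n x)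
      have hx : HCompl.proj m x = Ideal.Quotient.mk _ a := by
        have h1 : Ideal.Quotient.factor (hIdeal_anti k A h) (HCompl.proj n x)
          = HCompl.proj m x := x.2 m n h
        rw [← h1, ← ha]
        rfl
      simp only [LinearMap.pi_apply, LinearMap.comp_apply, AlgHom.toLinearMap_apply]
      rw [hx, ← ha, HCompl.levelMap_mk, HCompl.levelMap_mk]
      exact (f a).2 m n h)

/-- The closure of a subalgebra for the `h`-adic topology of the ambient algebra. -/
def hClosure (P : Subalgebra k⟦X⟧ B) : Subalgebra k⟦X⟧ B where
  carrier := {x | ∀ n : ℕ, ∃ y ∈ P, x - y ∈ hIdeal k B n}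
  mul_mem' := by
    intro x x' hx hx' n
    obtain ⟨y, hy, hxy⟩ := hx n
    obtain ⟨y', hy', hxy'⟩ := hx' n
    exact ⟨y * y', P.mul_mem hy hy', Ideal.mul_sub_mul_mem _ hxy hxy'⟩
  add_mem' := by
    intro x x' hx hx' n
    obtain ⟨y, hy, hxy⟩ := hx n
    obtain ⟨y', hy', hxy'⟩ := hx' n
    refine ⟨y + y', P.add_mem hy hy', ?_⟩
    rw [add_sub_add_comm]
    exact Ideal.add_mem _ hxy hxy'
  algebraMap_mem' := fun r n => ⟨_, P.algebraMap_mem r, by simp⟩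

/-- Continuity of a self-map of a subalgebra, for the topology induced by the `h`-adic topology
of the ambient algebra. For additive maps continuity at `0` is enough. -/
def InducedContinuous {P : Subalgebra k⟦X⟧ B} (f : P → P) : Prop :=
  ∀ n : ℕ, ∃ m : ℕ, ∀ x : P, (x : B) ∈ hIdeal k B m → (f x : B) ∈ hIdeal k B n

variable (k) in
/-- The objects of the category: topologically free, `h`-adically complete `k⟦h⟧`-modules.
An `h`-adically complete and separated `k⟦h⟧`-module is isomorphic to some `V⟦h⟧`, with `V` a
`k`-vector space, exactly when it is torsion-free. -/
structure IsTopFree (M : Type*) [AddCommGroup M] [Module k⟦X⟧ M] : Prop where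
  complete : IsAdicComplete (Ideal.span {(PowerSeries.X : k⟦X⟧)}) M
  torsionFree : Module.IsTorsionFree k⟦X⟧ M

end Completion

/-! ### Completed tensor powers -/

section Tensor

variable (k : Type*) [Field k] (H : Type*) [Ring H] [Algebra k⟦X⟧ H]

/-- The completed tensor power `H^{⊗ι}`, with its algebra structure:
the limit of the algebras `(⨂_ι H) / hⁿ (⨂_ι H)`. -/
abbrev TPow (ι : Type*) : Type _ := HCompl k (⨂[k⟦X⟧] _ : ι, H)

variable {k H} {ι κ : Type*}

variable (k) in
/-- The pure tensor `⊗_i a i` in the completed tensor power. -/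
def pure (a : ι → H) : TPow k H ι := HCompl.of k _ (PiTensorProduct.tprod k⟦X⟧ a)

theorem extend_update [DecidableEq ι] [DecidableEq κ] (e : ι ↪ κ) (a : ι → H) (i : ι) (x : H) :
    Function.extend e (Function.update a i x) (1 : κ → H) =
      Function.update (Function.extend e a 1) (e i) x := by
  funext c
  by_cases hc : ∃ j, e j = c
  · obtain ⟨j, rfl⟩ := hc
    rw [e.injective.extend_apply]
    by_cases hj : j = i
    · subst hj; simp
    · rw [Function.update_of_ne hj, Function.update_of_ne (fun h => hj (e.injective h)),
        e.injective.extend_apply]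
  · rw [Function.extend_apply' _ _ _ hc, Function.update_of_ne, Function.extend_apply' _ _ _ hc]
    rintro rfl
    exact hc ⟨i, rfl⟩

/-- For `e : ι ↪ κ`, the map `⨂_ι H → H^{⊗κ}` that puts the factor of index `i` at the place
`e i`, and `1` at the places outside the range of `e`. -/
def placeAlg (e : ι ↪ κ) : (⨂[k⟦X⟧] _ : ι, H) →ₗ[k⟦X⟧] TPow k H κ :=
  (HCompl.of k _).toLinearMap ∘ₗ PiTensorProduct.lift
    { toFun := fun a => PiTensorProduct.tprod k⟦X⟧ (Function.extend e a (1 : κ → H))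
      map_update_add' := by
        classical
        intro _ a i x y
        have h := fun z => extend_update e a i z
        convert (PiTensorProduct.tprod k⟦X⟧ (s := fun _ : κ => H)).map_update_add
          (Function.extend e a 1) (e i) x y using 2
        all_goals (try congr 1)
        all_goals (rw [← h]; try congr!)
      map_update_smul' := by
        classical
        intro _ a i c x
        have h := fun z => extend_update e a i z
        convert (PiTensorProduct.tprod k⟦X⟧ (s := fun _ : κ => H)).map_update_smul
          (Function.extend e a 1) (e i) c x using 2
        all_goals (try congr 1)
        all_goals (rw [← h]; try congr!) }

/-- For `e : ι ↪ κ`, the map `j_e : H^{⊗ι} → H^{⊗κ}` that puts the factor of index `i` at the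
place `e i`, and `1` at the places outside the range of `e`. -/
def place (e : ι ↪ κ) : TPow k H ι →ₗ[k⟦X⟧] TPow k H κ := HCompl.lift (placeAlg e)

/-- The element of `H^{⊗κ}` with `a` at the place `c` and `1` at the other places. -/
def single [DecidableEq κ] (c : κ) : H →ₐ[k⟦X⟧] TPow k H κ :=
  (HCompl.of k _).comp (PiTensorProduct.singleAlgHom (R := k⟦X⟧) (A := fun _ : κ => H) c)

/-- The continuous linear map `H ⊗ H → B^` with `a ⊗ b ↦ f a * g b`,
where `B^` is the completion of `B`. -/
def tens {B : Type*} [Ring B] [Algebra k⟦X⟧ B] (f g : H →ₗ[k⟦X⟧] HCompl k B) :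
    TPow k H (Fin 2) →ₗ[k⟦X⟧] HCompl k B :=
  HCompl.lift (PiTensorProduct.lift
    ((MultilinearMap.mkPiAlgebraFin k⟦X⟧ 2 (HCompl k B)).compLinearMap ![f, g]))

/-- The embedding `0 ↦ a, 1 ↦ b`. -/
def emb {κ : Type*} (a b : κ) (h : a ≠ b) : Fin 2 ↪ κ where
  toFun := ![a, b]
  inj' := by
    intro i j hij
    fin_cases i <;> fin_cases j <;> simp_all [eq_comm]

/-- The flip `a ⊗ b ↦ b ⊗ a`. -/
def flip : TPow k H (Fin 2) →ₗ[k⟦X⟧] TPow k H (Fin 2) :=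
  place (emb 1 0 (by decide))

/-- `j₁₂ : H ⊗ H → H ⊗ H ⊗ H`. -/
def j₁₂ : TPow k H (Fin 2) →ₗ[k⟦X⟧] TPow k H (Fin 3) := place (emb 0 1 (by decide))

/-- `j₁₃ : H ⊗ H → H ⊗ H ⊗ H`. -/
def j₁₃ : TPow k H (Fin 2) →ₗ[k⟦X⟧] TPow k H (Fin 3) := place (emb 0 2 (by decide))

/-- `j₂₃ : H ⊗ H → H ⊗ H ⊗ H`. -/
def j₂₃ : TPow k H (Fin 2) →ₗ[k⟦X⟧] TPow k H (Fin 3) := place (emb 1 2 (by decide))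

/-- For a subalgebra `S` of `H`, the tensor power `S^{⊗ι}` for the topology induced by `H`: the
closure in `H^{⊗ι}` of the subalgebra generated by (equivalently, of the span of) the pure
tensors with all factors in `S`. -/
def subTPow (S : Subalgebra k⟦X⟧ H) (ι : Type*) : Subalgebra k⟦X⟧ (TPow k H ι) :=
  hClosure (Algebra.adjoin k⟦X⟧ {x | ∃ a : ι → H, (∀ i, a i ∈ S) ∧ x = pure k a})

/-- `f ⊗ id : H ⊗ H → H ⊗ H ⊗ H` for `f : H → H ⊗ H`. -/
def tensId (f : H →ₗ[k⟦X⟧] TPow k H (Fin 2)) : TPow k H (Fin 2) →ₗ[k⟦X⟧] TPow k H (Fin 3) :=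
  tens (j₁₂ ∘ₗ f) (single 2).toLinearMap

/-- `id ⊗ f : H ⊗ H → H ⊗ H ⊗ H` for `f : H → H ⊗ H`. -/
def idTens (f : H →ₗ[k⟦X⟧] TPow k H (Fin 2)) : TPow k H (Fin 2) →ₗ[k⟦X⟧] TPow k H (Fin 3) :=
  tens (single 0).toLinearMap (j₂₃ ∘ₗ f)

end Tensor

/-! ### Hopf algebras in the category of topologically free complete modules -/

/-- A Hopf algebra structure on a `k⟦h⟧`-algebra `H`, with respect to the completed tensor
product. The last four axioms are equalities in the completion of `H`, which is `H` itself as soon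
as `H` is complete. -/
structure TopHopf (k : Type*) [Field k] (H : Type*) [Ring H] [Algebra k⟦X⟧ H] where
  comul : H →ₐ[k⟦X⟧] TPow k H (Fin 2)
  counit : H →ₐ[k⟦X⟧] k⟦X⟧
  antipode : H →ₗ[k⟦X⟧] H
  coassoc : ∀ a, tensId comul.toLinearMap (comul a) = idTens comul.toLinearMap (comul a)
  counit_left : ∀ a, tens ((Algebra.linearMap k⟦X⟧ (HCompl k H)) ∘ₗ counit.toLinearMap)
    (HCompl.of k H).toLinearMap (comul a) = HCompl.of k H a
  counit_right : ∀ a, tens (HCompl.of k H).toLinearMap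
    ((Algebra.linearMap k⟦X⟧ (HCompl k H)) ∘ₗ counit.toLinearMap) (comul a) = HCompl.of k H a
  antipode_left : ∀ a, tens ((HCompl.of k H).toLinearMap ∘ₗ antipode)
    (HCompl.of k H).toLinearMap (comul a) = algebraMap k⟦X⟧ (HCompl k H) (counit a)
  antipode_right : ∀ a, tens (HCompl.of k H).toLinearMap
    ((HCompl.of k H).toLinearMap ∘ₗ antipode) (comul a) = algebraMap k⟦X⟧ (HCompl k H) (counit a)

namespace TopHopf

variable {k : Type*} [Field k] {H : Type*} [Ring H] [Algebra k⟦X⟧ H] (𝓗 : TopHopf k H)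

/-- `R` is an `R`-matrix: `R Δ(a) R⁻¹ = Δᵒᵖ(a)`, `(Δ ⊗ id)(R) = R₁₃ R₂₃` and
`(id ⊗ Δ)(R) = R₁₃ R₁₂`. -/
structure IsRMatrix (R : (TPow k H (Fin 2))ˣ) : Prop where
  conj_comul : ∀ a : H, (R : TPow k H (Fin 2)) * 𝓗.comul a * (R⁻¹ : (TPow k H (Fin 2))ˣ) =
    flip (𝓗.comul a)
  comul_id : tensId 𝓗.comul.toLinearMap (R : TPow k H (Fin 2)) =
    j₁₃ (R : TPow k H (Fin 2)) * j₂₃ (R : TPow k H (Fin 2))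
  id_comul : idTens 𝓗.comul.toLinearMap (R : TPow k H (Fin 2)) =
    j₁₃ (R : TPow k H (Fin 2)) * j₁₂ (R : TPow k H (Fin 2))

/-- The iterated coproduct `Δⁿ : H → H^{⊗n}`: `Δ⁰ = ε` and `Δⁿ⁺¹ = (Δⁿ ⊗ id) ∘ Δ`
(so `Δ¹ = id` and `Δ² = Δ`). -/
def iterComul : (n : ℕ) → H →ₗ[k⟦X⟧] TPow k H (Fin n)
  | 0 => Algebra.linearMap k⟦X⟧ (TPow k H (Fin 0)) ∘ₗ 𝓗.counit.toLinearMap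
  | n + 1 => tens (place Fin.castSuccEmb ∘ₗ iterComul n)
      (single (Fin.last n)).toLinearMap ∘ₗ 𝓗.comul.toLinearMap

/-- The increasing enumeration of a subset of `{1, …, n}`. -/
def enum {n : ℕ} (s : Finset (Fin n)) : Fin s.card ↪ Fin n := (s.orderEmbOfFin rfl).toEmbedding

/-- `δₙ = ∑_{Σ ⊆ {1, …, n}} (-1)^{n - |Σ|} Δ_Σ`, with `Δ_Σ = j_Σ ∘ Δ^{|Σ|}`. -/
def delta (n : ℕ) : H →ₗ[k⟦X⟧] TPow k H (Fin n) :=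
  ∑ s : Finset (Fin n), ((-1 : k⟦X⟧) ^ (n - s.card)) • (place (enum s) ∘ₗ 𝓗.iterComul s.card)

/-- `H' = {a ∈ H : δₙ(a) ∈ hⁿ H^{⊗n} for all n}`. -/
def drinfeld : Submodule k⟦X⟧ H where
  carrier := {a | ∀ n, 𝓗.delta n a ∈ hIdeal k (TPow k H (Fin n)) n}
  zero_mem' := fun n => by simp
  add_mem' := fun ha hb n => by
    rw [map_add]
    exact Ideal.add_mem _ (ha n) (hb n)
  smul_mem' := fun c a ha n => by
    obtain ⟨z, hz⟩ := ha n
    exact ⟨c • z, by rw [map_smul, hz, smul_comm]⟩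

/-- The iterated coproduct `Δ̃ⁿ : H ⊗ H → (H ⊗ H)^{⊗n}` of the Hopf algebra `H ⊗ H`, whose
coproduct is `Δ̃ = σ₂₃ ∘ (Δ ⊗ Δ)`. Here `(H ⊗ H)^{⊗n}` is `H^{⊗(Fin n × Fin 2)}`, the place
`(i, 0)` (resp. `(i, 1)`) being the first (resp. second) factor of the `i`-th copy of `H ⊗ H`:
thus `Δ̃ⁿ(a ⊗ b)` is the product of `Δⁿ(a)` on the places `(·, 0)` and of `Δⁿ(b)` on the
places `(·, 1)`. -/
def iterComul₂ (n : ℕ) : TPow k H (Fin 2) →ₗ[k⟦X⟧] TPow k H (Fin n × Fin 2) :=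
  tens (place (Function.Embedding.sectL (Fin n) (0 : Fin 2)) ∘ₗ 𝓗.iterComul n)
    (place (Function.Embedding.sectL (Fin n) (1 : Fin 2)) ∘ₗ 𝓗.iterComul n)

/-- The maps `δₙ` of the Hopf algebra `H ⊗ H`. -/
def delta₂ (n : ℕ) : TPow k H (Fin 2) →ₗ[k⟦X⟧] TPow k H (Fin n × Fin 2) :=
  ∑ s : Finset (Fin n), ((-1 : k⟦X⟧) ^ (n - s.card)) •
    (place ((enum s).prodMap (Function.Embedding.refl (Fin 2))) ∘ₗ 𝓗.iterComul₂ s.card)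

/-- `(H ⊗ H)'`. -/
def drinfeld₂ : Submodule k⟦X⟧ (TPow k H (Fin 2)) where
  carrier := {c | ∀ n, 𝓗.delta₂ n c ∈ hIdeal k (TPow k H (Fin n × Fin 2)) n}
  zero_mem' := fun n => by simp
  add_mem' := fun ha hb n => by
    rw [map_add]
    exact Ideal.add_mem _ (ha n) (hb n)
  smul_mem' := fun c a ha n => by
    obtain ⟨z, hz⟩ := ha n
    exact ⟨c • z, by rw [map_smul, hz, smul_comm]⟩

/-- The subalgebra `S` of `H`, with the topology induced by that of `H`, is a Hopf algebra for the
structure maps of `H`: it is closed, topologically free and complete as a `k⟦h⟧`-module, and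
`Δ(S) ⊆ S ⊗ S`, `antipode(S) ⊆ S`. -/
structure IsHopfSubalgebra (S : Subalgebra k⟦X⟧ H) : Prop where
  topFree : IsTopFree k S
  closed : hClosure S = S
  comul_mem : ∀ a ∈ S, 𝓗.comul a ∈ subTPow S (Fin 2)
  antipode_mem : ∀ a ∈ S, 𝓗.antipode a ∈ S

/-- `F` is the continuous automorphism of `S ⊗ S ⊗ S` that acts as `T` on the two factors of
places `a`, `b` and as the identity on the factor of place `c`. It is determined by `T`, since the
elements `j_{ab}(x) * single c s` span a dense submodule. -/
structure IsAmplification {S : Subalgebra k⟦X⟧ H}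
    (T : subTPow S (Fin 2) ≃ₐ[k⟦X⟧] subTPow S (Fin 2))
    (a b : Fin 3) (h : a ≠ b) (c : Fin 3)
    (F : subTPow S (Fin 3) ≃ₐ[k⟦X⟧] subTPow S (Fin 3)) : Prop where
  continuous : InducedContinuous F
  continuous_symm : InducedContinuous F.symm
  apply : ∀ (x : subTPow S (Fin 2)) (s : S), ∃ y : subTPow S (Fin 3),
    (y : TPow k H (Fin 3)) = place (emb a b h) (x : TPow k H (Fin 2)) * single c (s : H) ∧
    (F y : TPow k H (Fin 3)) =
      place (emb a b h) (T x : TPow k H (Fin 2)) * single c (s : H)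

/-- The pair `(S, T)` is a braided Hopf algebra: `S` is a Hopf algebra, and `T` is an algebra
automorphism of `S ⊗ S`, different from the flip unless `S` is reduced to `k⟦h⟧`, such that
`T ∘ Δ = Δᵒᵖ`, `(Δ ⊗ id) ∘ T = T₁₃ ∘ T₂₃ ∘ (Δ ⊗ id)` and
`(id ⊗ Δ) ∘ T = T₁₃ ∘ T₁₂ ∘ (id ⊗ Δ)`. -/
structure IsBraided (S : Subalgebra k⟦X⟧ H)
    (T : subTPow S (Fin 2) ≃ₐ[k⟦X⟧] subTPow S (Fin 2)) : Prop where
  hopf : 𝓗.IsHopfSubalgebra S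
  continuous : InducedContinuous T
  continuous_symm : InducedContinuous T.symm
  ne_flip : S ≠ ⊥ → ∃ x : subTPow S (Fin 2),
    (T x : TPow k H (Fin 2)) ≠ flip (x : TPow k H (Fin 2))
  comul : ∀ a ∈ S, ∃ x : subTPow S (Fin 2), (x : TPow k H (Fin 2)) = 𝓗.comul a ∧
    (T x : TPow k H (Fin 2)) = flip (𝓗.comul a)
  hexagon : ∃ T₁₂ T₁₃ T₂₃ : subTPow S (Fin 3) ≃ₐ[k⟦X⟧] subTPow S (Fin 3),
    IsAmplification T 0 1 (by decide) 2 T₁₂ ∧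
    IsAmplification T 0 2 (by decide) 1 T₁₃ ∧
    IsAmplification T 1 2 (by decide) 0 T₂₃ ∧
    (∀ x : subTPow S (Fin 2), ∃ y : subTPow S (Fin 3),
      (y : TPow k H (Fin 3)) = tensId 𝓗.comul.toLinearMap (x : TPow k H (Fin 2)) ∧
      tensId 𝓗.comul.toLinearMap (T x : TPow k H (Fin 2)) = T₁₃ (T₂₃ y)) ∧
    (∀ x : subTPow S (Fin 2), ∃ y : subTPow S (Fin 3),
      (y : TPow k H (Fin 3)) = idTens 𝓗.comul.toLinearMap (x : TPow k H (Fin 2)) ∧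
      idTens 𝓗.comul.toLinearMap (T x : TPow k H (Fin 2)) = T₁₃ (T₁₂ y))

end TopHopf

end HAdic

end

namespace HAdic

noncomputable section

/-! ### Completions: linear maps are continuous and determined by a dense subset -/

section Basic

variable {k : Type*} [Field k] {A B C : Type*} [Ring A] [Algebra k⟦X⟧ A]
  [Ring B] [Algebra k⟦X⟧ B] [Ring C] [Algebra k⟦X⟧ C]

/-! For fixed a, the family Δ_Σ(a) is a function of Σ whose Möbius coefficient at T is δ_{|T|}(a)
put at the places of T. So a lies in H' exactly when, for every n, this function is filtered: its
coefficient at T lies in h^|T| (`mem_drinfeld_iff`, and `mem_drinfeld₂_iff` for H ⊗ H). In a product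
of two functions the coefficients at T and U contribute at T ∪ U, and |T ∪ U| ≤ |T| + |U|; hence
products of filtered functions are filtered. Since each Δ_Σ is multiplicative, H' and (H ⊗ H)' are
subalgebras.

Conjugation by R: the hexagon identities make Δ̃_Σ(R) an ordered product of copies of R at the
places (c, 0), (d, 1) with c, d ∈ Σ (`IsRMatrix.comulOn₂_eq`). Conjugation by one copy u turns a
coefficient x at T into x plus a contribution u x u⁻¹ - x at T ∪ {c, d}. If T misses c and d, then u
commutes with x and the contribution is zero; otherwise the union has at most one more element than
T, and u ≡ 1 mod h supplies the extra power of h (`conj_sub_mem_suppFil`).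

Stability under Δ and S: a convolution product of n maps vanishing at 1 sends H' into h^n, because
its value at a is read off δ_n(a) (`list_prod_apply_mem`). The insertions of H at the various
places, and their composites with S, differ from the convolution unit ε by maps vanishing at 1, and
Δ̃_Σ ∘ Δ and Δ_Σ ∘ S are convolution products of such maps.

Tensor square: functionals that are products of n maps vanishing at 1 (weight n) also detect H'
(`mem_drinfeld_of_isWeight`). Choose topological coordinates of H adapted to H'
(`exists_coordinates`): each basis element u either has an i with h^i u ∈ H' and coord_u(H') ⊆
(h^i), or has coord_u zero on H'. For x in (H ⊗ H)', a slice of x by a weight-n functional lies in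
h^n H', so the slice by coord_u lies in h^i H' (or is zero), and u ⊗ slice lies in H' ⊗ H'. These
terms approximate x (`drinfeldAlg₂_le_subTPow`).

Braiding: the identities for Ad(R) are the axioms of R transported through the algebra maps Δ ⊗ id
and id ⊗ Δ. If Ad(R) were the flip, 1 ⊗ a - a ⊗ 1 would be one order smaller in h than a, forcing a
= 0 when ε(a) = 0. -/

theorem smul_mem_hIdeal (n : ℕ) (a : A) : (PowerSeries.X ^ n : k⟦X⟧) • a ∈ hIdeal k A n :=
  ⟨a, rfl⟩

theorem hIdeal_smul_mem {n : ℕ} (r : k⟦X⟧) {a : A} (ha : a ∈ hIdeal k A n) :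
    r • a ∈ hIdeal k A n := by
  obtain ⟨b, rfl⟩ := ha
  exact ⟨r • b, smul_comm _ _ _⟩

theorem mul_mem_hIdeal_add {m n : ℕ} {a b : A} (ha : a ∈ hIdeal k A m) (hb : b ∈ hIdeal k A n) :
    a * b ∈ hIdeal k A (m + n) := by
  obtain ⟨a, rfl⟩ := ha
  obtain ⟨b, rfl⟩ := hb
  exact ⟨a * b, by rw [smul_mul_smul_comm, pow_add]⟩

theorem mem_hIdeal_zero (a : A) : a ∈ hIdeal k A 0 := ⟨a, by simp⟩

theorem map_mem_hIdeal (f : A →ₗ[k⟦X⟧] B) {n : ℕ} {a : A} (ha : a ∈ hIdeal k A n) :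
    f a ∈ hIdeal k B n := by
  obtain ⟨b, rfl⟩ := ha
  exact ⟨f b, map_smul _ _ _⟩

variable (k A) in
/-- The `h`-adic topology of `A` is separated. -/
class IsHSeparated : Prop where
  eq_zero : ∀ x : A, (∀ n, x ∈ hIdeal k A n) → x = 0

variable (k) in
theorem eq_of_sub_mem [IsHSeparated k A] {x y : A} (h : ∀ n, x - y ∈ hIdeal k A n) : x = y :=
  sub_eq_zero.1 (IsHSeparated.eq_zero (k := k) _ h)

theorem HCompl.ext {x y : HCompl k A} (h : ∀ n, HCompl.proj n x = HCompl.proj n y) : x = y :=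
  Subtype.ext (funext h)

theorem HCompl.proj_of (n : ℕ) (a : A) :
    HCompl.proj n (HCompl.of k A a) = Ideal.Quotient.mk (hIdeal k A n) a := rfl

theorem HCompl.factor_proj {m n : ℕ} (h : m ≤ n) (x : HCompl k A) :
    Ideal.Quotient.factor (hIdeal_anti k A h) (HCompl.proj n x) = HCompl.proj m x := x.2 m n h

theorem HCompl.proj_eq_mk_of_le {m n : ℕ} (h : m ≤ n) {x : HCompl k A} {a : A}
    (ha : HCompl.proj n x = Ideal.Quotient.mk _ a) :
    HCompl.proj m x = Ideal.Quotient.mk _ a := by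
  rw [← HCompl.factor_proj h, ha]; rfl

theorem HCompl.proj_eq_zero_of_mem {n : ℕ} {x : HCompl k A}
    (hx : x ∈ hIdeal k (HCompl k A) n) : HCompl.proj n x = 0 := by
  obtain ⟨y, rfl⟩ := hx
  obtain ⟨a, ha⟩ := Ideal.Quotient.mk_surjective (HCompl.proj n y)
  rw [map_smul, ← ha]
  exact Ideal.Quotient.eq_zero_iff_mem.2 ⟨a, rfl⟩

instance : IsHSeparated k (HCompl k A) where
  eq_zero x hx := HCompl.ext fun n => by
    rw [HCompl.proj_eq_zero_of_mem (hx n), map_zero]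

/-- The completion carries its own h-adic topology: the kernel of the projection to level n is
divisible by h^n. As A may have torsion, a quotient cannot be computed level by level; compatible
quotients are built by correcting each one to obtain the next. -/
theorem HCompl.mem_hIdeal_of_proj_eq_zero {n : ℕ} {x : HCompl k A} (hx : HCompl.proj n x = 0) :
    x ∈ hIdeal k (HCompl k A) n := by
  have key : ∀ m, ∀ b : A,
      HCompl.proj (n + m) x = Ideal.Quotient.mk _ ((PowerSeries.X ^ n : k⟦X⟧) • b) →
      ∃ b' : A, HCompl.proj (n + (m + 1)) x =
        Ideal.Quotient.mk _ ((PowerSeries.X ^ n : k⟦X⟧) • b') ∧ b' - b ∈ hIdeal k A m := by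
    intro m b hb
    obtain ⟨a, ha⟩ := Ideal.Quotient.mk_surjective (HCompl.proj (n + (m + 1)) x)
    have h1 := HCompl.proj_eq_mk_of_le (show n + m ≤ n + (m + 1) by omega) ha.symm
    rw [hb, Ideal.Quotient.eq] at h1
    obtain ⟨c, hc⟩ := h1
    -- The lift at level n + m + 1 differs from h^n b by a multiple of h^(n+m); absorbing it changes
    -- b only modulo h^m, so the quotients form a Cauchy sequence.
    refine ⟨b - (PowerSeries.X ^ m : k⟦X⟧) • c, ?_, ⟨-c, by simp⟩⟩
    rw [← ha]
    congr 1
    rw [smul_sub, smul_smul, ← pow_add, ← hc]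
    abel
  choose! g hg hg' using key
  obtain ⟨a0, ha0⟩ := Ideal.Quotient.mk_surjective (HCompl.proj n x)
  let b : ℕ → A := fun m => Nat.rec 0 (fun m b => g m b) m
  have hb : ∀ m, HCompl.proj (n + m) x =
      Ideal.Quotient.mk _ ((PowerSeries.X ^ n : k⟦X⟧) • b m) := by
    intro m
    induction m with
    | zero => simpa [b] using hx
    | succ m ih => exact hg m _ ih
  have hb' : ∀ m, b (m + 1) - b m ∈ hIdeal k A m := fun m => hg' m _ (hb m)
  have hb2 : ∀ m l, b (m + l) - b m ∈ hIdeal k A m := by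
    intro m l
    induction l with
    | zero => simp
    | succ l ih =>
      have := Ideal.add_mem _ (hIdeal_anti k A (Nat.le_add_right m l) (hb' (m + l))) ih
      simpa [add_assoc] using this
  refine ⟨⟨fun m => Ideal.Quotient.mk _ (b m), ?_⟩, ?_⟩
  · intro m l h
    obtain ⟨l, rfl⟩ := Nat.exists_eq_add_of_le h
    exact Ideal.Quotient.eq.2 (hb2 m l)
  · refine HCompl.ext fun m => ?_
    have h1 := HCompl.proj_eq_mk_of_le (Nat.le_add_left m n) (hb m)
    rw [h1]
    rfl

theorem HCompl.mem_hIdeal_iff {n : ℕ} {x : HCompl k A} :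
    x ∈ hIdeal k (HCompl k A) n ↔ HCompl.proj n x = 0 :=
  ⟨HCompl.proj_eq_zero_of_mem, HCompl.mem_hIdeal_of_proj_eq_zero⟩

theorem HCompl.of_mem_hIdeal_iff {n : ℕ} {a : A} :
    HCompl.of k A a ∈ hIdeal k (HCompl k A) n ↔ a ∈ hIdeal k A n := by
  rw [HCompl.mem_hIdeal_iff, HCompl.proj_of, Ideal.Quotient.eq_zero_iff_mem]

theorem HCompl.exists_sub_of_mem (x : HCompl k A) (n : ℕ) :
    ∃ a : A, x - HCompl.of k A a ∈ hIdeal k (HCompl k A) n := by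
  obtain ⟨a, ha⟩ := Ideal.Quotient.mk_surjective (HCompl.proj n x)
  exact ⟨a, by rw [HCompl.mem_hIdeal_iff, map_sub, HCompl.proj_of, ha, sub_self]⟩

theorem HCompl.lift_of (f : A →ₗ[k⟦X⟧] HCompl k B) (a : A) :
    HCompl.lift f (HCompl.of k A a) = f a := rfl

/-- Linearity over k⟦h⟧ already gives h-adic continuity, so density of A and separatedness of the
target suffice. -/
theorem HCompl.linearMap_ext [IsHSeparated k B] {f g : HCompl k A →ₗ[k⟦X⟧] B}
    (h : f ∘ₗ (HCompl.of k A).toLinearMap = g ∘ₗ (HCompl.of k A).toLinearMap) : f = g := by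
  refine LinearMap.ext fun x => eq_of_sub_mem k fun n => ?_
  obtain ⟨a, ha⟩ := HCompl.exists_sub_of_mem x n
  have h1 := map_mem_hIdeal (f - g) ha
  have h2 : f (HCompl.of k A a) = g (HCompl.of k A a) := LinearMap.congr_fun h a
  simpa [h2] using h1

theorem HCompl.of_injective [IsHSeparated k A] : Function.Injective (HCompl.of k A) := by
  intro a b hab
  refine eq_of_sub_mem k fun n => ?_
  rw [← HCompl.of_mem_hIdeal_iff, map_sub, hab, sub_self]
  exact Ideal.zero_mem _

theorem le_hClosure (P : Subalgebra k⟦X⟧ B) : P ≤ hClosure P :=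
  fun x hx n => ⟨x, hx, by simp⟩

theorem hClosure_idem (P : Subalgebra k⟦X⟧ B) : hClosure (hClosure P) = hClosure P := by
  refine le_antisymm (fun x hx n => ?_) (le_hClosure _)
  obtain ⟨y, hy, hxy⟩ := hx n
  obtain ⟨z, hz, hyz⟩ := hy n
  exact ⟨z, hz, by simpa using Ideal.add_mem _ hxy hyz⟩

theorem map_mem_hClosure {P : Subalgebra k⟦X⟧ B} {Q : Subalgebra k⟦X⟧ C} (f : B →ₗ[k⟦X⟧] C)
    (h : ∀ x ∈ P, f x ∈ hClosure Q) {x : B} (hx : x ∈ hClosure P) : f x ∈ hClosure Q := by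
  rw [← hClosure_idem]
  intro n
  obtain ⟨y, hy, hxy⟩ := hx n
  exact ⟨f y, h y hy, by simpa using map_mem_hIdeal f hxy⟩

end Basic

/-! ### Completed tensor powers: place maps, products of maps -/

section Tensor

variable {k : Type*} [Field k] {H : Type*} [Ring H] [Algebra k⟦X⟧ H] {ι κ μ : Type*}
  {B C : Type*} [Ring B] [Algebra k⟦X⟧ B] [Ring C] [Algebra k⟦X⟧ C]

theorem TPow.ext [IsHSeparated k B] {f g : TPow k H ι →ₗ[k⟦X⟧] B}
    (h : ∀ a : ι → H, f (pure k a) = g (pure k a)) : f = g := by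
  refine HCompl.linearMap_ext (PiTensorProduct.ext (MultilinearMap.ext h))

theorem pure_mul (a b : ι → H) : pure k a * pure k b = pure k (a * b) := by
  rw [pure, pure, ← map_mul, PiTensorProduct.tprod_mul_tprod]; rfl

theorem pure_one : pure k (1 : ι → H) = 1 := by
  rw [pure, ← map_one (HCompl.of k _)]; rfl

/-- Multiplicativity is a bilinear identity, so density of pure tensors is used once in each
variable. -/
theorem algHom_of_pure {f : TPow k H ι →ₗ[k⟦X⟧] HCompl k B}
    (h : ∀ a b : ι → H, f (pure k (a * b)) = f (pure k a) * f (pure k b)) (x y : TPow k H ι) :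
    f (x * y) = f x * f y := by
  have h2 : ∀ a : ι → H, f ∘ₗ LinearMap.mulLeft k⟦X⟧ (pure k a) =
      LinearMap.mulLeft k⟦X⟧ (f (pure k a)) ∘ₗ f := fun a => TPow.ext fun b => by
    simp [pure_mul, h]
  have h3 : f ∘ₗ LinearMap.mulRight k⟦X⟧ y = LinearMap.mulRight k⟦X⟧ (f y) ∘ₗ f :=
    TPow.ext fun a => by simpa using LinearMap.congr_fun (h2 a) y
  simpa using LinearMap.congr_fun h3 x

theorem place_pure (e : ι ↪ κ) (a : ι → H) :
    place e (pure k a) = pure k (Function.extend e a 1) := by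
  rw [place, pure, HCompl.lift_of, placeAlg, LinearMap.comp_apply, PiTensorProduct.lift.tprod]
  rfl

theorem place_one (e : ι ↪ κ) : place e (1 : TPow k H ι) = 1 := by
  rw [← pure_one, place_pure, ← pure_one]
  congr 1
  funext c
  by_cases hc : ∃ i, e i = c
  · obtain ⟨i, rfl⟩ := hc
    simp [e.injective.extend_apply]
  · rw [Function.extend_apply' _ _ _ hc]

theorem extend_mul (e : ι ↪ κ) (a b : ι → H) :
    Function.extend e (a * b) 1 = Function.extend e a 1 * Function.extend e b 1 := by
  have := Function.extend_mul e a b 1 1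
  rwa [mul_one] at this

/-- `place e` as an algebra homomorphism. -/
def placeHom (e : ι ↪ κ) : TPow k H ι →ₐ[k⟦X⟧] TPow k H κ :=
  AlgHom.ofLinearMap (place e) (place_one e) (algHom_of_pure fun a b => by
    rw [place_pure, extend_mul, place_pure, place_pure, pure_mul])

@[simp]
theorem placeHom_apply (e : ι ↪ κ) (x : TPow k H ι) : placeHom e x = place e x := rfl

theorem place_mul (e : ι ↪ κ) (x y : TPow k H ι) : place e (x * y) = place e x * place e y :=
  map_mul (placeHom e) x y

theorem single_apply [DecidableEq κ] (c : κ) (a : H) :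
    single c a = pure k (Pi.mulSingle c a) := by
  simp only [single, pure, AlgHom.comp_apply, PiTensorProduct.singleAlgHom_apply]
  rfl

theorem place_single [DecidableEq ι] [DecidableEq κ] (e : ι ↪ κ) (i : ι) (a : H) :
    place e (single i a) = (single (e i) a : TPow k H κ) := by
  rw [single_apply, single_apply, place_pure, Pi.mulSingle, Pi.mulSingle, extend_update]
  congr 2
  funext c
  by_cases hc : ∃ i, e i = c
  · obtain ⟨i, rfl⟩ := hc
    simp [e.injective.extend_apply]
  · rw [Function.extend_apply' _ _ _ hc]

theorem place_comp_single [DecidableEq ι] [DecidableEq κ] (e : ι ↪ κ) (i : ι) :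
    (placeHom e).comp (single i) = (single (e i) : H →ₐ[k⟦X⟧] TPow k H κ) :=
  AlgHom.ext fun a => place_single e i a

theorem place_place (e : ι ↪ κ) (e' : κ ↪ μ) (x : TPow k H ι) :
    place e' (place e x) = place (e.trans e') x := by
  have : place e' ∘ₗ place e = (place (e.trans e') : TPow k H ι →ₗ[k⟦X⟧] TPow k H μ) :=
    TPow.ext fun a => by
      simp only [LinearMap.comp_apply, place_pure]
      congr 1
      funext c
      by_cases hc : ∃ j, e' j = c
      · obtain ⟨j, rfl⟩ := hc
        rw [e'.injective.extend_apply]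
        by_cases hj : ∃ i, e i = j
        · obtain ⟨i, rfl⟩ := hj
          rw [e.injective.extend_apply]
          exact ((e.trans e').injective.extend_apply a 1 i).symm
        · rw [Function.extend_apply' _ _ _ hj, Function.extend_apply']
          · rfl
          · rintro ⟨i, hi⟩
            exact hj ⟨i, e'.injective hi⟩
      · rw [Function.extend_apply' _ _ _ hc, Function.extend_apply' _ _ _]
        rintro ⟨i, hi⟩
        exact hc ⟨e i, hi⟩
  exact LinearMap.congr_fun this x

theorem single_commute [DecidableEq κ] {c d : κ} (h : c ≠ d) (a b : H) :
    Commute (single c a : TPow k H κ) (single d b) := by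
  rw [Commute, SemiconjBy, single_apply, single_apply, pure_mul, pure_mul]
  congr 1
  exact Pi.mulSingle_commute (f := fun _ : κ => H) h a b

theorem tens_pure (f g : H →ₗ[k⟦X⟧] HCompl k B) (a : Fin 2 → H) :
    tens f g (pure k a) = f (a 0) * g (a 1) := by
  rw [tens, pure, HCompl.lift_of, PiTensorProduct.lift.tprod]
  simp

theorem pure_fin_two (a : Fin 2 → H) : pure k a = single 0 (a 0) * single 1 (a 1) := by
  rw [single_apply, single_apply, pure_mul]
  congr 1
  funext i
  fin_cases i <;> simp

theorem tens_single_mul_single (f g : H →ₗ[k⟦X⟧] HCompl k B) (a b : H) :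
    tens f g (single 0 a * single 1 b) = f a * g b := by
  have := tens_pure f g ![a, b]
  rwa [pure_fin_two] at this

theorem tens_one (f g : H →ₐ[k⟦X⟧] HCompl k B) : tens f.toLinearMap g.toLinearMap 1 = 1 := by
  rw [← pure_one, tens_pure]; simp

/-- `tens f g` as an algebra homomorphism, when the images of `f` and `g` commute. -/
def tensHom (f g : H →ₐ[k⟦X⟧] HCompl k B) (hfg : ∀ a b, Commute (f a) (g b)) :
    TPow k H (Fin 2) →ₐ[k⟦X⟧] HCompl k B :=
  AlgHom.ofLinearMap (tens f.toLinearMap g.toLinearMap) (tens_one f g)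
    (algHom_of_pure fun a b => by
      simp only [tens_pure, Pi.mul_apply, AlgHom.toLinearMap_apply, map_mul]
      rw [mul_assoc, ← mul_assoc (f (b 0)), (hfg (b 0) (a 1)).eq]
      simp only [mul_assoc])

theorem algHom_comp_tens (ψ : HCompl k B →ₐ[k⟦X⟧] HCompl k C) (f g : H →ₗ[k⟦X⟧] HCompl k B)
    (x : TPow k H (Fin 2)) :
    ψ (tens f g x) = tens (ψ.toLinearMap ∘ₗ f) (ψ.toLinearMap ∘ₗ g) x := by
  have : ψ.toLinearMap ∘ₗ tens f g = tens (ψ.toLinearMap ∘ₗ f) (ψ.toLinearMap ∘ₗ g) :=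
    TPow.ext fun a => by simp [tens_pure]
  exact LinearMap.congr_fun this x

theorem place_emb_pure {κ : Type*} [DecidableEq κ] {c d : κ} (h : c ≠ d) (a : Fin 2 → H) :
    place (emb c d h) (pure k a) = single c (a 0) * single d (a 1) := by
  rw [pure_fin_two, place_mul, place_single, place_single]
  rfl

theorem place_emb_eq_tens {κ : Type*} [DecidableEq κ] {c d : κ} (h : c ≠ d) :
    (place (emb c d h) : TPow k H (Fin 2) →ₗ[k⟦X⟧] TPow k H κ) =
      tens (B := ⨂[k⟦X⟧] _ : κ, H) (single c).toLinearMap (single d).toLinearMap :=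
  TPow.ext fun a => by rw [place_emb_pure, tens_pure]; rfl

theorem commute_of_pure {f : TPow k H ι →ₗ[k⟦X⟧] HCompl k B} {y : HCompl k B}
    (h : ∀ a, Commute (f (pure k a)) y) (x : TPow k H ι) : Commute (f x) y := by
  have : LinearMap.mulRight k⟦X⟧ y ∘ₗ f = LinearMap.mulLeft k⟦X⟧ y ∘ₗ f := TPow.ext fun a => by
    simpa using (h a).eq
  have h2 := LinearMap.congr_fun this x
  simp only [LinearMap.comp_apply, LinearMap.mulRight_apply, LinearMap.mulLeft_apply] at h2
  exact h2

theorem place_commute_single [DecidableEq κ] (e : ι ↪ κ) {c : κ} (hc : c ∉ Set.range e)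
    (x : TPow k H ι) (b : H) : Commute (place e x) (single c b) := by
  refine commute_of_pure (f := place e) (fun a => ?_) x
  rw [place_pure, single_apply, Commute, SemiconjBy, pure_mul, pure_mul]
  congr 1
  funext d
  by_cases hd : d = c
  · subst hd
    simp [Function.extend_apply' a (1 : κ → H) d (by simpa using hc)]
  · simp [hd]

end Tensor

end

end HAdic

namespace HAdic

noncomputable section

/-! ### Ordered products of linear maps on tensor powers -/

section TensFin

variable {k : Type*} [Field k] {H : Type*} [Ring H] [Algebra k⟦X⟧ H]
  {B C : Type*} [Ring B] [Algebra k⟦X⟧ B] [Ring C] [Algebra k⟦X⟧ C]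

/-- The continuous linear map `a₁ ⊗ ⋯ ⊗ aₙ ↦ f₁ a₁ ⋯ fₙ aₙ`. -/
def tensFin {n : ℕ} (f : Fin n → H →ₗ[k⟦X⟧] HCompl k B) : TPow k H (Fin n) →ₗ[k⟦X⟧] HCompl k B :=
  HCompl.lift (PiTensorProduct.lift
    ((MultilinearMap.mkPiAlgebraFin k⟦X⟧ n (HCompl k B)).compLinearMap f))

theorem tensFin_pure {n : ℕ} (f : Fin n → H →ₗ[k⟦X⟧] HCompl k B) (a : Fin n → H) :
    tensFin f (pure k a) = (List.ofFn fun i => f i (a i)).prod := by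
  rw [tensFin, pure, HCompl.lift_of, PiTensorProduct.lift.tprod]
  simp

theorem tens_add_left (f f' g : H →ₗ[k⟦X⟧] HCompl k B) :
    tens (f + f') g = tens f g + tens f' g :=
  TPow.ext fun a => by simp [tens_pure, add_mul]

theorem tens_add_right (f g g' : H →ₗ[k⟦X⟧] HCompl k B) :
    tens f (g + g') = tens f g + tens f g' :=
  TPow.ext fun a => by simp [tens_pure, mul_add]

theorem j₁₂_pure (a : Fin 2 → H) : j₁₂ (pure k a) = single 0 (a 0) * single 1 (a 1) :=
  place_emb_pure _ a

theorem j₁₃_pure (a : Fin 2 → H) : j₁₃ (pure k a) = single 0 (a 0) * single 2 (a 1) :=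
  place_emb_pure _ a

theorem j₂₃_pure (a : Fin 2 → H) : j₂₃ (pure k a) = single 1 (a 0) * single 2 (a 1) :=
  place_emb_pure _ a

theorem pure_fin_three (a : Fin 3 → H) :
    pure k a = single 0 (a 0) * single 1 (a 1) * single 2 (a 2) := by
  rw [single_apply, single_apply, single_apply, pure_mul, pure_mul]
  congr 1
  funext i
  fin_cases i <;> simp

theorem tensFin_single_mul (f : Fin 3 → H →ₗ[k⟦X⟧] HCompl k B) (a b c : H) :
    tensFin f (single 0 a * single 1 b * single 2 c) = f 0 a * f 1 b * f 2 c := by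
  have := tensFin_pure f ![a, b, c]
  rw [pure_fin_three] at this
  simpa [List.ofFn_succ, mul_assoc] using this

theorem tensFin_j₁₂_mul (f : Fin 3 → H →ₗ[k⟦X⟧] HCompl k B) (x : TPow k H (Fin 2)) (b : H) :
    tensFin f (j₁₂ x * single 2 b) = tens (f 0) (f 1) x * f 2 b := by
  have : tensFin f ∘ₗ LinearMap.mulRight k⟦X⟧ (single 2 b) ∘ₗ j₁₂ =
      LinearMap.mulRight k⟦X⟧ (f 2 b) ∘ₗ tens (f 0) (f 1) := TPow.ext fun a => by
    simp only [LinearMap.comp_apply, LinearMap.mulRight_apply, j₁₂_pure, tens_pure]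
    rw [tensFin_single_mul]
  exact LinearMap.congr_fun this x

theorem tensFin_mul_j₂₃ (f : Fin 3 → H →ₗ[k⟦X⟧] HCompl k B) (x : TPow k H (Fin 2)) (b : H) :
    tensFin f (single 0 b * j₂₃ x) = f 0 b * tens (f 1) (f 2) x := by
  have : tensFin f ∘ₗ LinearMap.mulLeft k⟦X⟧ (single 0 b) ∘ₗ j₂₃ =
      LinearMap.mulLeft k⟦X⟧ (f 0 b) ∘ₗ tens (f 1) (f 2) := TPow.ext fun a => by
    simp only [LinearMap.comp_apply, LinearMap.mulLeft_apply, j₂₃_pure, tens_pure]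
    rw [← mul_assoc, tensFin_single_mul, mul_assoc]
  exact LinearMap.congr_fun this x

/-- With `tensFin_idTens`, this turns coassociativity into associativity of convolution, and lets
the hexagon identities be evaluated in any target algebra. -/
theorem tensFin_tensId (f : Fin 3 → H →ₗ[k⟦X⟧] HCompl k B) (D : H →ₗ[k⟦X⟧] TPow k H (Fin 2))
    (x : TPow k H (Fin 2)) :
    tensFin f (tensId D x) = tens (tens (f 0) (f 1) ∘ₗ D) (f 2) x := by
  have : tensFin f ∘ₗ tensId D = tens (tens (f 0) (f 1) ∘ₗ D) (f 2) := TPow.ext fun a => by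
    rw [LinearMap.comp_apply, tensId, tens_pure, tens_pure]
    exact tensFin_j₁₂_mul f _ _
  exact LinearMap.congr_fun this x

theorem tensFin_idTens (f : Fin 3 → H →ₗ[k⟦X⟧] HCompl k B) (D : H →ₗ[k⟦X⟧] TPow k H (Fin 2))
    (x : TPow k H (Fin 2)) :
    tensFin f (idTens D x) = tens (f 0) (tens (f 1) (f 2) ∘ₗ D) x := by
  have : tensFin f ∘ₗ idTens D = tens (f 0) (tens (f 1) (f 2) ∘ₗ D) := TPow.ext fun a => by
    rw [LinearMap.comp_apply, idTens, tens_pure, tens_pure]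
    exact tensFin_mul_j₂₃ f _ _
  exact LinearMap.congr_fun this x

theorem tensFin_three_mul (f : Fin 3 → H →ₐ[k⟦X⟧] HCompl k B)
    (hf : ∀ i j, i ≠ j → ∀ a b, Commute (f i a) (f j b)) (x y : TPow k H (Fin 3)) :
    tensFin (fun i => (f i).toLinearMap) (x * y) =
      tensFin (fun i => (f i).toLinearMap) x * tensFin (fun i => (f i).toLinearMap) y := by
  refine algHom_of_pure (fun a b => ?_) x y
  · simp only [tensFin_pure, List.ofFn_succ, List.ofFn_zero, List.prod_cons, List.prod_nil,
      AlgHom.toLinearMap_apply, Pi.mul_apply, map_mul, mul_one]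
    simp only [Fin.succ_zero_eq_one, Fin.succ_one_eq_two]
    have h1 := (hf 0 1 (by decide) (b 0) (a 1)).eq
    have h2 := (hf 0 2 (by decide) (b 0) (a 2)).eq
    have h3 := (hf 1 2 (by decide) (b 1) (a 2)).eq
    generalize f 0 (a 0) = x0, f 1 (a 1) = x1, f 2 (a 2) = x2 at *
    generalize f 0 (b 0) = y0, f 1 (b 1) = y1, f 2 (b 2) = y2 at *
    simp only [mul_assoc]
    rw [← mul_assoc y0 x1, h1, mul_assoc, ← mul_assoc y1 x2, h3, mul_assoc, ← mul_assoc y0 x2, h2,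
      mul_assoc]

theorem tensFin_j₁₃ (f : Fin 3 → H →ₗ[k⟦X⟧] HCompl k B) (h1 : f 1 1 = 1)
    (x : TPow k H (Fin 2)) : tensFin f (j₁₃ x) = tens (f 0) (f 2) x := by
  have : tensFin f ∘ₗ j₁₃ = tens (f 0) (f 2) := TPow.ext fun a => by
    have := tensFin_single_mul f (a 0) 1 (a 1)
    rw [LinearMap.comp_apply, j₁₃_pure, tens_pure]
    simpa [h1] using this
  exact LinearMap.congr_fun this x

theorem tensFin_j₂₃ (f : Fin 3 → H →ₗ[k⟦X⟧] HCompl k B) (h1 : f 0 1 = 1)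
    (x : TPow k H (Fin 2)) : tensFin f (j₂₃ x) = tens (f 1) (f 2) x := by
  simpa [h1] using tensFin_mul_j₂₃ f x 1

theorem tensFin_j₁₂ (f : Fin 3 → H →ₗ[k⟦X⟧] HCompl k B) (h1 : f 2 1 = 1)
    (x : TPow k H (Fin 2)) : tensFin f (j₁₂ x) = tens (f 0) (f 1) x := by
  simpa [h1] using tensFin_j₁₂_mul f x 1

theorem finSnoc_extend {n : ℕ} (a : Fin n → H) (i : Fin (n + 1)) :
    Function.extend Fin.castSucc a 1 i = (Fin.snoc a 1 : Fin (n + 1) → H) i := by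
  refine Fin.lastCases ?_ (fun j => ?_) i
  · rw [Function.extend_apply' _ _ _ (by rintro ⟨j, hj⟩; exact j.castSucc_ne_last hj)]
    simp
  · rw [(Fin.castSucc_injective n).extend_apply]; simp

theorem tensFin_place_castSucc_mul {n : ℕ} (f : Fin (n + 1) → H →ₗ[k⟦X⟧] HCompl k B)
    (x : TPow k H (Fin n)) (b : H) :
    tensFin f (place Fin.castSuccEmb x * single (Fin.last n) b) =
      tensFin (fun i => f i.castSucc) x * f (Fin.last n) b := by
  have : tensFin f ∘ₗ LinearMap.mulRight k⟦X⟧ (single (Fin.last n) b) ∘ₗ place Fin.castSuccEmb =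
      LinearMap.mulRight k⟦X⟧ (f (Fin.last n) b) ∘ₗ tensFin (fun i => f i.castSucc) :=
    TPow.ext fun a => by
      simp only [LinearMap.comp_apply, LinearMap.mulRight_apply, place_pure, tensFin_pure,
        single_apply, pure_mul]
      rw [List.ofFn_succ_last, List.prod_append, List.prod_singleton]
      simp [finSnoc_extend]
  exact LinearMap.congr_fun this x

end TensFin

/-! ### The convolution algebra -/

namespace TopHopf

variable {k : Type*} [Field k] {H : Type*} [Ring H] [Algebra k⟦X⟧ H] (𝓗 : TopHopf k H)
  (B : Type*) [Ring B] [Algebra k⟦X⟧ B] {C : Type*} [Ring C] [Algebra k⟦X⟧ C]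

/-- The convolution algebra of linear maps from `H` to the completion of `B`. -/
def Conv (_ : TopHopf k H) : Type _ := H →ₗ[k⟦X⟧] HCompl k B

namespace Conv

instance : AddCommGroup (𝓗.Conv B) := inferInstanceAs (AddCommGroup (H →ₗ[k⟦X⟧] HCompl k B))

instance : FunLike (𝓗.Conv B) H (HCompl k B) :=
  inferInstanceAs (FunLike (H →ₗ[k⟦X⟧] HCompl k B) H (HCompl k B))

instance : LinearMapClass (𝓗.Conv B) k⟦X⟧ H (HCompl k B) :=
  inferInstanceAs (LinearMapClass (H →ₗ[k⟦X⟧] HCompl k B) k⟦X⟧ H (HCompl k B))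

variable {B}

/-- A linear map as an element of the convolution algebra. -/
def ofLin (f : H →ₗ[k⟦X⟧] HCompl k B) : 𝓗.Conv B := f

/-- An algebra map as an element of the convolution algebra. -/
def ofAlg (f : H →ₐ[k⟦X⟧] HCompl k B) : 𝓗.Conv B := f.toLinearMap

variable {𝓗}

/-- The linear map underlying an element of the convolution algebra. -/
def lin (f : 𝓗.Conv B) : H →ₗ[k⟦X⟧] HCompl k B := f

@[ext]
theorem ext {f g : 𝓗.Conv B} (h : ∀ a, f a = g a) : f = g := LinearMap.ext h

@[simp] theorem lin_apply (f : 𝓗.Conv B) (a : H) : f.lin a = f a := rfl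
@[simp] theorem ofLin_apply (f : H →ₗ[k⟦X⟧] HCompl k B) (a : H) : ofLin 𝓗 f a = f a := rfl
@[simp] theorem ofAlg_apply (f : H →ₐ[k⟦X⟧] HCompl k B) (a : H) : ofAlg 𝓗 f a = f a := rfl
@[simp] theorem add_apply (f g : 𝓗.Conv B) (a : H) : (f + g) a = f a + g a := rfl
@[simp] theorem sub_apply (f g : 𝓗.Conv B) (a : H) : (f - g) a = f a - g a := rfl
@[simp] theorem zero_apply (a : H) : (0 : 𝓗.Conv B) a = 0 := rfl
theorem add_lin (f g : 𝓗.Conv B) : (f + g).lin = f.lin + g.lin := rfl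

instance : Mul (𝓗.Conv B) := ⟨fun f g => (tens f.lin g.lin ∘ₗ 𝓗.comul.toLinearMap :)⟩
instance : One (𝓗.Conv B) := ⟨(Algebra.linearMap k⟦X⟧ (HCompl k B) ∘ₗ 𝓗.counit.toLinearMap :)⟩

theorem mul_apply (f g : 𝓗.Conv B) (a : H) : (f * g) a = tens f.lin g.lin (𝓗.comul a) := rfl

theorem mul_lin (f g : 𝓗.Conv B) : (f * g).lin = tens f.lin g.lin ∘ₗ 𝓗.comul.toLinearMap := rfl

theorem one_apply (a : H) : (1 : 𝓗.Conv B) a = algebraMap k⟦X⟧ (HCompl k B) (𝓗.counit a) := rfl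

theorem linearMap_comp_tens (F : HCompl k C →ₗ[k⟦X⟧] HCompl k B) (f g : H →ₗ[k⟦X⟧] HCompl k C)
    (f' g' : H →ₗ[k⟦X⟧] HCompl k B) (h : ∀ a b, F (f a * g b) = f' a * g' b)
    (x : TPow k H (Fin 2)) : F (tens f g x) = tens f' g' x := by
  have : F ∘ₗ tens f g = tens f' g' := TPow.ext fun a => by
    simp [tens_pure, h]
  exact LinearMap.congr_fun this x

instance : Ring (𝓗.Conv B) where
  __ := (inferInstance : AddCommGroup (𝓗.Conv B))
  left_distrib f g h := by
    ext a; simp only [mul_apply, add_lin, tens_add_right, add_apply, LinearMap.add_apply]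
  right_distrib f g h := by
    ext a; simp only [mul_apply, add_lin, tens_add_left, add_apply, LinearMap.add_apply]
  zero_mul f := by
    have : tens (0 : H →ₗ[k⟦X⟧] HCompl k B) f.lin = 0 := TPow.ext fun a => by simp [tens_pure]
    ext a; exact LinearMap.congr_fun this _
  mul_zero f := by
    have : tens f.lin (0 : H →ₗ[k⟦X⟧] HCompl k B) = 0 := TPow.ext fun a => by simp [tens_pure]
    ext a; exact LinearMap.congr_fun this _
  mul_assoc f g h := by
    ext a
    -- Both bracketings are f ⊗ g ⊗ h applied to the two forms of the threefold coproduct.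
    have h1 := tensFin_tensId ![f.lin, g.lin, h.lin] 𝓗.comul.toLinearMap (𝓗.comul a)
    have h2 := tensFin_idTens ![f.lin, g.lin, h.lin] 𝓗.comul.toLinearMap (𝓗.comul a)
    rw [𝓗.coassoc, h2] at h1
    exact h1.symm
  one_mul f := by
    ext a
    have h := congrArg (HCompl.lift f.lin) (𝓗.counit_left a)
    rw [HCompl.lift_of, linearMap_comp_tens (HCompl.lift f.lin) _ _ (1 : 𝓗.Conv B).lin f.lin] at h
    · exact h
    · intro a b
      simp only [LinearMap.comp_apply, Algebra.linearMap_apply, AlgHom.toLinearMap_apply, lin_apply,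
        one_apply, ← Algebra.smul_def, map_smul, HCompl.lift_of]
  mul_one f := by
    ext a
    have h := congrArg (HCompl.lift f.lin) (𝓗.counit_right a)
    rw [HCompl.lift_of, linearMap_comp_tens (HCompl.lift f.lin) _ _ f.lin (1 : 𝓗.Conv B).lin] at h
    · exact h
    · intro a b
      simp only [LinearMap.comp_apply, Algebra.linearMap_apply, AlgHom.toLinearMap_apply, lin_apply,
        one_apply, ← Algebra.commutes, ← Algebra.smul_def, map_smul, HCompl.lift_of]

/-- Composition with an algebra map is a homomorphism of convolution algebras. -/
def map (ψ : HCompl k B →ₐ[k⟦X⟧] HCompl k C) : 𝓗.Conv B →+* 𝓗.Conv C where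
  toFun f := ofLin 𝓗 (ψ.toLinearMap ∘ₗ f.lin)
  map_one' := by ext a; simp [one_apply]
  map_mul' f g := by ext a; exact algHom_comp_tens ψ f.lin g.lin _
  map_zero' := by ext a; simp
  map_add' f g := by ext a; simp

@[simp]
theorem map_apply (ψ : HCompl k B →ₐ[k⟦X⟧] HCompl k C) (f : 𝓗.Conv B) (a : H) :
    map ψ f a = ψ (f a) := rfl

theorem map_ofAlg (ψ : HCompl k B →ₐ[k⟦X⟧] HCompl k C) (f : H →ₐ[k⟦X⟧] HCompl k B) :
    map ψ (ofAlg 𝓗 f) = ofAlg 𝓗 (ψ.comp f) := rfl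

end Conv

end TopHopf

end

end HAdic

namespace HAdic

noncomputable section

/-! ### Ordered convolution products and iterated coproducts -/

theorem eq_one_of_isUnit_of_mul_self {M : Type*} [Monoid M] {x : M} (hx : IsUnit x)
    (h : x = x * x) : x = 1 := by
  obtain ⟨u, rfl⟩ := hx
  have : u = u * u := Units.ext h
  simpa using this

/-- The ordered product of the elements `f c`, for `c` in a set `s` of indices. -/
def prodOn {n : ℕ} {M : Type*} [Monoid M] (s : Finset (Fin n)) (f : Fin n → M) : M :=
  ((List.finRange n).map fun c => if c ∈ s then f c else 1).prod

theorem prod_map_filter_eq {ι M : Type*} [Monoid M] (p : ι → Prop) [DecidablePred p] (f : ι → M)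
    (l : List ι) : ((l.filter p).map f).prod = (l.map fun c => if p c then f c else 1).prod := by
  induction l with
  | nil => rfl
  | cons c l ih =>
    by_cases h : p c <;> simp [h, ih]

theorem map_prodOn {n : ℕ} {M N : Type*} [Monoid M] [Monoid N] (g : M →* N) (s : Finset (Fin n))
    (f : Fin n → M) : g (prodOn s f) = prodOn s (fun c => g (f c)) := by
  rw [prodOn, prodOn, map_list_prod, List.map_map]
  congr 2
  funext c
  by_cases h : c ∈ s <;> simp [h]

theorem finRange_map_orderEmbOfFin {n : ℕ} (s : Finset (Fin n)) :
    (List.finRange s.card).map (TopHopf.enum s) =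
      (List.finRange n).filter (fun c => c ∈ s) := by
  refine List.Perm.eq_of_pairwise' (r := (· < ·)) ?_ ?_ ?_
  · rw [List.pairwise_map]
    exact (List.pairwise_lt_finRange _).imp fun h => (s.orderEmbOfFin rfl).strictMono h
  · exact (List.pairwise_lt_finRange _).filter _
  · rw [List.perm_ext_iff_of_nodup
      ((List.nodup_finRange _).map (TopHopf.enum s).injective)
      ((List.nodup_finRange _).filter _)]
    intro c
    simp [TopHopf.enum]

theorem prod_map_enum {n : ℕ} {M : Type*} [Monoid M] (s : Finset (Fin n)) (f : Fin n → M) :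
    ((List.finRange s.card).map fun c => f (TopHopf.enum s c)).prod = prodOn s f := by
  rw [prodOn, ← prod_map_filter_eq, ← finRange_map_orderEmbOfFin, List.map_map]
  rfl

namespace TopHopf

variable {k : Type*} [Field k] {H : Type*} [Ring H] [Algebra k⟦X⟧ H] {𝓗 : TopHopf k H}
  {B : Type*} [Ring B] [Algebra k⟦X⟧ B] {C : Type*} [Ring C] [Algebra k⟦X⟧ C] {ι κ : Type*}

namespace Conv

variable (𝓗 B) in
/-- The counit, as an algebra map to the completion of `B`. -/
def counitHom : H →ₐ[k⟦X⟧] HCompl k B := (Algebra.ofId k⟦X⟧ (HCompl k B)).comp 𝓗.counit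

theorem one_eq_ofAlg : (1 : 𝓗.Conv B) = ofAlg 𝓗 (counitHom 𝓗 B) := rfl

theorem counitHom_commute (a : H) (y : HCompl k B) : Commute (counitHom 𝓗 B a) y :=
  Algebra.commutes (A := HCompl k B) (𝓗.counit a) y

theorem ofAlg_mul (φ ψ : H →ₐ[k⟦X⟧] HCompl k B) (h : ∀ a b, Commute (φ a) (ψ b)) :
    ofAlg 𝓗 φ * ofAlg 𝓗 ψ = ofAlg 𝓗 ((tensHom φ ψ h).comp 𝓗.comul) := rfl

theorem mul_commute {f g : 𝓗.Conv B} {y : HCompl k B} (hf : ∀ a, Commute (f a) y)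
    (hg : ∀ a, Commute (g a) y) (a : H) : Commute ((f * g) a) y := by
  refine commute_of_pure (f := tens f.lin g.lin) (fun b => ?_) _
  rw [tens_pure]
  exact (hf _).mul_left (hg _)

theorem prod_commute {f : κ → 𝓗.Conv B} {y : HCompl k B} (l : List κ)
    (hf : ∀ c ∈ l, ∀ a, Commute (f c a) y) (a : H) : Commute ((l.map f).prod a) y := by
  induction l generalizing a with
  | nil => exact counitHom_commute a y
  | cons c l ih =>
    rw [List.map_cons, List.prod_cons]
    exact mul_commute (hf c (by simp)) (ih fun d hd => hf d (by simp [hd])) a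

/-- Two algebra maps with commuting images multiply to an algebra map on H ⊗ H, and composing with Δ
gives their convolution product. The induction needs that the partial product still commutes with
the next factor, hence distinct indices. -/
theorem exists_algHom_prod {φ : κ → H →ₐ[k⟦X⟧] HCompl k B}
    (hφ : ∀ c d, c ≠ d → ∀ a b, Commute (φ c a) (φ d b)) (l : List κ) (hl : l.Nodup) :
    ∃ Φ : H →ₐ[k⟦X⟧] HCompl k B, (l.map fun c => ofAlg 𝓗 (φ c)).prod = ofAlg 𝓗 Φ := by
  induction l with
  | nil => exact ⟨counitHom 𝓗 B, rfl⟩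
  | cons c l ih =>
    rw [List.nodup_cons] at hl
    obtain ⟨Φ, hΦ⟩ := ih hl.2
    have h : ∀ a b, Commute (φ c a) (Φ b) := fun a b => by
      have := prod_commute (f := fun c => ofAlg 𝓗 (φ c)) (y := φ c a) l
        (fun d hd b => hφ d c (by rintro rfl; exact hl.1 hd) b a) b
      rw [hΦ] at this
      exact this.symm
    exact ⟨_, by rw [List.map_cons, List.prod_cons, hΦ, ofAlg_mul _ _ h]⟩

/-- Replace by the counit the members of a family of algebra maps with index outside `s`. -/
def restrict {n : ℕ} (𝓗 : TopHopf k H) (s : Finset (Fin n)) (φ : Fin n → H →ₐ[k⟦X⟧] HCompl k B)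
    (c : Fin n) : H →ₐ[k⟦X⟧] HCompl k B :=
  if c ∈ s then φ c else counitHom 𝓗 B

theorem restrict_commute {n : ℕ} {s : Finset (Fin n)} {φ : Fin n → H →ₐ[k⟦X⟧] HCompl k B}
    {y : HCompl k B} {c : Fin n} (h : ∀ a, Commute (φ c a) y) (a : H) :
    Commute (restrict 𝓗 s φ c a) y := by
  rw [restrict]
  split_ifs
  · exact h a
  · exact counitHom_commute a y

theorem restrict_pairwise {n : ℕ} {s : Finset (Fin n)} {φ : Fin n → H →ₐ[k⟦X⟧] HCompl k B}
    (hφ : ∀ c d, c ≠ d → ∀ a b, Commute (φ c a) (φ d b)) (c d : Fin n) (hcd : c ≠ d) (a b : H) :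
    Commute (restrict 𝓗 s φ c a) (restrict 𝓗 s φ d b) :=
  restrict_commute (fun a => (restrict_commute (fun b => (hφ c d hcd a b).symm) b).symm) a

/-- The counit is the convolution unit, so omitted factors may be kept as counits; the list of
factors then no longer depends on the subset. -/
theorem prodOn_eq_restrict {n : ℕ} (s : Finset (Fin n)) (φ : Fin n → H →ₐ[k⟦X⟧] HCompl k B) :
    prodOn s (fun c => ofAlg 𝓗 (φ c)) =
      ((List.finRange n).map fun c => ofAlg 𝓗 (restrict 𝓗 s φ c)).prod := by
  rw [prodOn]
  congr 2
  funext c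
  by_cases h : c ∈ s <;> simp [h, restrict, one_eq_ofAlg]

theorem exists_algHom_prodOn {n : ℕ} {φ : Fin n → H →ₐ[k⟦X⟧] HCompl k B}
    (hφ : ∀ c d, c ≠ d → ∀ a b, Commute (φ c a) (φ d b)) (s : Finset (Fin n)) :
    ∃ Φ : H →ₐ[k⟦X⟧] HCompl k B, prodOn s (fun c => ofAlg 𝓗 (φ c)) = ofAlg 𝓗 Φ := by
  rw [prodOn_eq_restrict]
  exact exists_algHom_prod (restrict_pairwise hφ) _ (List.nodup_finRange n)

theorem prodOn_commute {n : ℕ} {f : Fin n → 𝓗.Conv B} {y : HCompl k B} {s : Finset (Fin n)}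
    (hf : ∀ c ∈ s, ∀ a, Commute (f c a) y) (a : H) : Commute (prodOn s f a) y := by
  rw [prodOn, ← prod_map_filter_eq]
  exact prod_commute _ (fun c hc => hf c (by simpa using hc)) a

end Conv

open Conv

/-- The recursion (Δⁿ ⊗ id) ∘ Δ is convolution with the insertion at the last place, and Δ⁰ = ε is
the empty product. All Δ_Σ thereby become ordered convolution products over Σ. -/
theorem iterComul_eq (n : ℕ) :
    𝓗.iterComul n = ((List.finRange n).map fun c => ofAlg 𝓗 (single c)).prod.lin := by
  induction n with
  | zero => rfl
  | succ n ih =>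
    rw [List.finRange_succ_last, List.map_append, List.prod_append, iterComul, ih, List.map_map]
    simp only [List.map_cons, List.map_nil, List.prod_singleton, mul_lin]
    congr 2
    ext a
    have := congrArg (fun f => f a) (map_list_prod (map (𝓗 := 𝓗) (placeHom Fin.castSuccEmb))
      ((List.finRange n).map fun c => ofAlg 𝓗 (single c)))
    simp only [map_apply, List.map_map, Function.comp_def, map_ofAlg, place_comp_single] at this
    exact this

theorem place_iterComul [DecidableEq κ] {n : ℕ} (e : Fin n ↪ κ) (a : H) :
    place e (𝓗.iterComul n a) =
      ((List.finRange n).map fun c => ofAlg 𝓗 (single (e c))).prod a := by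
  have := congrArg (fun f => f a) (map_list_prod (map (𝓗 := 𝓗) (placeHom e))
      ((List.finRange n).map fun c => ofAlg 𝓗 (single c)))
  simp only [map_apply, List.map_map, Function.comp_def, map_ofAlg, place_comp_single] at this
  rw [iterComul_eq]
  exact this

/-- `Δ_Σ`, as an element of the convolution algebra. -/
def comulOn (𝓗 : TopHopf k H) {n : ℕ} (s : Finset (Fin n)) : 𝓗.Conv (⨂[k⟦X⟧] _ : Fin n, H) :=
  prodOn s fun c => ofAlg 𝓗 (single c)

theorem delta_apply (n : ℕ) (a : H) :
    𝓗.delta n a = ∑ s : Finset (Fin n), ((-1 : k⟦X⟧) ^ (n - s.card)) • 𝓗.comulOn s a := by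
  rw [delta, LinearMap.sum_apply]
  refine Finset.sum_congr rfl fun s _ => ?_
  rw [LinearMap.smul_apply, LinearMap.comp_apply, place_iterComul,
    prod_map_enum s fun c => ofAlg 𝓗 (single c)]
  rfl

/-- The ordered convolution product of the maps `a ↦ a` at the places `(c, i)`, `c ∈ s`. -/
def colOn (𝓗 : TopHopf k H) {n : ℕ} (i : Fin 2) (s : Finset (Fin n)) :
    𝓗.Conv (⨂[k⟦X⟧] _ : Fin n × Fin 2, H) :=
  prodOn s fun c => ofAlg 𝓗 (single (c, i))

/-- `Δ̃_Σ` for the Hopf algebra `H ⊗ H`. -/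
def comulOn₂ (𝓗 : TopHopf k H) {n : ℕ} (s : Finset (Fin n)) :
    TPow k H (Fin 2) →ₗ[k⟦X⟧] TPow k H (Fin n × Fin 2) :=
  tens (𝓗.colOn 0 s).lin (𝓗.colOn 1 s).lin

theorem place_iterComul₂ {n : ℕ} (s : Finset (Fin n)) (x : TPow k H (Fin 2)) :
    place ((enum s).prodMap (Function.Embedding.refl (Fin 2))) (𝓗.iterComul₂ s.card x) =
      𝓗.comulOn₂ s x := by
  have h := algHom_comp_tens (placeHom ((enum s).prodMap (Function.Embedding.refl (Fin 2))))
    (place (Function.Embedding.sectL (Fin s.card) (0 : Fin 2)) ∘ₗ 𝓗.iterComul s.card)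
    (place (Function.Embedding.sectL (Fin s.card) (1 : Fin 2)) ∘ₗ 𝓗.iterComul s.card) x
  have key : ∀ i : Fin 2,
      (placeHom ((enum s).prodMap (Function.Embedding.refl (Fin 2)))).toLinearMap ∘ₗ
      (place (Function.Embedding.sectL (Fin s.card) i) ∘ₗ 𝓗.iterComul s.card) =
      (𝓗.colOn i s).lin := fun i => LinearMap.ext fun a => by
    rw [LinearMap.comp_apply, LinearMap.comp_apply, AlgHom.toLinearMap_apply, placeHom_apply,
      place_place, place_iterComul]
    exact congrArg (fun f : 𝓗.Conv _ => f a)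
      (prod_map_enum s fun c => ofAlg 𝓗 (single (k := k) (H := H) (c, i)))
  rw [key, key] at h
  exact h

theorem delta₂_apply (n : ℕ) (x : TPow k H (Fin 2)) :
    𝓗.delta₂ n x = ∑ s : Finset (Fin n), ((-1 : k⟦X⟧) ^ (n - s.card)) • 𝓗.comulOn₂ s x := by
  rw [delta₂, LinearMap.sum_apply]
  refine Finset.sum_congr rfl fun s _ => ?_
  rw [LinearMap.smul_apply, LinearMap.comp_apply, place_iterComul₂]

theorem single_pairwise [DecidableEq κ] {e : ι → κ} (he : Function.Injective e) (c d : ι)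
    (hcd : c ≠ d) (a b : H) : Commute (single (e c) a : TPow k H κ) (single (e d) b) :=
  single_commute (he.ne hcd) a b

theorem exists_algHom_comulOn (𝓗 : TopHopf k H) {n : ℕ} (s : Finset (Fin n)) :
    ∃ Φ : H →ₐ[k⟦X⟧] TPow k H (Fin n), 𝓗.comulOn s = ofAlg 𝓗 Φ :=
  exists_algHom_prodOn (single_pairwise Function.injective_id) s

theorem exists_algHom_colOn (𝓗 : TopHopf k H) {n : ℕ} (i : Fin 2) (s : Finset (Fin n)) :
    ∃ Φ : H →ₐ[k⟦X⟧] TPow k H (Fin n × Fin 2), 𝓗.colOn i s = ofAlg 𝓗 Φ :=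
  exists_algHom_prodOn (single_pairwise (Prod.mk_left_injective i)) s

theorem colOn_commute {n : ℕ} (s t : Finset (Fin n)) (a b : H) :
    Commute (𝓗.colOn 0 s a) (𝓗.colOn 1 t b) :=
  prodOn_commute (fun _ _ a => (prodOn_commute
    (fun _ _ b => single_commute (by simp) b a) b).symm) a

theorem exists_algHom_comulOn₂ (𝓗 : TopHopf k H) {n : ℕ} (s : Finset (Fin n)) :
    ∃ Φ : TPow k H (Fin 2) →ₐ[k⟦X⟧] TPow k H (Fin n × Fin 2), ∀ x, 𝓗.comulOn₂ s x = Φ x := by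
  obtain ⟨φ, hφ⟩ := 𝓗.exists_algHom_colOn 0 s
  obtain ⟨ψ, hψ⟩ := 𝓗.exists_algHom_colOn 1 s
  have h : ∀ a b, Commute (φ a) (ψ b) := fun a b => by
    have := 𝓗.colOn_commute s s a b
    rwa [hφ, hψ] at this
  refine ⟨tensHom φ ψ h, fun x => ?_⟩
  rw [comulOn₂, hφ, hψ]; rfl

/-! ### The `R`-matrix -/

section RMatrix

variable {R : (TPow k H (Fin 2))ˣ}

/-- Pairwise commuting images make φ ⊗ φ' ⊗ ψ multiplicative on H ⊗ H ⊗ H; apply it to (Δ ⊗ id)(R) =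
R₁₃ R₂₃. -/
theorem IsRMatrix.tens_mul_left (hR : 𝓗.IsRMatrix R) {φ φ' ψ : H →ₐ[k⟦X⟧] HCompl k B}
    (h1 : ∀ a b, Commute (φ a) (φ' b)) (h2 : ∀ a b, Commute (φ a) (ψ b))
    (h3 : ∀ a b, Commute (φ' a) (ψ b)) :
    tens (ofAlg 𝓗 φ * ofAlg 𝓗 φ').lin ψ.toLinearMap (R : TPow k H (Fin 2)) =
      tens φ.toLinearMap ψ.toLinearMap (R : TPow k H (Fin 2)) *
        tens φ'.toLinearMap ψ.toLinearMap (R : TPow k H (Fin 2)) := by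
  have h := tensFin_tensId (fun i => (![φ, φ', ψ] i).toLinearMap) 𝓗.comul.toLinearMap
    (R : TPow k H (Fin 2))
  rw [hR.comul_id, tensFin_three_mul, tensFin_j₁₃, tensFin_j₂₃] at h
  · exact h.symm
  · simp
  · simp
  · intro i j hij a b
    fin_cases i <;> fin_cases j <;> simp at hij <;>
      simp [h1 a b, h2 a b, h3 a b, (h1 b a).symm, (h2 b a).symm, (h3 b a).symm]

/-- Same argument with (id ⊗ Δ)(R) = R₁₃ R₁₂, which reverses the order of the factors. -/
theorem IsRMatrix.tens_mul_right (hR : 𝓗.IsRMatrix R) {φ ψ ψ' : H →ₐ[k⟦X⟧] HCompl k B}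
    (h1 : ∀ a b, Commute (φ a) (ψ b)) (h2 : ∀ a b, Commute (φ a) (ψ' b))
    (h3 : ∀ a b, Commute (ψ a) (ψ' b)) :
    tens φ.toLinearMap (ofAlg 𝓗 ψ * ofAlg 𝓗 ψ').lin (R : TPow k H (Fin 2)) =
      tens φ.toLinearMap ψ'.toLinearMap (R : TPow k H (Fin 2)) *
        tens φ.toLinearMap ψ.toLinearMap (R : TPow k H (Fin 2)) := by
  have h := tensFin_idTens (fun i => (![φ, ψ, ψ'] i).toLinearMap) 𝓗.comul.toLinearMap
    (R : TPow k H (Fin 2))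
  rw [hR.id_comul, tensFin_three_mul, tensFin_j₁₃, tensFin_j₁₂] at h
  · exact h.symm
  · simp
  · simp
  · intro i j hij a b
    fin_cases i <;> fin_cases j <;> simp at hij <;>
      simp [h1 a b, h2 a b, h3 a b, (h1 b a).symm, (h2 b a).symm, (h3 b a).symm]

/-- Since ε is idempotent for convolution, the hexagon makes (ε ⊗ ψ)(R) an idempotent, and an
invertible idempotent is 1. -/
theorem IsRMatrix.tens_counit_left (hR : 𝓗.IsRMatrix R) (ψ : H →ₐ[k⟦X⟧] HCompl k B) :
    tens (counitHom 𝓗 B).toLinearMap ψ.toLinearMap (R : TPow k H (Fin 2)) = 1 := by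
  have hc : ∀ a b, Commute (counitHom 𝓗 B a) (ψ b) := fun a b => counitHom_commute _ _
  refine eq_one_of_isUnit_of_mul_self (R.isUnit.map (tensHom _ ψ hc)) ?_
  have := hR.tens_mul_left (fun a b => counitHom_commute a _) hc hc
  rwa [← one_eq_ofAlg, mul_one] at this

theorem IsRMatrix.tens_counit_right (hR : 𝓗.IsRMatrix R) (φ : H →ₐ[k⟦X⟧] HCompl k B) :
    tens φ.toLinearMap (counitHom 𝓗 B).toLinearMap (R : TPow k H (Fin 2)) = 1 := by
  have hc : ∀ a b, Commute (φ b) (counitHom 𝓗 B a) := fun a b => (counitHom_commute _ _).symm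
  refine eq_one_of_isUnit_of_mul_self (R.isUnit.map (tensHom φ _ fun a b => hc b a)) ?_
  have := hR.tens_mul_right (fun a b => hc b a) (fun a b => hc b a)
    (fun a b => counitHom_commute a (counitHom 𝓗 B b))
  rwa [← one_eq_ofAlg, mul_one] at this

theorem IsRMatrix.tens_prod_left (hR : 𝓗.IsRMatrix R) {φ : κ → H →ₐ[k⟦X⟧] HCompl k B}
    {ψ : H →ₐ[k⟦X⟧] HCompl k B}
    (hφ : ∀ c d, c ≠ d → ∀ a b, Commute (φ c a) (φ d b))
    (h : ∀ c a b, Commute (φ c a) (ψ b)) (l : List κ) (hl : l.Nodup) :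
    tens (l.map fun c => ofAlg 𝓗 (φ c)).prod.lin ψ.toLinearMap (R : TPow k H (Fin 2)) =
      (l.map fun c => tens (φ c).toLinearMap ψ.toLinearMap (R : TPow k H (Fin 2))).prod := by
  induction l with
  | nil => exact hR.tens_counit_left ψ
  | cons c l ih =>
    rw [List.nodup_cons] at hl
    obtain ⟨Φ, hΦ⟩ := exists_algHom_prod (𝓗 := 𝓗) hφ l hl.2
    have h1 : ∀ a b, Commute (Φ b) (φ c a) := fun a b => by
      have := prod_commute (f := fun c => ofAlg 𝓗 (φ c)) (y := φ c a) l
        (fun d hd b => hφ d c (by rintro rfl; exact hl.1 hd) b a) b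
      rwa [hΦ] at this
    have h2 : ∀ a b, Commute (Φ a) (ψ b) := fun a b => by
      have := prod_commute (f := fun c => ofAlg 𝓗 (φ c)) (y := ψ b) l
        (fun d _ a => h d a b) a
      rwa [hΦ] at this
    rw [List.map_cons, List.prod_cons, List.map_cons, List.prod_cons, ← ih hl.2, hΦ,
      hR.tens_mul_left (fun a b => (h1 a b).symm) (h c) h2]
    rfl

theorem IsRMatrix.tens_prod_right (hR : 𝓗.IsRMatrix R) {ψ : κ → H →ₐ[k⟦X⟧] HCompl k B}
    {φ : H →ₐ[k⟦X⟧] HCompl k B}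
    (hψ : ∀ c d, c ≠ d → ∀ a b, Commute (ψ c a) (ψ d b))
    (h : ∀ c a b, Commute (φ b) (ψ c a)) (l : List κ) (hl : l.Nodup) :
    tens φ.toLinearMap (l.map fun c => ofAlg 𝓗 (ψ c)).prod.lin (R : TPow k H (Fin 2)) =
      (l.reverse.map fun c => tens φ.toLinearMap (ψ c).toLinearMap
        (R : TPow k H (Fin 2))).prod := by
  induction l with
  | nil => exact hR.tens_counit_right φ
  | cons c l ih =>
    rw [List.nodup_cons] at hl
    obtain ⟨Ψ, hΨ⟩ := exists_algHom_prod (𝓗 := 𝓗) hψ l hl.2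
    have h1 : ∀ a b, Commute (Ψ b) (ψ c a) := fun a b => by
      have := prod_commute (f := fun c => ofAlg 𝓗 (ψ c)) (y := ψ c a) l
        (fun d hd b => hψ d c (by rintro rfl; exact hl.1 hd) b a) b
      rwa [hΨ] at this
    have h2 : ∀ a b, Commute (Ψ a) (φ b) := fun a b => by
      have := prod_commute (f := fun c => ofAlg 𝓗 (ψ c)) (y := φ b) l
        (fun d _ a => (h d a b).symm) a
      rwa [hΨ] at this
    rw [List.map_cons, List.prod_cons, List.reverse_cons, List.map_append, List.prod_append,
      ← ih hl.2, hΨ, hR.tens_mul_right (fun a b => h c b a) (fun a b => (h2 b a).symm)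
        (fun a b => (h1 a b).symm)]
    simp only [List.map_cons, List.map_nil, List.prod_singleton]
    rfl

/-- Iterated hexagons: the first leg of R is split in increasing order and the second in decreasing
order. Places outside s carry a counit, and the corresponding factors are 1. -/
theorem IsRMatrix.comulOn₂_eq (hR : 𝓗.IsRMatrix R) {n : ℕ} (s : Finset (Fin n)) :
    𝓗.comulOn₂ s (R : TPow k H (Fin 2)) =
      ((List.finRange n).map fun c => ((List.finRange n).reverse.map fun d =>
        if c ∈ s ∧ d ∈ s then place (emb ((c, 0) : Fin n × Fin 2) (d, 1) (by simp))
          (R : TPow k H (Fin 2)) else 1).prod).prod := by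
  have h0 := restrict_pairwise (𝓗 := 𝓗) (s := s)
    (single_pairwise (k := k) (H := H) (Prod.mk_left_injective (α := Fin n) (0 : Fin 2)))
  have h1 := restrict_pairwise (𝓗 := 𝓗) (s := s)
    (single_pairwise (k := k) (H := H) (Prod.mk_left_injective (α := Fin n) (1 : Fin 2)))
  have h01 : ∀ c d a b, Commute
      (restrict 𝓗 s (fun c => single (k := k) (H := H) ((c, 0) : Fin n × Fin 2)) c a)
      (restrict 𝓗 s (fun c => single (k := k) (H := H) ((c, 1) : Fin n × Fin 2)) d b) :=
    fun c d a b => restrict_commute (fun a => (restrict_commute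
      (fun b => single_commute (c := (d, (1 : Fin 2))) (d := (c, (0 : Fin 2)))
        (by simp) b a) b).symm) a
  obtain ⟨Ψ, hΨ⟩ := exists_algHom_prod (𝓗 := 𝓗) h1 _ (List.nodup_finRange n)
  rw [comulOn₂, colOn, colOn, prodOn_eq_restrict, prodOn_eq_restrict, hΨ]
  refine (hR.tens_prod_left h0 (ψ := Ψ) (fun c a b => ?_) _ (List.nodup_finRange n)).trans ?_
  · have := prod_commute (f := fun d => ofAlg 𝓗 (restrict 𝓗 s _ d)) (List.finRange n)
      (fun d _ b => (h01 c d a b).symm) b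
    rw [hΨ] at this
    exact this.symm
  · congr 2
    funext c
    have h := hR.tens_prod_right h1 (fun d a b => h01 c d b a) _ (List.nodup_finRange n)
    rw [hΨ] at h
    refine h.trans ?_
    congr 2
    funext d
    by_cases hc : c ∈ s
    · by_cases hd : d ∈ s
      · simp only [restrict, hc, hd, if_true, and_self, place_emb_eq_tens]
      · simp only [hd, and_false, if_false, restrict]
        exact hR.tens_counit_right _
    · simp only [hc, false_and, if_false, restrict]
      exact hR.tens_counit_left _

end RMatrix

end TopHopf

end

end HAdic

namespace HAdic

noncomputable section

/-! ### Functions on subsets and their Möbius transforms -/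

section Moebius

variable {R : Type*} [CommRing R] {M : Type*} [AddCommGroup M] [Module R M] {ι : Type*}

variable (R) in
/-- The Möbius transform of a function on finite sets. -/
def moebius (F : Finset ι → M) (s : Finset ι) : M :=
  ∑ t ∈ s.powerset, ((-1 : R) ^ (s.card - t.card)) • F t

theorem moebius_map {κ : Type*} (e : ι ↪ κ) (F : Finset κ → M) (s : Finset ι) :
    moebius R F (s.map e) = moebius R (fun t => F (t.map e)) s := by
  have : (s.map e).powerset = s.powerset.map (Finset.mapEmbedding e).toEmbedding := by
    ext t
    simp only [Finset.mem_powerset, Finset.mem_map, Finset.subset_map_iff]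
    exact ⟨fun ⟨u, hu, h⟩ => ⟨u, hu, h.symm⟩, fun ⟨u, hu, h⟩ => ⟨u, hu, h.symm⟩⟩
  rw [moebius, this, Finset.sum_map, moebius]
  simp

theorem moebius_linearMap {N : Type*} [AddCommGroup N] [Module R N] (g : M →ₗ[R] N)
    (F : Finset ι → M) (s : Finset ι) : g (moebius R F s) = moebius R (fun t => g (F t)) s := by
  simp [moebius]

/-- `F` has a Möbius transform whose value at each `s` lies in `J s`. -/
def IsFiltered (J : Finset ι → AddSubmonoid M) (F : Finset ι → M) : Prop :=
  ∃ f : Finset ι → M, (∀ s, f s ∈ J s) ∧ ∀ s, F s = ∑ t ∈ s.powerset, f t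

theorem IsFiltered.map {N : Type*} [AddCommGroup N] {J : Finset ι → AddSubmonoid M}
    {J' : Finset ι → AddSubmonoid N} {F : Finset ι → M}
    (h : IsFiltered J F) (g : M →+ N) (hg : ∀ s, ∀ x ∈ J s, g x ∈ J' s) :
    IsFiltered J' fun s => g (F s) := by
  obtain ⟨f, hf, hF⟩ := h
  exact ⟨fun s => g (f s), fun s => hg s _ (hf s),
    fun s => (congrArg g (hF s)).trans (map_sum _ _ _)⟩

variable [DecidableEq ι]

/-- Splitting the subsets of s ∪ {c} by membership of c makes the Möbius transform an iterated
difference, which drives the inductions on s. -/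
theorem moebius_insert (F : Finset ι → M) {s : Finset ι} {c : ι} (hc : c ∉ s) :
    moebius R F (insert c s) = moebius R (fun t => F (insert c t)) s - moebius R F s := by
  have h1 : ∀ t ∈ s.powerset, ((-1 : R) ^ ((insert c s).card - t.card)) • F t =
      -(((-1 : R) ^ (s.card - t.card)) • F t) := fun t ht => by
    have := Finset.card_le_card (Finset.mem_powerset.1 ht)
    rw [Finset.card_insert_of_notMem hc, Nat.succ_sub this, pow_succ]
    simp
  have h2 : ∀ t ∈ s.powerset,
      ((-1 : R) ^ ((insert c s).card - (insert c t).card)) • F (insert c t) =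
      ((-1 : R) ^ (s.card - t.card)) • F (insert c t) := fun t ht => by
    rw [Finset.card_insert_of_notMem hc,
      Finset.card_insert_of_notMem fun h => hc (Finset.mem_powerset.1 ht h), Nat.add_sub_add_right]
  rw [moebius, Finset.sum_powerset_insert hc, Finset.sum_congr rfl h1, Finset.sum_congr rfl h2,
    Finset.sum_neg_distrib, moebius, moebius]
  abel

theorem sum_powerset_moebius (F : Finset ι → M) (s : Finset ι) :
    ∑ t ∈ s.powerset, moebius R F t = F s := by
  induction s using Finset.induction_on generalizing F with
  | empty => simp [moebius]
  | insert c s hc ih =>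
    rw [Finset.sum_powerset_insert hc, Finset.sum_congr rfl
      fun t ht => moebius_insert F fun h => hc (Finset.mem_powerset.1 ht h),
      Finset.sum_sub_distrib, ih, ih]
    abel

theorem eq_of_sum_powerset_eq {f g : Finset ι → M}
    (h : ∀ s : Finset ι, ∑ t ∈ s.powerset, f t = ∑ t ∈ s.powerset, g t) (s : Finset ι) :
    f s = g s := by
  induction s using Finset.strongInduction with
  | H s ih =>
    have h1 := h s
    rw [← Finset.sum_erase_add _ _ (Finset.mem_powerset_self s),
      ← Finset.sum_erase_add _ _ (Finset.mem_powerset_self s),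
      Finset.sum_congr rfl fun t ht => ih t (by
        rw [Finset.mem_erase, Finset.mem_powerset] at ht
        exact Finset.ssubset_iff_subset_ne.2 ⟨ht.2, ht.1⟩)] at h1
    exact add_left_cancel h1

theorem moebius_eq_of_sum {F f : Finset ι → M} (h : ∀ s : Finset ι, F s = ∑ t ∈ s.powerset, f t)
    (s : Finset ι) : moebius R F s = f s :=
  eq_of_sum_powerset_eq (fun s => by rw [sum_powerset_moebius, h]) s

theorem IsFiltered.moebius_mem {J : Finset ι → AddSubmonoid M} {F : Finset ι → M}
    (h : IsFiltered J F) (s : Finset ι) : moebius R F s ∈ J s := by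
  obtain ⟨f, hf, hF⟩ := h
  rw [moebius_eq_of_sum hF]
  exact hf s

theorem isFiltered_of_moebius_mem {J : Finset ι → AddSubmonoid M} {F : Finset ι → M}
    (h : ∀ s, moebius R F s ∈ J s) : IsFiltered J F :=
  ⟨moebius R F, h, fun s => (sum_powerset_moebius F s).symm⟩

/-- Expand both arguments and group the pairs (t, u) by their union: both sets lie in s exactly when
t ∪ u does. Multiplication in an algebra is one case; multiplication by an integer-valued indicator
is another. -/
theorem IsFiltered.map₂ {N P : Type*} [AddCommGroup N] [AddCommGroup P] [Fintype ι]
    {J : Finset ι → AddSubmonoid M} {J' : Finset ι → AddSubmonoid N}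
    {J'' : Finset ι → AddSubmonoid P} {F : Finset ι → M} {G : Finset ι → N}
    (hF : IsFiltered J F) (hG : IsFiltered J' G) (β : M →+ N →+ P)
    (hβ : ∀ s t, ∀ x ∈ J s, ∀ y ∈ J' t, β x y ∈ J'' (s ∪ t)) :
    IsFiltered J'' fun s => β (F s) (G s) := by
  obtain ⟨f, hf, hF⟩ := hF
  obtain ⟨g, hg, hG⟩ := hG
  refine ⟨fun s => ∑ p : Finset ι × Finset ι with p.1 ∪ p.2 = s, β (f p.1) (g p.2),
    fun s => AddSubmonoid.sum_mem _ fun p hp => ?_, fun s => ?_⟩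
  · rw [← (Finset.mem_filter.1 hp).2]
    exact hβ _ _ _ (hf _) _ (hg _)
  · change β (F s) (G s) = _
    rw [hF, hG, map_sum β, AddMonoidHom.finsetSum_apply]
    simp_rw [map_sum]
    rw [← Finset.sum_product', ← Finset.sum_fiberwise_of_maps_to (t := s.powerset)
      (g := fun p : Finset ι × Finset ι => p.1 ∪ p.2)]
    · refine Finset.sum_congr rfl fun t ht => Finset.sum_congr ?_ fun _ _ => rfl
      ext p
      simp only [Finset.mem_filter, Finset.mem_product, Finset.mem_powerset, Finset.mem_univ,
        true_and] at ht ⊢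
      refine ⟨fun h => h.2, fun h => ⟨?_, h⟩⟩
      rw [← Finset.union_subset_iff, h]
      exact ht
    · intro p hp
      simp only [Finset.mem_product, Finset.mem_powerset] at hp ⊢
      exact Finset.union_subset hp.1 hp.2

theorem isFiltered_const {J : Finset ι → AddSubmonoid M} {x : M} (hx : x ∈ J ∅) :
    IsFiltered J fun _ => x := by
  refine ⟨fun s => if s = ∅ then x else 0, fun s => ?_, fun s => ?_⟩
  · beta_reduce
    split_ifs with h
    · rwa [h]
    · exact zero_mem _
  · rw [Finset.sum_ite_eq' s.powerset ∅, if_pos (Finset.empty_mem_powerset s)]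

theorem isFiltered_ite {J : Finset ι → AddSubmonoid M} {x y : M} {c : ι} (hy : y ∈ J ∅)
    (hx : x - y ∈ J {c}) : IsFiltered J fun s => if c ∈ s then x else y := by
  refine ⟨fun s => (if s = ∅ then y else 0) + if s = {c} then x - y else 0, fun s => ?_,
    fun s => ?_⟩
  · refine add_mem ?_ ?_
    · split_ifs with h
      · rwa [h]
      · exact zero_mem _
    · split_ifs with h
      · rwa [h]
      · exact zero_mem _
  · rw [Finset.sum_add_distrib, Finset.sum_ite_eq' s.powerset ∅,
      if_pos (Finset.empty_mem_powerset s), Finset.sum_ite_eq' s.powerset {c}]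
    by_cases h : c ∈ s <;> simp [h]

theorem IsFiltered.mul {A : Type*} [Ring A] [Fintype ι] {J : Finset ι → AddSubmonoid A}
    {F G : Finset ι → A} (hJ : ∀ s t, ∀ x ∈ J s, ∀ y ∈ J t, x * y ∈ J (s ∪ t))
    (hF : IsFiltered J F) (hG : IsFiltered J G) : IsFiltered J fun s => F s * G s :=
  hF.map₂ hG AddMonoidHom.mul hJ

theorem IsFiltered.list_prod {A κ : Type*} [Ring A] [Fintype ι] {J : Finset ι → AddSubmonoid A}
    (h1 : (1 : A) ∈ J ∅) (hJ : ∀ s t, ∀ x ∈ J s, ∀ y ∈ J t, x * y ∈ J (s ∪ t))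
    (F : κ → Finset ι → A) (l : List κ) (h : ∀ c ∈ l, IsFiltered J (F c)) :
    IsFiltered J fun s => (l.map fun c => F c s).prod := by
  induction l with
  | nil => exact isFiltered_const h1
  | cons c l ih =>
    simp only [List.map_cons, List.prod_cons]
    exact (h c (by simp)).mul hJ (ih fun d hd => h d (by simp [hd]))

/-- Each factor, as a function of s, has coefficients 1 at ∅ and f c - 1 at {c}, and zero elsewhere.
-/
theorem isFiltered_prodOn {n : ℕ} {A : Type*} [Ring A] {J : Finset (Fin n) → AddSubmonoid A}
    (h1 : (1 : A) ∈ J ∅) (hJ : ∀ s t, ∀ x ∈ J s, ∀ y ∈ J t, x * y ∈ J (s ∪ t))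
    (f : Fin n → A) (h : ∀ c, f c - 1 ∈ J {c}) :
    IsFiltered J fun s => prodOn s f :=
  IsFiltered.list_prod h1 hJ (fun c s => if c ∈ s then f c else 1) _
    fun c _ => isFiltered_ite h1 (h c)

end Moebius

/-- The filtration of an algebra by the powers of `h`, indexed by the cardinality of subsets. -/
def hFil (k : Type*) [Field k] (A : Type*) [Ring A] [Algebra k⟦X⟧ A] {ι : Type*} (s : Finset ι) :
    AddSubmonoid A :=
  (hIdeal k A s.card).toAddSubmonoid

theorem mem_hFil {k : Type*} [Field k] {A : Type*} [Ring A] [Algebra k⟦X⟧ A] {ι : Type*}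
    {s : Finset ι} {x : A} : x ∈ hFil k A s ↔ x ∈ hIdeal k A s.card := Iff.rfl

theorem one_mem_hFil {k : Type*} [Field k] {A : Type*} [Ring A] [Algebra k⟦X⟧ A] {ι : Type*} :
    (1 : A) ∈ hFil k A (∅ : Finset ι) :=
  mem_hIdeal_zero (1 : A)

theorem hFil_mul {k : Type*} [Field k] {A : Type*} [Ring A] [Algebra k⟦X⟧ A] {ι : Type*}
    [DecidableEq ι] (s t : Finset ι) (x : A) (hx : x ∈ hFil k A s) (y : A) (hy : y ∈ hFil k A t) :
    x * y ∈ hFil k A (s ∪ t) :=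
  hIdeal_anti k A (Finset.card_union_le s t) (mul_mem_hIdeal_add hx hy)

namespace TopHopf

open Conv

variable {k : Type*} [Field k] {H : Type*} [Ring H] [Algebra k⟦X⟧ H] {𝓗 : TopHopf k H}
  {B : Type*} [Ring B] [Algebra k⟦X⟧ B]

/-! ### Drinfeld's subalgebras, in terms of filtered functions -/

theorem prodOn_map_enum {n : ℕ} {M : Type*} [Monoid M] (s : Finset (Fin n))
    (t : Finset (Fin s.card)) (f : Fin n → M) :
    prodOn (t.map (enum s)) f = prodOn t fun c => f (enum s c) := by
  have h := prod_map_enum s fun c => if c ∈ t.map (enum s) then f c else 1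
  simp only [Finset.mem_map'] at h
  change _ = ((List.finRange s.card).map _).prod
  rw [h, prodOn, prodOn]
  congr 2
  funext c
  by_cases hc : c ∈ s
  · simp [hc]
  · have : c ∉ t.map (enum s) := fun h => by
      obtain ⟨d, _, rfl⟩ := Finset.mem_map.1 h
      exact hc (s.orderEmbOfFin_mem rfl d)
    rw [if_neg hc, if_neg this]

theorem univ_map_enum {n : ℕ} (s : Finset (Fin n)) : Finset.univ.map (enum s) = s := by
  ext c
  simp [enum]

theorem place_comulOn {n : ℕ} (s : Finset (Fin n)) (t : Finset (Fin s.card)) (a : H) :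
    place (enum s) (𝓗.comulOn t a) = 𝓗.comulOn (t.map (enum s)) a := by
  have := congrArg (fun f => f a) (map_prodOn (map (𝓗 := 𝓗) (placeHom (enum s))).toMonoidHom t
    fun c => ofAlg 𝓗 (single c))
  rw [comulOn, comulOn, prodOn_map_enum]
  simp only [RingHom.toMonoidHom_eq_coe, MonoidHom.coe_coe, map_apply, map_ofAlg,
    place_comp_single] at this
  exact this

theorem place_comulOn₂ {n : ℕ} (s : Finset (Fin n)) (t : Finset (Fin s.card))
    (x : TPow k H (Fin 2)) :
    place ((enum s).prodMap (Function.Embedding.refl (Fin 2))) (𝓗.comulOn₂ t x) =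
      𝓗.comulOn₂ (t.map (enum s)) x := by
  have key : ∀ i, map (placeHom ((enum s).prodMap (Function.Embedding.refl (Fin 2))))
      (𝓗.colOn i t) = 𝓗.colOn i (t.map (enum s)) := fun i => by
    have := map_prodOn (map (𝓗 := 𝓗)
      (placeHom ((enum s).prodMap (Function.Embedding.refl (Fin 2))))).toMonoidHom t
      fun c => ofAlg 𝓗 (single (c, i))
    rw [colOn, colOn, prodOn_map_enum]
    simp only [RingHom.toMonoidHom_eq_coe, MonoidHom.coe_coe, map_ofAlg,
      place_comp_single] at this
    exact this
  rw [comulOn₂, comulOn₂, ← key, ← key]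
  exact algHom_comp_tens (placeHom ((enum s).prodMap (Function.Embedding.refl (Fin 2)))) _ _ x

theorem delta_eq_moebius (n : ℕ) (a : H) :
    𝓗.delta n a = moebius k⟦X⟧ (fun s => 𝓗.comulOn s a) (Finset.univ : Finset (Fin n)) := by
  rw [delta_apply, moebius]
  simp

theorem delta₂_eq_moebius (n : ℕ) (x : TPow k H (Fin 2)) :
    𝓗.delta₂ n x = moebius k⟦X⟧ (fun s => 𝓗.comulOn₂ s x) (Finset.univ : Finset (Fin n)) := by
  rw [delta₂_apply, moebius]
  simp

/-- Subsets of s correspond to subsets of {1, …, |s|}, so the coefficient at s is a placed copy of δ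
of order |s|. Conditions on all the δ's thus become filteredness. -/
theorem place_delta {n : ℕ} (s : Finset (Fin n)) (a : H) :
    place (enum s) (𝓗.delta s.card a) = moebius k⟦X⟧ (fun s => 𝓗.comulOn s a) s := by
  conv_rhs => rw [← univ_map_enum s]
  rw [moebius_map, delta_eq_moebius, moebius_linearMap]
  simp only [place_comulOn]

theorem place_delta₂ {n : ℕ} (s : Finset (Fin n)) (x : TPow k H (Fin 2)) :
    place ((enum s).prodMap (Function.Embedding.refl (Fin 2))) (𝓗.delta₂ s.card x) =
      moebius k⟦X⟧ (fun s => 𝓗.comulOn₂ s x) s := by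
  conv_rhs => rw [← univ_map_enum s]
  rw [moebius_map, delta₂_eq_moebius, moebius_linearMap]
  simp only [place_comulOn₂]

theorem mem_drinfeld_iff {a : H} :
    a ∈ 𝓗.drinfeld ↔ ∀ n, IsFiltered (ι := Fin n) (hFil k _) fun s => 𝓗.comulOn s a := by
  refine ⟨fun h n => isFiltered_of_moebius_mem (R := k⟦X⟧) fun s => ?_, fun h n => ?_⟩
  · rw [← place_delta]
    exact map_mem_hIdeal _ (h s.card)
  · rw [delta_eq_moebius]
    simpa [mem_hFil] using (h n).moebius_mem (R := k⟦X⟧) Finset.univ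

theorem mem_drinfeld₂_iff {x : TPow k H (Fin 2)} :
    x ∈ 𝓗.drinfeld₂ ↔ ∀ n, IsFiltered (ι := Fin n) (hFil k _) fun s => 𝓗.comulOn₂ s x := by
  refine ⟨fun h n => isFiltered_of_moebius_mem (R := k⟦X⟧) fun s => ?_, fun h n => ?_⟩
  · rw [← place_delta₂]
    exact map_mem_hIdeal _ (h s.card)
  · rw [delta₂_eq_moebius]
    simpa [mem_hFil] using (h n).moebius_mem (R := k⟦X⟧) Finset.univ

variable (𝓗) in
/-- Drinfeld's subalgebra `H'`. -/
def drinfeldAlg : Subalgebra k⟦X⟧ H where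
  carrier := 𝓗.drinfeld
  add_mem' := 𝓗.drinfeld.add_mem
  mul_mem' := fun {a b} ha hb => mem_drinfeld_iff.2 fun n => by
    have h := (mem_drinfeld_iff.1 ha n).mul hFil_mul (mem_drinfeld_iff.1 hb n)
    convert h using 2 with s
    obtain ⟨Φ, hΦ⟩ := 𝓗.exists_algHom_comulOn s
    simp [hΦ]
  algebraMap_mem' := fun r => by
    rw [Algebra.algebraMap_eq_smul_one]
    refine 𝓗.drinfeld.smul_mem r (mem_drinfeld_iff.2 fun n => ?_)
    convert (isFiltered_const one_mem_hFil : IsFiltered (ι := Fin n)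
      (hFil k (TPow k H (Fin n))) fun _ => 1) using 2 with s
    obtain ⟨Φ, hΦ⟩ := 𝓗.exists_algHom_comulOn s
    simp [hΦ]

variable (𝓗) in
/-- Drinfeld's subalgebra `(H ⊗ H)'`. -/
def drinfeldAlg₂ : Subalgebra k⟦X⟧ (TPow k H (Fin 2)) where
  carrier := 𝓗.drinfeld₂
  add_mem' := 𝓗.drinfeld₂.add_mem
  mul_mem' := fun {a b} ha hb => mem_drinfeld₂_iff.2 fun n => by
    have h := (mem_drinfeld₂_iff.1 ha n).mul hFil_mul (mem_drinfeld₂_iff.1 hb n)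
    convert h using 2 with s
    obtain ⟨Φ, hΦ⟩ := 𝓗.exists_algHom_comulOn₂ s
    simp [hΦ]
  algebraMap_mem' := fun r => by
    rw [Algebra.algebraMap_eq_smul_one]
    refine 𝓗.drinfeld₂.smul_mem r (mem_drinfeld₂_iff.2 fun n => ?_)
    convert (isFiltered_const one_mem_hFil : IsFiltered (ι := Fin n)
      (hFil k (TPow k H (Fin n × Fin 2))) fun _ => 1) using 2 with s
    obtain ⟨Φ, hΦ⟩ := 𝓗.exists_algHom_comulOn₂ s
    simp [hΦ]

theorem mem_drinfeldAlg₂ {x : TPow k H (Fin 2)} : x ∈ 𝓗.drinfeldAlg₂ ↔ x ∈ 𝓗.drinfeld₂ := Iff.rfl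

/-- Each condition defining H' is open: δₙ is continuous, and an approximation modulo h^n settles
the n-th condition. -/
theorem hClosure_drinfeldAlg : hClosure 𝓗.drinfeldAlg = 𝓗.drinfeldAlg := by
  refine le_antisymm (fun a ha n => ?_) (le_hClosure _)
  obtain ⟨b, hb, hab⟩ := ha n
  simpa using Ideal.add_mem _ (map_mem_hIdeal (𝓗.delta n) hab) (hb n)

theorem hClosure_drinfeldAlg₂ : hClosure 𝓗.drinfeldAlg₂ = 𝓗.drinfeldAlg₂ := by
  refine le_antisymm (fun a ha n => ?_) (le_hClosure _)
  obtain ⟨b, hb, hab⟩ := ha n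
  simpa using Ideal.add_mem _ (map_mem_hIdeal (𝓗.delta₂ n) hab) (hb n)

theorem hClosure_mono {P Q : Subalgebra k⟦X⟧ B} (h : P ≤ Q) : hClosure P ≤ hClosure Q :=
  fun _ hx n => let ⟨y, hy, hxy⟩ := hx n; ⟨y, h hy, hxy⟩

theorem place_sectL_comulOn {n : ℕ} (i : Fin 2) (s : Finset (Fin n)) (a : H) :
    place (Function.Embedding.sectL (Fin n) i) (𝓗.comulOn s a) = 𝓗.colOn i s a := by
  have := congrArg (fun f => f a) (map_prodOn
    (map (𝓗 := 𝓗) (placeHom (Function.Embedding.sectL (Fin n) i))).toMonoidHom s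
    fun c => ofAlg 𝓗 (single c))
  simp only [RingHom.toMonoidHom_eq_coe, MonoidHom.coe_coe, map_apply, map_ofAlg,
    place_comp_single] at this
  exact this

theorem colOn_isFiltered {a : H} (ha : a ∈ 𝓗.drinfeld) (n : ℕ) (i : Fin 2) :
    IsFiltered (ι := Fin n) (hFil k _) fun s => 𝓗.colOn i s a := by
  have h := (mem_drinfeld_iff.1 ha n).map
    (place (Function.Embedding.sectL (Fin n) i)).toAddMonoidHom
    (J' := hFil k _) fun s x hx => map_mem_hIdeal (place (Function.Embedding.sectL (Fin n) i)) hx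
  convert h using 2 with s
  exact (place_sectL_comulOn i s a).symm

theorem subTPow_drinfeldAlg_le : subTPow 𝓗.drinfeldAlg (Fin 2) ≤ 𝓗.drinfeldAlg₂ := by
  rw [← hClosure_drinfeldAlg₂]
  refine hClosure_mono (Algebra.adjoin_le ?_)
  rintro _ ⟨a, ha, rfl⟩
  refine mem_drinfeld₂_iff.2 fun n => ?_
  convert (colOn_isFiltered (ha 0) n 0).mul hFil_mul (colOn_isFiltered (ha 1) n 1) using 2 with s
  exact tens_pure _ _ _

end TopHopf

end

end HAdic

namespace HAdic

noncomputable section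

namespace TopHopf

open Conv

variable {k : Type*} [Field k] {H : Type*} [Ring H] [Algebra k⟦X⟧ H] {𝓗 : TopHopf k H}
  {B : Type*} [Ring B] [Algebra k⟦X⟧ B] {κ : Type*}

/-! ### Convolution products of maps that vanish at `1` -/

/-- Applying f₁ ⊗ ⋯ ⊗ fₙ turns insertion at successive places into multiplication in the target; no
commutation is required because the orders agree. The maps e allow each place to receive id, ε or id
- ε. -/
theorem tensFin_prod {n : ℕ} (f : Fin n → H →ₗ[k⟦X⟧] HCompl k B) (e : Fin n → H →ₗ[k⟦X⟧] H)
    (a : H) :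
    tensFin f (((List.finRange n).map fun c => ofLin 𝓗 ((single c).toLinearMap ∘ₗ e c)).prod a) =
      ((List.finRange n).map fun c => ofLin 𝓗 (f c ∘ₗ e c)).prod a := by
  induction n generalizing a with
  | zero =>
    have h1 : tensFin f (1 : TPow k H (Fin 0)) = 1 := by
      rw [← pure_one, tensFin_pure]; rfl
    simp only [List.finRange_zero, List.map_nil, List.prod_nil, one_apply,
      Algebra.algebraMap_eq_smul_one, map_smul, h1]
  | succ n ih =>
    have hp := map_list_prod (map (𝓗 := 𝓗) (placeHom Fin.castSuccEmb))
      ((List.finRange n).map fun c => ofLin 𝓗 ((single c).toLinearMap ∘ₗ e c.castSucc))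
    have hs : ∀ c : Fin n, map (placeHom Fin.castSuccEmb)
        (ofLin 𝓗 ((single (k := k) c).toLinearMap ∘ₗ e c.castSucc)) =
        ofLin 𝓗 ((single c.castSucc).toLinearMap ∘ₗ e c.castSucc) := fun c => by
      ext a
      exact place_single _ _ _
    simp only [List.map_map, Function.comp_def, hs] at hp
    rw [List.finRange_succ_last, List.map_append, List.prod_append, List.map_append,
      List.prod_append, List.map_map, List.map_map]
    simp only [List.map_cons, List.map_nil, List.prod_singleton, Function.comp_def]
    rw [← hp, mul_apply, mul_apply]
    generalize 𝓗.comul a = x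
    have : ∀ P : 𝓗.Conv (⨂[k⟦X⟧] _ : Fin n, H), tensFin f ∘ₗ
        tens (map (placeHom Fin.castSuccEmb) P).lin
          (ofLin 𝓗 ((single (Fin.last n)).toLinearMap ∘ₗ e (Fin.last n))).lin =
        tens (tensFin (fun i => f i.castSucc) ∘ₗ P.lin)
          (ofLin 𝓗 (f (Fin.last n) ∘ₗ e (Fin.last n))).lin := fun P => TPow.ext fun b => by
      rw [LinearMap.comp_apply, tens_pure, tens_pure]
      exact tensFin_place_castSucc_mul f _ _
    refine (LinearMap.congr_fun (this _) x).trans ?_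
    congr 2
    exact LinearMap.ext fun b => ih (fun i => f i.castSucc) (fun i => e i.castSucc) b

theorem comulOn_eq_prod {n : ℕ} (s : Finset (Fin n)) :
    𝓗.comulOn s = ((List.finRange n).map fun c => ofLin 𝓗 ((single c).toLinearMap ∘ₗ
      if c ∈ s then LinearMap.id else Algebra.linearMap k⟦X⟧ H ∘ₗ 𝓗.counit.toLinearMap)).prod := by
  rw [comulOn, prodOn]
  congr 2
  funext c
  by_cases hc : c ∈ s
  · simp only [hc, if_true]; rfl
  · simp only [hc, if_false]
    ext a
    exact ((single c : H →ₐ[k⟦X⟧] TPow k H (Fin n)).commutes _).symm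

theorem tensFin_comulOn_univ {n : ℕ} (f : Fin n → H →ₗ[k⟦X⟧] HCompl k B) (a : H) :
    tensFin f (𝓗.comulOn Finset.univ a) =
      ((List.finRange n).map fun c => ofLin 𝓗 (f c)).prod a := by
  rw [comulOn_eq_prod, tensFin_prod]
  simp

theorem tensFin_comulOn_eq_zero {n : ℕ} {f : Fin n → H →ₗ[k⟦X⟧] HCompl k B} {s : Finset (Fin n)}
    {c : Fin n} (hc : c ∉ s) (hf : f c 1 = 0) (a : H) : tensFin f (𝓗.comulOn s a) = 0 := by
  rw [comulOn_eq_prod, tensFin_prod,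
    List.prod_eq_zero (List.mem_map.2 ⟨c, List.mem_finRange c, ?_⟩),
    Conv.zero_apply]
  ext a
  simp [hc, Algebra.algebraMap_eq_smul_one, hf]

theorem exists_notMem_of_ne_univ {ι : Type*} [Fintype ι] {s : Finset ι} (hs : s ≠ Finset.univ) :
    ∃ c, c ∉ s := by
  by_contra! h
  exact hs (Finset.eq_univ_iff_forall.2 h)

/-- A proper Σ misses some place c, where Δ_Σ has the factor 1, killed by f c. Only the full set
survives, and it gives the convolution product. -/
theorem tensFin_delta {n : ℕ} {f : Fin n → H →ₗ[k⟦X⟧] HCompl k B} (hf : ∀ c, f c 1 = 0) (a : H) :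
    tensFin f (𝓗.delta n a) = ((List.finRange n).map fun c => ofLin 𝓗 (f c)).prod a := by
  rw [delta_apply, map_sum, Finset.sum_eq_single Finset.univ]
  · simp [tensFin_comulOn_univ]
  · intro s _ hs
    obtain ⟨c, hc⟩ := exists_notMem_of_ne_univ hs
    rw [map_smul, tensFin_comulOn_eq_zero hc (hf c), smul_zero]
  · simp

theorem list_prod_apply_mem {a : H} (ha : a ∈ 𝓗.drinfeld) (l : List (𝓗.Conv B))
    (hl : ∀ f ∈ l, f 1 = 0) : l.prod a ∈ hIdeal k (HCompl k B) l.length := by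
  have h := tensFin_delta (𝓗 := 𝓗) (f := fun c : Fin l.length => (l.get c).lin)
    (fun c => hl _ (List.get_mem l c)) a
  have h2 : ((List.finRange l.length).map fun c => ofLin 𝓗 (l.get c).lin) = l := by
    change (List.finRange l.length).map l.get = l
    exact List.map_get_finRange l
  rw [h2] at h
  rw [← h]
  exact map_mem_hIdeal _ (ha _)

/-- The filtration of the convolution algebra by the number of factors that vanish at `1`. -/
def convFil (𝓗 : TopHopf k H) (B : Type*) [Ring B] [Algebra k⟦X⟧ B] {ι : Type*} (s : Finset ι) :
    AddSubmonoid (𝓗.Conv B) :=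
  AddSubmonoid.closure {f | ∃ l : List (𝓗.Conv B), s.card ≤ l.length ∧ (∀ g ∈ l, g 1 = 0) ∧
    f = l.prod}

theorem apply_mem_of_mem_convFil {ι : Type*} {s : Finset ι} {f : 𝓗.Conv B}
    (hf : f ∈ convFil 𝓗 B s) {a : H} (ha : a ∈ 𝓗.drinfeld) : f a ∈ hFil k (HCompl k B) s := by
  induction hf using AddSubmonoid.closure_induction with
  | mem f hf =>
    obtain ⟨l, hl, h0, rfl⟩ := hf
    exact hIdeal_anti k _ hl (list_prod_apply_mem ha l h0)
  | zero => exact zero_mem _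
  | add f g _ _ hf hg => exact add_mem hf hg

theorem one_mem_convFil {ι : Type*} : (1 : 𝓗.Conv B) ∈ convFil 𝓗 B (∅ : Finset ι) :=
  AddSubmonoid.subset_closure ⟨[], by simp, by simp, rfl⟩

theorem mem_convFil_singleton {ι : Type*} {f : 𝓗.Conv B} (hf : f 1 = 0) (c : ι) :
    f ∈ convFil 𝓗 B {c} :=
  AddSubmonoid.subset_closure ⟨[f], by simp, by simpa using hf, by simp⟩

/-- Concatenating two lists adds their lengths; asking only for at least |s| factors absorbs the
overlap of s and t. -/
theorem convFil_mul {ι : Type*} [DecidableEq ι] (s t : Finset ι) (f : 𝓗.Conv B)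
    (hf : f ∈ convFil 𝓗 B s) (g : 𝓗.Conv B) (hg : g ∈ convFil 𝓗 B t) :
    f * g ∈ convFil 𝓗 B (s ∪ t) := by
  have h := AddSubmonoid.mul_mem_mul hf hg
  rw [convFil, convFil, AddSubmonoid.closure_mul_closure] at h
  refine AddSubmonoid.closure_mono ?_ h
  rintro _ ⟨_, ⟨l, hl, h0, rfl⟩, _, ⟨l', hl', h0', rfl⟩, rfl⟩
  refine ⟨l ++ l', ?_, ?_, by simp⟩
  · have := Finset.card_union_le s t
    rw [List.length_append]
    omega
  · intro f hf
    rcases List.mem_append.1 hf with hf | hf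
    · exact h0 f hf
    · exact h0' f hf

theorem one_apply_one : (1 : 𝓗.Conv B) 1 = 1 := by simp [one_apply]

theorem isFiltered_apply {ι : Type*} [DecidableEq ι] {F : Finset ι → 𝓗.Conv B}
    (hF : IsFiltered (convFil 𝓗 B) F) {a : H} (ha : a ∈ 𝓗.drinfeld) :
    IsFiltered (hFil k (HCompl k B)) fun s => F s a :=
  hF.map (AddMonoidHom.mk' (fun f : 𝓗.Conv B => f a) fun _ _ => rfl)
    fun _ _ hf => apply_mem_of_mem_convFil hf ha

/-- Δ̃_Σ ∘ Δ is the convolution product of the two columns over Σ, and each insertion differs from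
the unit by a map vanishing at 1. -/
theorem comul_mem_drinfeld₂ {a : H} (ha : a ∈ 𝓗.drinfeld) : 𝓗.comul a ∈ 𝓗.drinfeld₂ := by
  refine mem_drinfeld₂_iff.2 fun n => ?_
  have h : ∀ i : Fin 2, IsFiltered (ι := Fin n) (convFil 𝓗 _) fun s => 𝓗.colOn i s := fun i =>
    isFiltered_prodOn one_mem_convFil convFil_mul _
      fun c => mem_convFil_singleton (by simp [one_apply_one]) c
  exact isFiltered_apply ((h 0).mul convFil_mul (h 1)) ha

/-! ### The antipode -/

variable (𝓗) in
/-- The composite of an algebra map and the antipode. -/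
def compAntipode (φ : H →ₐ[k⟦X⟧] HCompl k B) : 𝓗.Conv B := ofLin 𝓗 (φ.toLinearMap ∘ₗ 𝓗.antipode)

theorem compAntipode_mul (φ : H →ₐ[k⟦X⟧] HCompl k B) :
    𝓗.compAntipode φ * ofAlg 𝓗 φ = 1 := by
  ext a
  have h := congrArg (HCompl.lift φ.toLinearMap) (𝓗.antipode_left a)
  rw [linearMap_comp_tens _ _ _ (𝓗.compAntipode φ).lin (ofAlg 𝓗 φ).lin] at h
  · rw [mul_apply, h, Algebra.algebraMap_eq_smul_one, map_smul, ← map_one (HCompl.of k H),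
      HCompl.lift_of, AlgHom.toLinearMap_apply, map_one, one_apply,
      Algebra.algebraMap_eq_smul_one]
  · intro a b
    rw [LinearMap.comp_apply, AlgHom.toLinearMap_apply, AlgHom.toLinearMap_apply, ← map_mul,
      HCompl.lift_of, AlgHom.toLinearMap_apply, map_mul]
    rfl

theorem mul_compAntipode (φ : H →ₐ[k⟦X⟧] HCompl k B) :
    ofAlg 𝓗 φ * 𝓗.compAntipode φ = 1 := by
  ext a
  have h := congrArg (HCompl.lift φ.toLinearMap) (𝓗.antipode_right a)
  rw [linearMap_comp_tens _ _ _ (ofAlg 𝓗 φ).lin (𝓗.compAntipode φ).lin] at h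
  · rw [mul_apply, h, Algebra.algebraMap_eq_smul_one, map_smul, ← map_one (HCompl.of k H),
      HCompl.lift_of, AlgHom.toLinearMap_apply, map_one, one_apply,
      Algebra.algebraMap_eq_smul_one]
  · intro a b
    rw [LinearMap.comp_apply, AlgHom.toLinearMap_apply, AlgHom.toLinearMap_apply, ← map_mul,
      HCompl.lift_of, AlgHom.toLinearMap_apply, map_mul]
    rfl

theorem compAntipode_one (φ : H →ₐ[k⟦X⟧] HCompl k B) : 𝓗.compAntipode φ 1 = 1 := by
  have h := congrArg (fun f => f 1) (compAntipode_mul (𝓗 := 𝓗) φ)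
  simp only [mul_apply, map_one, one_apply_one] at h
  rw [← pure_one, tens_pure] at h
  simpa using h

theorem compAntipode_counitHom : 𝓗.compAntipode (counitHom 𝓗 B) = 1 := by
  have h := compAntipode_mul (𝓗 := 𝓗) (counitHom 𝓗 B)
  rwa [← one_eq_ofAlg, mul_one] at h

theorem prod_mul_prod_reverse {M ι : Type*} [Monoid M] {f g : ι → M} (h : ∀ c, f c * g c = 1)
    (l : List ι) : (l.map f).prod * (l.reverse.map g).prod = 1 := by
  induction l with
  | nil => simp
  | cons c l ih =>
    rw [List.map_cons, List.prod_cons, List.reverse_cons, List.map_append, List.prod_append,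
      mul_assoc, ← mul_assoc (l.map f).prod, ih]
    simp [h]

/-- Φ composed with the antipode is the convolution inverse of Φ, and the inverse of an ordered
product is the reversed product of the inverses. -/
theorem compAntipode_of_prod {φ : κ → H →ₐ[k⟦X⟧] HCompl k B} {l : List κ}
    {Φ : H →ₐ[k⟦X⟧] HCompl k B} (hΦ : (l.map fun c => ofAlg 𝓗 (φ c)).prod = ofAlg 𝓗 Φ) :
    𝓗.compAntipode Φ = (l.reverse.map fun c => 𝓗.compAntipode (φ c)).prod :=
  left_inv_eq_right_inv (compAntipode_mul Φ)
    (hΦ ▸ prod_mul_prod_reverse (fun c => mul_compAntipode (φ c)) l)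

/-- Δ_Σ ∘ S is a reversed convolution product of the maps S placed at c ∈ Σ. These take the value 1
at 1, so they differ from the unit by maps vanishing at 1. -/
theorem antipode_mem_drinfeld {a : H} (ha : a ∈ 𝓗.drinfeld) : 𝓗.antipode a ∈ 𝓗.drinfeld := by
  refine mem_drinfeld_iff.2 fun n => ?_
  have h : IsFiltered (ι := Fin n) (convFil 𝓗 (⨂[k⟦X⟧] _ : Fin n, H)) fun s =>
      ((List.finRange n).reverse.map fun c =>
        if c ∈ s then 𝓗.compAntipode (single c) else 1).prod :=
    IsFiltered.list_prod one_mem_convFil convFil_mul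
      (fun c s => if c ∈ s then 𝓗.compAntipode (single c) else 1) _
      fun c _ => isFiltered_ite one_mem_convFil
        (mem_convFil_singleton (by simp [one_apply_one, compAntipode_one]) c)
  convert isFiltered_apply h ha using 2 with s
  obtain ⟨Φ, hΦ⟩ := exists_algHom_comulOn 𝓗 s
  have h2 := hΦ
  rw [comulOn, prodOn_eq_restrict] at h2
  have h3 := congrArg (fun f => f a) (compAntipode_of_prod h2)
  rw [hΦ]
  refine h3.trans ?_
  congr 3
  funext c
  rw [restrict]
  split_ifs
  · rfl
  · exact compAntipode_counitHom

end TopHopf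

end

end HAdic

namespace HAdic

noncomputable section

/-! ### Conjugation by the `R`-matrix -/

theorem IsFiltered.add {M ι : Type*} [AddCommGroup M]
    {J : Finset ι → AddSubmonoid M} {F G : Finset ι → M} (hF : IsFiltered J F)
    (hG : IsFiltered J G) : IsFiltered J fun s => F s + G s := by
  obtain ⟨f, hf, hF⟩ := hF
  obtain ⟨g, hg, hG⟩ := hG
  exact ⟨fun s => f s + g s, fun s => add_mem (hf s) (hg s), fun s =>
    (congrArg₂ _ (hF s) (hG s)).trans Finset.sum_add_distrib.symm⟩

/-- Conjugation by the units `V s` and by their inverses preserves filtered functions. -/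
def ConjPreserves {A ι : Type*} [Ring A] (J : Finset ι → AddSubmonoid A) (V : Finset ι → Aˣ) :
    Prop :=
  ∀ F : Finset ι → A, IsFiltered J F →
    IsFiltered J (fun s => (V s : A) * F s * ((V s)⁻¹ : Aˣ)) ∧
    IsFiltered J (fun s => ((V s)⁻¹ : Aˣ) * F s * (V s : A))

section Conj

variable {A ι κ : Type*} [Ring A] {J : Finset ι → AddSubmonoid A}

theorem ConjPreserves.one : ConjPreserves J (fun _ => 1) := fun F hF => by simpa using hF

theorem ConjPreserves.mul {V W : Finset ι → Aˣ} (hV : ConjPreserves J V)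
    (hW : ConjPreserves J W) : ConjPreserves J fun s => V s * W s := fun F hF => by
  refine ⟨?_, ?_⟩
  · simpa [mul_assoc] using (hV _ (hW F hF).1).1
  · simpa [mul_assoc] using (hW _ (hV F hF).2).2

theorem ConjPreserves.list_prod {V : κ → Finset ι → Aˣ} (l : List κ)
    (h : ∀ c, ConjPreserves J (V c)) : ConjPreserves J fun s => (l.map fun c => V c s).prod := by
  induction l with
  | nil => exact ConjPreserves.one
  | cons c l ih => simpa using (h c).mul ih

end Conj

namespace TopHopf

open Conv

variable {k : Type*} [Field k] {H : Type*} [Ring H] [Algebra k⟦X⟧ H] {𝓗 : TopHopf k H} {n : ℕ}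

/-- The elements of `h^|s| (H ⊗ H)^{⊗n}` that commute with the places outside `s`. -/
def suppFil (k : Type*) [Field k] (H : Type*) [Ring H] [Algebra k⟦X⟧ H] {n : ℕ}
    (s : Finset (Fin n)) : AddSubmonoid (TPow k H (Fin n × Fin 2)) where
  carrier := {x | x ∈ hFil k (TPow k H (Fin n × Fin 2)) s ∧
    ∀ c ∉ s, ∀ (i : Fin 2) (a : H), Commute x (single (c, i) a)}
  zero_mem' := ⟨zero_mem _, fun _ _ _ _ => Commute.zero_left _⟩
  add_mem' := fun hx hy => ⟨add_mem hx.1 hy.1, fun c hc i a =>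
    (hx.2 c hc i a).add_left (hy.2 c hc i a)⟩

theorem mem_suppFil {s : Finset (Fin n)} {x : TPow k H (Fin n × Fin 2)} :
    x ∈ suppFil k H s ↔ x ∈ hIdeal k (TPow k H (Fin n × Fin 2)) s.card ∧
    ∀ c ∉ s, ∀ (i : Fin 2) (a : H), Commute x (single (c, i) a) := Iff.rfl

/-- The coefficient at s is a δ placed on s, hence commutes with all other places. This support
information is what the conjugation argument needs beyond divisibility. -/
theorem isFiltered_suppFil {x : TPow k H (Fin 2)} (hx : x ∈ 𝓗.drinfeld₂) (n : ℕ) :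
    IsFiltered (suppFil k H) fun s : Finset (Fin n) => 𝓗.comulOn₂ s x := by
  refine isFiltered_of_moebius_mem (R := k⟦X⟧) fun s => ?_
  rw [← place_delta₂]
  refine mem_suppFil.2 ⟨map_mem_hIdeal _ (hx s.card), fun c hc i a =>
    place_commute_single _ ?_ _ _⟩
  rintro ⟨p, hp⟩
  have h1 : enum s p.1 = c := congrArg Prod.fst hp
  exact hc (h1 ▸ s.orderEmbOfFin_mem rfl p.1)

theorem drinfeld₂_of_isFiltered_suppFil {x : TPow k H (Fin 2)}
    (h : ∀ n, IsFiltered (suppFil k H) fun s : Finset (Fin n) => 𝓗.comulOn₂ s x) :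
    x ∈ 𝓗.drinfeld₂ :=
  mem_drinfeld₂_iff.2 fun n => (h n).map (AddMonoidHom.id _) fun _ _ hx => hx.1

/-- A unit, congruent to `1`, supported at the places `c`, `d`. -/
structure IsSupportedUnit (c d : Fin n) (u : (TPow k H (Fin n × Fin 2))ˣ) : Prop where
  sub_one_mem : (u : TPow k H (Fin n × Fin 2)) - 1 ∈ hIdeal k (TPow k H (Fin n × Fin 2)) 1
  commute_single : ∀ e, e ≠ c → e ≠ d → ∀ (i : Fin 2) (a : H),
    Commute (u : TPow k H (Fin n × Fin 2)) (single (e, i) a)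
  commute : ∀ x : TPow k H (Fin n × Fin 2),
    (∀ e, e = c ∨ e = d → ∀ (i : Fin 2) (a : H), Commute x (single (e, i) a)) →
    Commute (u : TPow k H (Fin n × Fin 2)) x

theorem IsSupportedUnit.inv {c d : Fin n} {u : (TPow k H (Fin n × Fin 2))ˣ}
    (hu : IsSupportedUnit c d u) : IsSupportedUnit c d u⁻¹ where
  sub_one_mem := by
    have : (u⁻¹ : (TPow k H (Fin n × Fin 2))ˣ) - (1 : TPow k H (Fin n × Fin 2)) =
        -((u⁻¹ : (TPow k H (Fin n × Fin 2))ˣ) * (u - 1)) := by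
      rw [mul_sub, Units.inv_mul, mul_one, neg_sub]
    rw [this]
    exact neg_mem (Ideal.mul_mem_left _ _ hu.sub_one_mem)
  commute_single e hc hd i a := (hu.commute_single e hc hd i a).units_inv_left
  commute x hx := (hu.commute x hx).units_inv_left

/-- If s misses both c and d, then u commutes with x and the difference vanishes. Otherwise s ∪ {c,
d} has at most one element more than s, and the commutator of x with u - 1 gains a factor h. The
case c = d is included. -/
theorem conj_sub_mem_suppFil {c d : Fin n} {u : (TPow k H (Fin n × Fin 2))ˣ}
    (hu : IsSupportedUnit c d u) {s : Finset (Fin n)} {x : TPow k H (Fin n × Fin 2)}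
    (hx : x ∈ suppFil k H s) :
    u * x * (u⁻¹ : (TPow k H (Fin n × Fin 2))ˣ) - x ∈ suppFil k H (s ∪ {c, d}) := by
  by_cases h : c ∈ s ∨ d ∈ s
  · refine mem_suppFil.2 ⟨?_, fun e he i a => ?_⟩
    · have hcard : (s ∪ {c, d}).card ≤ s.card + 1 := by
        rcases h with h | h
        · rw [show s ∪ {c, d} = insert d s by ext; simp; grind]
          exact Finset.card_insert_le _ _
        · rw [show s ∪ {c, d} = insert c s by ext; simp; grind]
          exact Finset.card_insert_le _ _
      have h1 : u * x * (u⁻¹ : (TPow k H (Fin n × Fin 2))ˣ) - x =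
          ((u - 1) * x - x * (u - 1)) * (u⁻¹ : (TPow k H (Fin n × Fin 2))ˣ) := by
        have : x = x * u * (u⁻¹ : (TPow k H (Fin n × Fin 2))ˣ) := by simp [mul_assoc]
        conv_lhs => rw [sub_eq_add_neg]; right; rw [this]
        noncomm_ring
      rw [h1]
      refine hIdeal_anti k _ hcard (Ideal.mul_mem_right _ _ (Ideal.sub_mem _ ?_ ?_))
      · rw [add_comm]
        exact mul_mem_hIdeal_add hu.sub_one_mem hx.1
      · exact mul_mem_hIdeal_add hx.1 hu.sub_one_mem
    · simp only [Finset.mem_union, Finset.mem_insert, Finset.mem_singleton, not_or] at he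
      have h1 := hx.2 e he.1 i a
      have h2 := hu.commute_single e he.2.1 he.2.2 i a
      exact ((h2.mul_left h1).mul_left h2.units_inv_left).sub_left h1
  · rw [not_or] at h
    have h1 : Commute (u : TPow k H (Fin n × Fin 2)) x := hu.commute x fun e he i a => by
      rcases he with rfl | rfl
      · exact hx.2 _ h.1 i a
      · exact hx.2 _ h.2 i a
    rw [h1.eq, mul_assoc, Units.mul_inv, mul_one, sub_self]
    exact zero_mem _

/-- The conjugated function is F plus the indicator of c, d ∈ s times u F u⁻¹ - F; the indicator has
a single Möbius coefficient, at {c, d}. -/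
theorem isFiltered_conj {c d : Fin n} {u : (TPow k H (Fin n × Fin 2))ˣ}
    (hu : IsSupportedUnit c d u) {F : Finset (Fin n) → TPow k H (Fin n × Fin 2)}
    (hF : IsFiltered (suppFil k H) F) :
    IsFiltered (suppFil k H) fun s =>
      ((if c ∈ s ∧ d ∈ s then u else 1 : (TPow k H (Fin n × Fin 2))ˣ) : TPow k H (Fin n × Fin 2)) *
        F s * ((if c ∈ s ∧ d ∈ s then u else 1)⁻¹ : (TPow k H (Fin n × Fin 2))ˣ) := by
  -- This filtration only records that the coefficients of the indicator are concentrated at {c, d}.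
  let J' : Finset (Fin n) → AddSubmonoid ℤ := fun t => if t = {c, d} then ⊤ else ⊥
  have hG : IsFiltered J' fun s => if c ∈ s ∧ d ∈ s then (1 : ℤ) else 0 := by
    refine ⟨fun t => if t = {c, d} then 1 else 0, fun t => ?_, fun s => ?_⟩
    · by_cases h : t = {c, d} <;> simp [J', h]
    · rw [Finset.sum_ite_eq' s.powerset {c, d}]
      simp [Finset.insert_subset_iff]
  let g : TPow k H (Fin n × Fin 2) →+ TPow k H (Fin n × Fin 2) :=
    AddMonoidHom.mk' (fun x => u * x * (u⁻¹ : (TPow k H (Fin n × Fin 2))ˣ) - x) fun x y => by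
      noncomm_ring
  let β : TPow k H (Fin n × Fin 2) →+ ℤ →+ TPow k H (Fin n × Fin 2) :=
    (smulAddHom ℤ _).flip.comp g
  have hg : ∀ x, g x = u * x * (u⁻¹ : (TPow k H (Fin n × Fin 2))ˣ) - x := fun x => rfl
  have h := hF.add (hF.map₂ hG β (J'' := suppFil k H) fun s t x hx m hm => by
    by_cases ht : t = {c, d}
    · subst ht
      have h1 : g x ∈ suppFil k H (s ∪ {c, d}) := hg x ▸ conj_sub_mem_suppFil hu hx
      change m • g x ∈ _
      refine ⟨?_, fun e he i a => (h1.2 e he i a).smul_left m⟩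
      exact zsmul_mem (S := Ideal _) (K := hIdeal k _ _) h1.1 m
    · have : m = 0 := by simpa [J', ht] using hm
      rw [this, map_zero]
      exact zero_mem _)
  convert h using 2 with s
  by_cases hs : c ∈ s ∧ d ∈ s
  · simp only [if_pos hs]
    change _ = F s + (1 : ℤ) • g (F s)
    rw [hg]
    simp
  · simp only [if_neg hs]
    simp

theorem conjPreserves_ite {c d : Fin n} {u : (TPow k H (Fin n × Fin 2))ˣ}
    (hu : IsSupportedUnit c d u) :
    ConjPreserves (suppFil k H) fun s => if c ∈ s ∧ d ∈ s then u else 1 := fun F hF => by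
  refine ⟨isFiltered_conj hu hF, ?_⟩
  convert isFiltered_conj hu.inv hF using 2 with s
  by_cases hs : c ∈ s ∧ d ∈ s <;> simp [hs]

section RMatrix

variable {R : (TPow k H (Fin 2))ˣ}

/-- `R` at the places `(c, 0)` and `(d, 1)`. -/
def placeUnit (R : (TPow k H (Fin 2))ˣ) (c d : Fin n) : (TPow k H (Fin n × Fin 2))ˣ :=
  Units.map (placeHom (emb ((c, 0) : Fin n × Fin 2) (d, 1) (by simp))).toRingHom.toMonoidHom R

theorem placeUnit_val (R : (TPow k H (Fin 2))ˣ) (c d : Fin n) :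
    (placeUnit R c d : TPow k H (Fin n × Fin 2)) =
      place (emb ((c, 0) : Fin n × Fin 2) (d, 1) (by simp)) (R : TPow k H (Fin 2)) := rfl

theorem isSupportedUnit_placeUnit
    (hR1 : (R : TPow k H (Fin 2)) - 1 ∈ hIdeal k (TPow k H (Fin 2)) 1) (c d : Fin n) :
    IsSupportedUnit c d (placeUnit R c d) where
  sub_one_mem := by
    rw [placeUnit_val, ← place_one (emb ((c, 0) : Fin n × Fin 2) (d, 1) (by simp)), ← map_sub]
    exact map_mem_hIdeal _ hR1
  commute_single e hc hd i a := by
    refine place_commute_single _ ?_ _ _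
    rintro ⟨j, hj⟩
    fin_cases j
    · exact hc (congrArg Prod.fst hj).symm
    · exact hd (congrArg Prod.fst hj).symm
  commute x hx := by
    rw [placeUnit_val]
    refine commute_of_pure (f := place _) (fun a => ?_) _
    rw [place_emb_pure]
    exact (hx c (Or.inl rfl) 0 _).symm.mul_left (hx d (Or.inr rfl) 1 _).symm

/-- Δ̃_Σ is multiplicative, so it carries Ad(R) to conjugation by Δ̃_Σ(R), a product of elementary
units; each factor preserves filtered functions with support. -/
theorem IsRMatrix.conj_mem_drinfeld₂ (hR : 𝓗.IsRMatrix R)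
    (hR1 : (R : TPow k H (Fin 2)) - 1 ∈ hIdeal k (TPow k H (Fin 2)) 1) {x : TPow k H (Fin 2)}
    (hx : x ∈ 𝓗.drinfeld₂) :
    R * x * (R⁻¹ : (TPow k H (Fin 2))ˣ) ∈ 𝓗.drinfeld₂ ∧
    (R⁻¹ : (TPow k H (Fin 2))ˣ) * x * R ∈ 𝓗.drinfeld₂ := by
  have key : ∀ n, ∃ V : Finset (Fin n) → (TPow k H (Fin n × Fin 2))ˣ,
      ConjPreserves (suppFil k H) V ∧
      ∀ s, ∃ Φ : TPow k H (Fin 2) →ₐ[k⟦X⟧] TPow k H (Fin n × Fin 2),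
        (∀ x, 𝓗.comulOn₂ s x = Φ x) ∧ V s = Units.map (Φ : _ →* _) R := by
    intro n
    refine ⟨fun s => ((List.finRange n).map fun c => ((List.finRange n).reverse.map fun d =>
      if c ∈ s ∧ d ∈ s then placeUnit R c d else 1).prod).prod,
      ConjPreserves.list_prod _ fun c => ConjPreserves.list_prod _ fun d =>
        conjPreserves_ite (isSupportedUnit_placeUnit hR1 c d), fun s => ?_⟩
    obtain ⟨Φ, hΦ⟩ := 𝓗.exists_algHom_comulOn₂ s
    refine ⟨Φ, hΦ, Units.ext ?_⟩
    rw [Units.coe_map]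
    refine Eq.trans ?_ ((hR.comulOn₂_eq s).symm.trans (hΦ _))
    have hval : ∀ (l : List (Fin n)) (f : Fin n → (TPow k H (Fin n × Fin 2))ˣ),
        ((l.map f).prod : TPow k H (Fin n × Fin 2)) = (l.map fun c => (f c : TPow k H _)).prod :=
      fun l f => by
        have := map_list_prod (Units.coeHom (TPow k H (Fin n × Fin 2))) (l.map f)
        rw [List.map_map] at this
        exact this
    rw [hval]
    congr 2
    funext c
    rw [hval]
    congr 2
    funext d
    split_ifs
    · rfl
    · rfl
  refine ⟨drinfeld₂_of_isFiltered_suppFil fun n => ?_, drinfeld₂_of_isFiltered_suppFil fun n => ?_⟩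
  · obtain ⟨V, hV, h⟩ := key n
    convert (hV _ (isFiltered_suppFil hx n)).1 using 2 with s
    obtain ⟨Φ, hΦ, hVs⟩ := h s
    rw [hΦ, hΦ, hVs, map_mul, map_mul]
    rfl
  · obtain ⟨V, hV, h⟩ := key n
    convert (hV _ (isFiltered_suppFil hx n)).2 using 2 with s
    obtain ⟨Φ, hΦ, hVs⟩ := h s
    rw [hΦ, hΦ, hVs, map_mul, map_mul]
    rfl

end RMatrix

end TopHopf

end

end HAdic

namespace HAdic

noncomputable section

/-! ### Topologically free modules -/

section TopFree

variable {k : Type*} [Field k] {H : Type*} [Ring H] [Algebra k⟦X⟧ H]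

theorem mem_span_X_pow_smul_top {M : Type*} [AddCommGroup M] [Module k⟦X⟧ M] {n : ℕ} {x : M} :
    x ∈ (Ideal.span {(PowerSeries.X : k⟦X⟧)} ^ n • ⊤ : Submodule k⟦X⟧ M) ↔
      ∃ y : M, x = (PowerSeries.X ^ n : k⟦X⟧) • y := by
  rw [Ideal.span_singleton_pow, Submodule.ideal_span_singleton_smul,
    Submodule.mem_smul_pointwise_iff_exists]
  simp [eq_comm]

theorem IsTopFree.isHSeparated (hH : IsTopFree k H) : IsHSeparated k H where
  eq_zero x hx := hH.complete.toIsHausdorff.haus x fun n => by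
    rw [SModEq.zero, mem_span_X_pow_smul_top]
    exact hx n

instance : IsHSeparated k k⟦X⟧ where
  eq_zero x hx := by
    ext n
    obtain ⟨b, hb⟩ := hx (n + 1)
    rw [hb, smul_eq_mul, PowerSeries.coeff_X_pow_mul']
    simp

theorem mem_hIdeal_powerSeries {n : ℕ} {r : k⟦X⟧} :
    r ∈ hIdeal k k⟦X⟧ n ↔ PowerSeries.X ^ n ∣ r := Iff.rfl

theorem IsTopFree.smul_cancel (hH : IsTopFree k H) {n : ℕ} {a b : H}
    (h : (PowerSeries.X ^ n : k⟦X⟧) • a = (PowerSeries.X ^ n : k⟦X⟧) • b) : a = b := by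
  have := hH.torsionFree
  exact smul_right_injective H (pow_ne_zero n PowerSeries.X_ne_zero) h

theorem IsTopFree.mem_hIdeal_of_smul (hH : IsTopFree k H) {m n : ℕ} {a : H}
    (h : (PowerSeries.X ^ m : k⟦X⟧) • a ∈ hIdeal k H (m + n)) : a ∈ hIdeal k H n := by
  obtain ⟨b, hb⟩ := h
  rw [pow_add, mul_smul] at hb
  exact ⟨b, hH.smul_cancel hb⟩

theorem IsTopFree.exists_limit (hH : IsTopFree k H) {f : ℕ → H}
    (hf : ∀ m n, m ≤ n → f n - f m ∈ hIdeal k H m) : ∃ a, ∀ n, a - f n ∈ hIdeal k H n := by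
  obtain ⟨a, ha⟩ := hH.complete.toIsPrecomplete.prec (f := f) fun {m n} h => by
    rw [SModEq.comm, SModEq.sub_mem, mem_span_X_pow_smul_top]
    exact hf m n h
  refine ⟨a, fun n => ?_⟩
  have := ha n
  rw [SModEq.comm, SModEq.sub_mem, mem_span_X_pow_smul_top] at this
  exact this

theorem IsTopFree.of_surjective (hH : IsTopFree k H) : Function.Surjective (HCompl.of k H) := by
  intro x
  choose f hf using HCompl.exists_sub_of_mem (k := k) (A := H) x
  obtain ⟨a, ha⟩ := hH.exists_limit (f := f) fun m n h => by
    rw [← HCompl.of_mem_hIdeal_iff, map_sub]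
    have := Ideal.sub_mem _ (hf m) (hIdeal_anti k _ h (hf n))
    rwa [sub_sub_sub_cancel_left] at this
  refine ⟨a, eq_of_sub_mem k fun n => ?_⟩
  have := Ideal.sub_mem _ (HCompl.of_mem_hIdeal_iff.2 (ha n)) (hf n)
  simpa using this

/-- The inverse of the isomorphism of `H` with its completion. -/
def IsTopFree.ofEquiv (hH : IsTopFree k H) : H ≃ₐ[k⟦X⟧] HCompl k H :=
  haveI := hH.isHSeparated
  AlgEquiv.ofBijective (HCompl.of k H) ⟨HCompl.of_injective, hH.of_surjective⟩

theorem IsTopFree.of_ofEquiv_symm (hH : IsTopFree k H) (x : HCompl k H) :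
    HCompl.of k H (hH.ofEquiv.symm x) = x := hH.ofEquiv.apply_symm_apply x

end TopFree

/-! ### Coordinates adapted to a submodule -/

/-- Extend an independent set successively along the chain t 0 ⊆ t 1 ⊆ ⋯ so that it spans each
stage, take the union, and complete it to a spanning set. -/
theorem exists_linearIndepOn_adapted {K V X : Type*} [DivisionRing K] [AddCommGroup V]
    [Module K V] (v : X → V) (t : ℕ → Set X) (ht : Monotone t) :
    ∃ b : Set X, LinearIndepOn K v b ∧ (∀ x, v x ∈ Submodule.span K (v '' b)) ∧
      ∀ i, v '' (t i) ⊆ Submodule.span K (v '' (b ∩ t i)) := by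
  have step : ∀ (i : ℕ) (s : {s : Set X // LinearIndepOn K v s ∧ s ⊆ t i}),
      ∃ b : {s : Set X // LinearIndepOn K v s ∧ s ⊆ t (i + 1)}, s.1 ⊆ b.1 ∧
        v '' (t (i + 1)) ⊆ Submodule.span K (v '' b.1) := fun i s => by
    obtain ⟨b, hb, hsb, hspan, hli⟩ :=
      exists_linearIndepOn_extension s.2.1 (s.2.2.trans (ht (Nat.le_succ i)))
    exact ⟨⟨b, hli, hb⟩, hsb, hspan⟩
  choose g hg hg' using step
  obtain ⟨b0, hb0, -, hspan0, hli0⟩ := exists_linearIndepOn_extension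
    (linearIndepOn_empty K v) (Set.empty_subset (t 0))
  let s : ∀ i, {s : Set X // LinearIndepOn K v s ∧ s ⊆ t i} :=
    fun i => Nat.rec ⟨b0, hli0, hb0⟩ (fun i s => g i s) i
  have hmono : Monotone fun i => (s i).1 := monotone_nat_of_le_succ fun i => hg i (s i)
  have hspan : ∀ i, v '' (t i) ⊆ Submodule.span K (v '' (s i).1) := fun i => by
    cases i with
    | zero => exact hspan0
    | succ i => exact hg' i (s i)
  have hU : LinearIndepOn K v (⋃ i, (s i).1) :=
    linearIndepOn_iUnion_of_directed hmono.directed_le fun i => (s i).2.1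
  obtain ⟨b, -, hsb, hb, hli⟩ := exists_linearIndepOn_extension hU (Set.subset_univ _)
  refine ⟨b, hli, fun x => hb ⟨x, trivial, rfl⟩, fun i => (hspan i).trans ?_⟩
  refine Submodule.span_mono (Set.image_mono fun x hx => ⟨hsb ?_, (s i).2.2 hx⟩)
  exact Set.mem_iUnion.2 ⟨i, hx⟩

section Coordinates

variable {k : Type*} [Field k] {H : Type*} [Ring H] [Algebra k⟦X⟧ H]

theorem powerSeries_eq_C_add_X_mul (r : k⟦X⟧) :
    ∃ (c : k) (r' : k⟦X⟧), r = PowerSeries.C c + PowerSeries.X * r' :=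
  ⟨_, _, (PowerSeries.eq_X_mul_shift_add_const r).trans (add_comm _ _)⟩

/-- Additive maps that commute with constants and with `h` are `k⟦h⟧`-linear. -/
theorem exists_linearMap_of_X {M : Type*} [AddCommGroup M] [Module k⟦X⟧ M] (f : M →+ k⟦X⟧)
    (hC : ∀ (c : k) x, f (PowerSeries.C c • x) = PowerSeries.C c * f x)
    (hX : ∀ x, f ((PowerSeries.X : k⟦X⟧) • x) = PowerSeries.X * f x) :
    ∃ g : M →ₗ[k⟦X⟧] k⟦X⟧, ∀ x, g x = f x := by
  -- Peeling off the constant term of r gains one power of h at a time, so linearity holds modulo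
  -- every h^n.
  have key : ∀ (n : ℕ) (r : k⟦X⟧) (x : M), PowerSeries.X ^ n ∣ f (r • x) - r * f x := by
    intro n
    induction n with
    | zero => simp
    | succ n ih =>
      intro r x
      obtain ⟨c, r', rfl⟩ := powerSeries_eq_C_add_X_mul r
      have : f ((PowerSeries.C c + PowerSeries.X * r') • x) -
          (PowerSeries.C c + PowerSeries.X * r') * f x =
          PowerSeries.X * (f (r' • x) - r' * f x) := by
        rw [add_smul, map_add, hC, mul_smul, hX]
        ring
      rw [this, pow_succ']
      exact mul_dvd_mul_left _ (ih r' x)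
  let g : M →ₗ[k⟦X⟧] k⟦X⟧ :=
    { toFun := f
      map_add' := map_add f
      map_smul' := fun r x => eq_of_sub_mem k fun n => key n r x }
  exact ⟨g, fun _ => rfl⟩

/-- A family of elements of `H`, with coordinate functions, that spans a dense submodule. -/
structure IsCoordinates {β : Type*} (u : β → H) (coord : β → H →ₗ[k⟦X⟧] k⟦X⟧) : Prop where
  dense : ∀ (n : ℕ) (y : H), ∃ F : β →₀ k⟦X⟧,
    y - F.sum (fun i r => r • u i) ∈ hIdeal k H n
  coord_self : ∀ i, coord i (u i) = 1
  coord_ne : ∀ i j, i ≠ j → coord i (u j) = 0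

/-- Lift to H a basis of H/hH adapted to the images of t i = {a : h^i a ∈ P}. Writing y = L(κ y) + h
T(y), with κ the coordinates mod h and L the lift, the n-th coefficient of a coordinate of y is that
of κ(Tⁿ y). Adaptedness makes the elements h^i u ∈ P, with u in the basis, span a dense part of P,
which bounds the coordinates on P. -/
theorem exists_coordinates (hH : IsTopFree k H) (P : Submodule k⟦X⟧ H) :
    ∃ (b : Set H) (coord : b → H →ₗ[k⟦X⟧] k⟦X⟧),
      IsCoordinates (fun u : b => (u : H)) coord ∧
      ∀ u : b, (∃ i : ℕ, (PowerSeries.X ^ i : k⟦X⟧) • (u : H) ∈ P ∧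
        ∀ y ∈ P, PowerSeries.X ^ i ∣ coord u y) ∨ ∀ y ∈ P, coord u y = 0 := by
  classical
  let _ : Module k H := Module.compHom H (PowerSeries.C : k →+* k⟦X⟧)
  have hsmul : ∀ (c : k) (x : H), c • x = (PowerSeries.C c : k⟦X⟧) • x := fun _ _ => rfl
  let N : Submodule k H :=
    { carrier := {a | ∃ b, a = (PowerSeries.X : k⟦X⟧) • b}
      zero_mem' := ⟨0, by simp⟩
      add_mem' := by
        rintro _ _ ⟨a, rfl⟩ ⟨b, rfl⟩
        exact ⟨a + b, (smul_add _ _ _).symm⟩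
      smul_mem' := by
        rintro c _ ⟨a, rfl⟩
        exact ⟨c • a, by rw [hsmul, hsmul, smul_comm]⟩ }
  let t : ℕ → Set H := fun i => {a | (PowerSeries.X ^ i : k⟦X⟧) • a ∈ P}
  have ht : Monotone t := monotone_nat_of_le_succ fun i a (ha : _ ∈ P) => by
    change _ ∈ P
    rw [pow_succ', mul_smul]
    exact P.smul_mem _ ha
  obtain ⟨b, hli, hspan, hb⟩ := exists_linearIndepOn_adapted (K := k) N.mkQ t ht
  let B : Module.Basis b k (H ⧸ N) := Module.Basis.mk hli (by
    rintro x -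
    obtain ⟨y, rfl⟩ := N.mkQ_surjective x
    have := hspan y
    rwa [Set.image_eq_range] at this)
  have hB : ∀ u : b, B u = N.mkQ u := fun u => Module.Basis.mk_apply _ _ u
  have hX : ∀ {a c : H}, (PowerSeries.X : k⟦X⟧) • a = (PowerSeries.X : k⟦X⟧) • c → a = c :=
    fun {a c} h => hH.smul_cancel (n := 1) (by simpa using h)
  let κ : H →ₗ[k] (b →₀ k) := B.repr.toLinearMap ∘ₗ N.mkQ
  let L : (b →₀ k) →ₗ[k] H := Finsupp.linearCombination k (fun u : b => (u : H))
  have hT : ∀ y, ∃ z, y - L (κ y) = (PowerSeries.X : k⟦X⟧) • z := fun y => by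
    change y - L (κ y) ∈ N
    rw [← N.ker_mkQ, LinearMap.mem_ker, map_sub, sub_eq_zero]
    have h1 : N.mkQ (L (κ y)) = Finsupp.linearCombination k B (κ y) := by
      rw [Finsupp.apply_linearCombination]
      congr 2
      funext u
      exact (hB u).symm
    rw [h1]
    exact (B.linearCombination_repr _).symm
  choose T hT using hT
  have hTadd : ∀ x y, T (x + y) = T x + T y := fun x y => hX (by
    rw [smul_add, ← hT, ← hT, ← hT, map_add, map_add]; abel)
  have hTsmul : ∀ (c : k) x, T (c • x) = c • T x := fun c x => hX (by
    rw [hsmul c (T x), smul_comm, ← hsmul, ← hT, ← hT, map_smul, map_smul, smul_sub])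
  let T' : H →ₗ[k] H := { toFun := T, map_add' := hTadd, map_smul' := hTsmul }
  have hκX : ∀ x, κ ((PowerSeries.X : k⟦X⟧) • x) = 0 := fun x => by
    have : N.mkQ ((PowerSeries.X : k⟦X⟧) • x) = 0 := by
      rw [← LinearMap.mem_ker, N.ker_mkQ]
      exact ⟨x, rfl⟩
    simp only [κ, LinearMap.comp_apply, this, map_zero]
  have hTX : ∀ x, T' ((PowerSeries.X : k⟦X⟧) • x) = x := fun x => hX (by
    change _ • T _ = _
    rw [← hT, hκX, map_zero, sub_zero])
  have hκu : ∀ u : b, κ u = Finsupp.single u 1 := fun u => by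
    change B.repr (N.mkQ u) = _
    rw [← hB, B.repr_self]
  have hTu : ∀ u : b, T' (u : H) = 0 := fun u => hX (by
    change _ • T _ = _
    rw [← hT, hκu, smul_zero, Finsupp.linearCombination_single, one_smul, sub_self])
  have hcoord : ∀ u : b, ∃ g : H →ₗ[k⟦X⟧] k⟦X⟧, ∀ y,
      g y = PowerSeries.mk fun n => κ ((T' ^ n) y) u := fun u => by
    let f : H →+ k⟦X⟧ := AddMonoidHom.mk' (fun y => PowerSeries.mk fun n => κ ((T' ^ n) y) u)
      fun x y => by ext n; simp
    refine exists_linearMap_of_X f (fun c x => ?_) fun x => ?_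
    · ext n
      rw [← hsmul]
      simp [f]
    · ext n
      cases n with
      | zero => simp [f, hκX]
      | succ n =>
        rw [PowerSeries.coeff_succ_X_mul]
        simp only [f, AddMonoidHom.mk'_apply, PowerSeries.coeff_mk]
        rw [pow_succ, Module.End.mul_apply, hTX]
  choose coord hcoord using hcoord
  have hself : ∀ i j : b, coord i j = if i = j then 1 else 0 := fun i j => by
    rw [hcoord]
    ext n
    cases n with
    | zero =>
      rw [PowerSeries.coeff_mk, pow_zero, Module.End.one_apply, hκu, Finsupp.single_apply]
      by_cases h : i = j
      · simp [h]
      · rw [if_neg h, if_neg (Ne.symm h)]; simp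
    | succ n =>
      rw [PowerSeries.coeff_mk, pow_succ, Module.End.mul_apply, hTu, map_zero, map_zero]
      split_ifs <;> simp [PowerSeries.coeff_one]
  refine ⟨b, coord, ⟨fun n => ?_, fun i => by simp [hself], fun i j h => by simp [hself, h]⟩, ?_⟩
  · induction n with
    | zero => exact fun y => ⟨0, mem_hIdeal_zero _⟩
    | succ n ih =>
      intro y
      obtain ⟨F, z, hz⟩ := ih (T y)
      refine ⟨(κ y).mapRange (PowerSeries.C : k →+* k⟦X⟧) (map_zero _) +
        (PowerSeries.X : k⟦X⟧) • F, z, ?_⟩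
      rw [Finsupp.sum_add_index' (by simp) (by simp [add_smul]),
        Finsupp.sum_mapRange_index (by simp), Finsupp.sum_smul_index (by simp), pow_succ',
        mul_smul, ← hz, smul_sub, ← hT, ← sub_sub]
      congr 1
      simp only [mul_smul, Finsupp.smul_sum]
  -- The multiples h^i u lying in P generate S; approximating P by S reduces divisibility of
  -- coordinates to these generators.
  · let S : Submodule k⟦X⟧ H := Submodule.span k⟦X⟧
      {x | ∃ (i : ℕ) (u : H), u ∈ b ∩ t i ∧ x = (PowerSeries.X ^ i : k⟦X⟧) • u}
    have hSP : S ≤ P := Submodule.span_le.2 (by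
      rintro _ ⟨i, u, hu, rfl⟩
      exact hu.2)
    have happrox : ∀ y ∈ P, ∀ n : ℕ, ∃ z ∈ S, y - z ∈ hIdeal k H n := by
      intro y hy n
      induction n with
      | zero => exact ⟨0, zero_mem _, mem_hIdeal_zero _⟩
      | succ n ih =>
        obtain ⟨z, hz, a, ha⟩ := ih
        have hat : a ∈ t n := by
          change _ ∈ P
          rw [← ha]
          exact P.sub_mem hy (hSP hz)
        -- The error is h^n a with a ∈ t n; modulo h, a is a combination of basis elements in t n,
        -- which improves the approximation by one order.
        have h1 := hb n ⟨a, hat, rfl⟩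
        rw [SetLike.mem_coe, ← Submodule.map_span] at h1
        obtain ⟨a0, ha0, haa⟩ := h1
        have h2 : a - a0 ∈ N := by
          rw [← N.ker_mkQ, LinearMap.mem_ker, map_sub, haa, sub_self]
        obtain ⟨a1, ha1⟩ := h2
        refine ⟨z + (PowerSeries.X ^ n : k⟦X⟧) • a0, S.add_mem hz ?_, a1, ?_⟩
        · clear haa ha1
          induction ha0 using Submodule.span_induction with
          | mem u hu => exact Submodule.subset_span ⟨n, u, hu, rfl⟩
          | zero => simp
          | add x y _ _ hx hy => rw [smul_add]; exact S.add_mem hx hy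
          | smul c x _ hx => rw [hsmul, smul_comm]; exact S.smul_mem _ hx
        · rw [← sub_sub, ha, ← smul_sub, ha1, smul_smul, pow_succ]
    intro u
    by_cases hu : ∃ i, (u : H) ∈ t i
    -- The least i with h^i u ∈ P serves for both claims: any generator h^j u of S has j ≥ i.
    · refine Or.inl ⟨Nat.find hu, Nat.find_spec hu, fun y hy => ?_⟩
      obtain ⟨z, hz, hyz⟩ := happrox y hy (Nat.find hu)
      have h1 : PowerSeries.X ^ Nat.find hu ∣ coord u z := by
        clear hyz
        induction hz using Submodule.span_induction with
        | mem x hx =>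
          obtain ⟨i, w, hw, rfl⟩ := hx
          rw [map_smul, smul_eq_mul, show coord u w = _ from hself u ⟨w, hw.1⟩]
          split_ifs with h
          · subst h
            exact (pow_dvd_pow _ (Nat.find_min' hu hw.2)).mul_right _
          · simp
        | zero => simp
        | add x y _ _ hx hy => rw [map_add]; exact dvd_add hx hy
        | smul c x _ hx => rw [map_smul, smul_eq_mul]; exact hx.mul_left _
      have h2 : PowerSeries.X ^ Nat.find hu ∣ coord u (y - z) := map_mem_hIdeal (coord u) hyz
      simpa using dvd_add h2 h1
    · refine Or.inr fun y hy => IsHSeparated.eq_zero (k := k) _ fun n => ?_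
      obtain ⟨z, hz, hyz⟩ := happrox y hy n
      have h1 : coord u z = 0 := by
        clear hyz
        induction hz using Submodule.span_induction with
        | mem x hx =>
          obtain ⟨i, w, hw, rfl⟩ := hx
          rw [map_smul, smul_eq_mul, show coord u w = _ from hself u ⟨w, hw.1⟩]
          split_ifs with h
          · subst h
            exact absurd ⟨i, hw.2⟩ hu
          · simp
        | zero => simp
        | add x y _ _ hx hy => rw [map_add, hx, hy, add_zero]
        | smul c x _ hx => rw [map_smul, hx, smul_zero]
      have h2 := map_mem_hIdeal (coord u) hyz
      rwa [map_sub, h1, sub_zero] at h2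

end Coordinates

end

end HAdic

namespace HAdic

noncomputable section

/-! ### Density of tensors of basis elements -/

section Density

variable {k : Type*} [Field k] {H : Type*} [Ring H] [Algebra k⟦X⟧ H]

theorem isTopFree_powerSeries : IsTopFree k k⟦X⟧ where
  complete := inferInstance
  torsionFree := inferInstance

variable (k H) in
/-- The pure tensors, as a multilinear map. -/
def pureMul (ι : Type*) : MultilinearMap k⟦X⟧ (fun _ : ι => H) (TPow k H ι) :=
  (HCompl.of k _).toLinearMap.compMultilinearMap (PiTensorProduct.tprod k⟦X⟧)

theorem pureMul_apply {ι : Type*} (a : ι → H) : pureMul k H ι a = pure k a := rfl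

/-- Replace the factors one at a time; each replacement changes the tensor by a multiple of h^n. -/
theorem pure_sub_pure_mem {ι : Type*} [Fintype ι] {n : ℕ} {a a' : ι → H}
    (h : ∀ i, a i - a' i ∈ hIdeal k H n) : pure k a - pure k a' ∈ hIdeal k (TPow k H ι) n := by
  classical
  have key : ∀ s : Finset ι, pure k (s.piecewise a a') - pure k a' ∈ hIdeal k (TPow k H ι) n := by
    intro s
    induction s using Finset.induction_on with
    | empty => simp
    | insert i s hi ih =>
      obtain ⟨z, hz⟩ := h i
      have h1 : pure k ((insert i s).piecewise a a') - pure k (s.piecewise a a') ∈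
          hIdeal k (TPow k H ι) n := by
        refine ⟨pure k (Function.update (s.piecewise a a') i z), ?_⟩
        have h2 : s.piecewise a a' = Function.update (s.piecewise a a') i (a' i) := by
          rw [eq_comm, Function.update_eq_self_iff, Finset.piecewise_eq_of_notMem _ _ _ hi]
        conv_lhs => rw [Finset.piecewise_insert]; right; rw [h2]
        simp only [← pureMul_apply]
        rw [← MultilinearMap.map_update_sub, hz, MultilinearMap.map_update_smul]
      simpa using Ideal.add_mem _ h1 ih
  simpa using key Finset.univ

theorem IsCoordinates.dense_pure {β : Type*} {u : β → H} {coord : β → H →ₗ[k⟦X⟧] k⟦X⟧}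
    (hu : IsCoordinates u coord) {ι : Type*} [Fintype ι] (n : ℕ) (x : TPow k H ι) :
    ∃ G : (ι → β) →₀ k⟦X⟧,
      x - G.sum (fun r c => c • pure k fun i => u (r i)) ∈ hIdeal k (TPow k H ι) n := by
  classical
  let D : Submodule k⟦X⟧ (TPow k H ι) :=
    Submodule.span k⟦X⟧ (Set.range fun r : ι → β => pure k fun i => u (r i)) ⊔
      (hIdeal k (TPow k H ι) n).restrictScalars k⟦X⟧
  have hD : ∀ a : ι → H, pure k a ∈ D := by
    intro a
    choose F hF using fun i => hu.dense n (a i)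
    have h1 := pure_sub_pure_mem hF
    rw [← sub_add_cancel (pure k a) (pure k fun i => (F i).sum fun i r => r • u i)]
    refine D.add_mem (Submodule.mem_sup_right h1) (Submodule.mem_sup_left ?_)
    simp only [Finsupp.sum]
    rw [← pureMul_apply, MultilinearMap.map_sum_finset]
    refine Submodule.sum_mem _ fun r _ => ?_
    rw [MultilinearMap.map_smul_univ]
    exact Submodule.smul_mem _ _ (Submodule.subset_span ⟨r, rfl⟩)
  obtain ⟨y, hy⟩ := HCompl.exists_sub_of_mem x n
  have hy' : HCompl.of k _ y ∈ D := by
    have h2 : y ∈ Submodule.span k⟦X⟧ (Set.range (PiTensorProduct.tprod k⟦X⟧)) := by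
      rw [PiTensorProduct.span_tprod_eq_top]; trivial
    clear hy
    induction h2 using Submodule.span_induction with
    | mem y hy =>
      obtain ⟨a, rfl⟩ := hy
      exact hD a
    | zero => rw [map_zero]; exact D.zero_mem
    | add y z _ _ hy hz => rw [map_add]; exact D.add_mem hy hz
    | smul c y _ hy => rw [map_smul]; exact D.smul_mem c hy
  have hx : x ∈ D := by
    rw [← sub_add_cancel x (HCompl.of k _ y)]
    exact D.add_mem (Submodule.mem_sup_right hy) hy'
  obtain ⟨s, hs, t, ht, rfl⟩ := Submodule.mem_sup.1 hx
  obtain ⟨G, rfl⟩ := Finsupp.mem_span_range_iff_exists_finsupp.1 hs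
  exact ⟨G, by rwa [add_sub_cancel_left]⟩

theorem IsCoordinates.mem_hIdeal_of_coord {β : Type*} {u : β → H}
    {coord : β → H →ₗ[k⟦X⟧] k⟦X⟧} (hu : IsCoordinates u coord) {n : ℕ} {y : H}
    (h : ∀ i, coord i y ∈ hIdeal k k⟦X⟧ n) : y ∈ hIdeal k H n := by
  classical
  obtain ⟨F, hF⟩ := hu.dense n y
  have h1 : ∀ j, F j ∈ hIdeal k k⟦X⟧ n := fun j => by
    have h2 := Ideal.sub_mem _ (h j) (map_mem_hIdeal (coord j) hF)
    rw [map_sub, sub_sub_cancel, map_finsuppSum] at h2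
    have h3 : (F.sum fun i r => coord j (r • u i)) = F j := by
      rw [Finsupp.sum, Finset.sum_eq_single j]
      · simp [hu.coord_self]
      · intro i _ hij
        simp [hu.coord_ne j i hij.symm]
      · intro hj
        simp [Finsupp.notMem_support_iff.1 hj]
    rwa [h3] at h2
  have h4 : (F.sum fun i r => r • u i) ∈ hIdeal k H n := by
    refine Ideal.sum_mem _ fun i _ => ?_
    obtain ⟨c, hc⟩ := h1 i
    change F i • u i ∈ _
    rw [hc, smul_eq_mul, mul_smul]
    exact smul_mem_hIdeal n _
  simpa using Ideal.add_mem _ hF h4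

/-- A functional, with values in the completion of `k⟦h⟧`. -/
def hat (f : H →ₗ[k⟦X⟧] k⟦X⟧) : H →ₗ[k⟦X⟧] HCompl k k⟦X⟧ :=
  (HCompl.of k k⟦X⟧).toLinearMap ∘ₗ f

theorem hat_apply (f : H →ₗ[k⟦X⟧] k⟦X⟧) (a : H) : hat f a = HCompl.of k k⟦X⟧ (f a) := rfl

/-- Modulo h^n the tensor is a finite combination of tensors of basis elements, whose coefficients
are read off by products of coordinates. Divisibility in H^{⊗m} is thus tested by scalar
functionals. -/
theorem IsCoordinates.mem_hIdeal_of_tensFin {β : Type*} {u : β → H}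
    {coord : β → H →ₗ[k⟦X⟧] k⟦X⟧} (hu : IsCoordinates u coord) {m n : ℕ} {x : TPow k H (Fin m)}
    (h : ∀ r : Fin m → β,
      tensFin (fun i => hat (coord (r i))) x ∈ hIdeal k (HCompl k k⟦X⟧) n) :
    x ∈ hIdeal k (TPow k H (Fin m)) n := by
  classical
  obtain ⟨G, hG⟩ := hu.dense_pure n x
  have h1 : ∀ r, G r ∈ hIdeal k k⟦X⟧ n := fun r => by
    have h2 := Ideal.sub_mem _ (h r) (map_mem_hIdeal (tensFin fun i => hat (coord (r i))) hG)
    rw [map_sub, sub_sub_cancel, map_finsuppSum] at h2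
    have h3 : (G.sum fun r' c => tensFin (fun i => hat (coord (r i)))
        (c • pure k fun i => u (r' i))) = HCompl.of k k⟦X⟧ (G r) := by
      rw [Finsupp.sum, Finset.sum_eq_single r]
      · simp only [map_smul, tensFin_pure, hat_apply, hu.coord_self, map_one]
        simp [Algebra.smul_def]
        rfl
      · intro r' _ hr
        obtain ⟨i, hi⟩ := Function.ne_iff.1 hr
        rw [map_smul, tensFin_pure, List.prod_eq_zero, smul_zero]
        rw [List.mem_ofFn]
        exact ⟨i, by rw [hat_apply, hu.coord_ne _ _ hi.symm, map_zero]⟩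
      · intro hr
        rw [Finsupp.notMem_support_iff.1 hr, zero_smul, map_zero]
    rwa [h3, HCompl.of_mem_hIdeal_iff] at h2
  have h4 : (G.sum fun r c => c • pure k fun i => u (r i)) ∈ hIdeal k (TPow k H (Fin m)) n := by
    refine Ideal.sum_mem _ fun i _ => ?_
    obtain ⟨c, hc⟩ := h1 i
    change G i • pure k (fun j => u (i j)) ∈ _
    rw [hc, smul_eq_mul, mul_smul]
    exact smul_mem_hIdeal n _
  simpa using Ideal.add_mem _ hG h4

/-! ### Slices -/

/-- `id ⊗ f : H ⊗ H → H`. -/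
def sliceRight (hH : IsTopFree k H) (f : H →ₗ[k⟦X⟧] k⟦X⟧) : TPow k H (Fin 2) →ₗ[k⟦X⟧] H :=
  hH.ofEquiv.symm.toLinearMap ∘ₗ
    tens (HCompl.of k H).toLinearMap (Algebra.linearMap k⟦X⟧ (HCompl k H) ∘ₗ f)

/-- `f ⊗ id : H ⊗ H → H`. -/
def sliceLeft (hH : IsTopFree k H) (f : H →ₗ[k⟦X⟧] k⟦X⟧) : TPow k H (Fin 2) →ₗ[k⟦X⟧] H :=
  hH.ofEquiv.symm.toLinearMap ∘ₗ
    tens (Algebra.linearMap k⟦X⟧ (HCompl k H) ∘ₗ f) (HCompl.of k H).toLinearMap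

theorem hat_sliceRight (hH : IsTopFree k H) (f g : H →ₗ[k⟦X⟧] k⟦X⟧) (x : TPow k H (Fin 2)) :
    hat f (sliceRight hH g x) = tens (hat f) (hat g) x := by
  have h := TopHopf.Conv.linearMap_comp_tens (HCompl.lift (hat f)) (HCompl.of k H).toLinearMap
    (Algebra.linearMap k⟦X⟧ (HCompl k H) ∘ₗ g) (hat f) (hat g) (fun a b => by
      rw [LinearMap.comp_apply, Algebra.linearMap_apply, ← Algebra.commutes, ← Algebra.smul_def,
        map_smul, AlgHom.toLinearMap_apply, HCompl.lift_of, hat_apply, hat_apply, ← map_smul,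
        ← map_mul, smul_eq_mul, mul_comm]) x
  rw [← h, ← hH.of_ofEquiv_symm (tens _ _ x), HCompl.lift_of]
  rfl

theorem hat_sliceLeft (hH : IsTopFree k H) (f g : H →ₗ[k⟦X⟧] k⟦X⟧) (x : TPow k H (Fin 2)) :
    hat g (sliceLeft hH f x) = tens (hat f) (hat g) x := by
  have h := TopHopf.Conv.linearMap_comp_tens (HCompl.lift (hat g))
    (Algebra.linearMap k⟦X⟧ (HCompl k H) ∘ₗ f) (HCompl.of k H).toLinearMap (hat f) (hat g)
    (fun a b => by
      rw [LinearMap.comp_apply, Algebra.linearMap_apply, ← Algebra.smul_def,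
        map_smul, AlgHom.toLinearMap_apply, HCompl.lift_of, hat_apply, hat_apply, ← map_smul,
        ← map_mul, smul_eq_mul]) x
  rw [← h, ← hH.of_ofEquiv_symm (tens _ _ x), HCompl.lift_of]
  rfl

theorem sliceLeft_pure (hH : IsTopFree k H) (f : H →ₗ[k⟦X⟧] k⟦X⟧) (a : Fin 2 → H) :
    sliceLeft hH f (pure k a) = f (a 0) • a 1 := by
  rw [sliceLeft, LinearMap.comp_apply, tens_pure, LinearMap.comp_apply, Algebra.linearMap_apply,
    ← Algebra.smul_def, map_smul]
  congr 1
  exact hH.ofEquiv.symm_apply_apply (a 1)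

theorem apply_sliceRight (hH : IsTopFree k H) (f g : H →ₗ[k⟦X⟧] k⟦X⟧) (x : TPow k H (Fin 2)) :
    f (sliceRight hH g x) = g (sliceLeft hH f x) := by
  refine HCompl.of_injective (k := k) ?_
  rw [← hat_apply, ← hat_apply, hat_sliceRight, hat_sliceLeft]

end Density

/-! ### The convolution algebra and the maps `δₙ` -/

theorem moebius_congr {R M ι : Type*} [CommRing R] [AddCommGroup M] [Module R M]
    {F G : Finset ι → M} {s : Finset ι} (h : ∀ t ⊆ s, F t = G t) :
    moebius R F s = moebius R G s :=
  Finset.sum_congr rfl fun t ht => by rw [h t (Finset.mem_powerset.1 ht)]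

/-- Taking the difference in c splits off the factor f c - 1. In the convolution algebra this gives
δₙ = (id - ε)^{⊗n} ∘ Δⁿ, that is, `delta_eq_prod`. -/
theorem moebius_prod_ite {A ι : Type*} [Ring A] [DecidableEq ι] (f : ι → A) (l : List ι)
    (hl : l.Nodup) :
    moebius ℤ (fun s => (l.map fun c => if c ∈ s then f c else 1).prod) l.toFinset =
      (l.map fun c => f c - 1).prod := by
  induction l with
  | nil => simp [moebius]
  | cons c l ih =>
    rw [List.nodup_cons] at hl
    have hc : c ∉ l.toFinset := by simpa using hl.1
    rw [List.toFinset_cons, moebius_insert _ hc, List.map_cons, List.prod_cons, ← ih hl.2]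
    have h1 : moebius ℤ (fun t => ((c :: l).map fun d => if d ∈ insert c t then f d else 1).prod)
        l.toFinset = f c * moebius ℤ (fun s => (l.map fun c => if c ∈ s then f c else 1).prod)
        l.toFinset := by
      rw [← LinearMap.mulLeft_apply (R := ℤ), moebius_linearMap]
      refine moebius_congr fun t ht => ?_
      rw [List.map_cons, List.prod_cons, if_pos (Finset.mem_insert_self c t),
        LinearMap.mulLeft_apply]
      congr 2
      refine List.map_congr_left fun d hd => ?_
      have : d ≠ c := by rintro rfl; exact hl.1 hd
      simp [this]
    have h2 : moebius ℤ (fun s => ((c :: l).map fun d => if d ∈ s then f d else 1).prod)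
        l.toFinset = moebius ℤ (fun s => (l.map fun c => if c ∈ s then f c else 1).prod)
        l.toFinset := by
      refine moebius_congr fun t ht => ?_
      rw [List.map_cons, List.prod_cons, if_neg fun h => hc (ht h), one_mul]
    rw [h1, h2, sub_mul, one_mul]

namespace TopHopf

open Conv

variable {k : Type*} [Field k] {H : Type*} [Ring H] [Algebra k⟦X⟧ H] {𝓗 : TopHopf k H}
  {B : Type*} [Ring B] [Algebra k⟦X⟧ B]

variable (𝓗) in
/-- The projection `a ↦ a - ε(a)` onto the augmentation ideal. -/
def augProj : H →ₗ[k⟦X⟧] H :=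
  LinearMap.id - Algebra.linearMap k⟦X⟧ H ∘ₗ 𝓗.counit.toLinearMap

theorem augProj_one : 𝓗.augProj 1 = 0 := by simp [augProj]

theorem delta_eq_prod (n : ℕ) (a : H) :
    𝓗.delta n a =
      ((List.finRange n).map fun c => ofLin 𝓗 ((single c).toLinearMap ∘ₗ 𝓗.augProj)).prod a := by
  have h1 : ∀ s : Finset (Fin n), 𝓗.comulOn s a =
      ∑ t ∈ s.powerset, moebius ℤ (fun s : Finset (Fin n) => 𝓗.comulOn s) t a := fun s => by
    have := congrArg (AddMonoidHom.mk' (fun f : 𝓗.Conv (⨂[k⟦X⟧] _ : Fin n, H) => f a)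
      fun _ _ => rfl)
      (sum_powerset_moebius (R := ℤ) (fun s : Finset (Fin n) => 𝓗.comulOn s) s)
    rw [map_sum] at this
    exact this.symm
  rw [delta_eq_moebius, moebius_eq_of_sum h1]
  have h2 := moebius_prod_ite (fun c : Fin n => ofAlg 𝓗 (single c)) _ (List.nodup_finRange n)
  have h3 : (List.finRange n).toFinset = Finset.univ := by ext; simp
  rw [h3] at h2
  refine (congrArg (fun f => f a) h2).trans ?_
  congr 3
  funext c
  ext a
  simp only [Conv.sub_apply, ofAlg_apply, one_apply, ofLin_apply, LinearMap.comp_apply, augProj,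
    LinearMap.sub_apply, LinearMap.id_apply, AlgHom.toLinearMap_apply, map_sub,
    Algebra.linearMap_apply, AlgHom.commutes]

/-- `f` is a convolution product of `n` functionals that vanish at `1`. -/
def IsWeight (𝓗 : TopHopf k H) (n : ℕ) (f : H →ₗ[k⟦X⟧] k⟦X⟧) : Prop :=
  ∃ l : List (𝓗.Conv k⟦X⟧), l.length = n ∧ (∀ g ∈ l, g 1 = 0) ∧ ofLin 𝓗 (hat f) = l.prod

theorem isWeight_counit : 𝓗.IsWeight 0 𝓗.counit.toLinearMap :=
  ⟨[], rfl, by simp, rfl⟩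

theorem isWeight_of_apply_one {f : H →ₗ[k⟦X⟧] k⟦X⟧} (hf : f 1 = 0) : 𝓗.IsWeight 1 f :=
  ⟨[ofLin 𝓗 (hat f)], rfl, by simp [hat_apply, hf], by simp⟩

theorem exists_isWeight {n : ℕ} (f : Fin n → H →ₗ[k⟦X⟧] HCompl k k⟦X⟧) (hf : ∀ c, f c 1 = 0) :
    ∃ g, 𝓗.IsWeight n g ∧
      ofLin 𝓗 (hat g) = ((List.finRange n).map fun c => ofLin 𝓗 (f c)).prod := by
  let P : 𝓗.Conv k⟦X⟧ := ((List.finRange n).map fun c => ofLin 𝓗 (f c)).prod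
  have h : ofLin 𝓗 (hat (isTopFree_powerSeries.ofEquiv.symm.toLinearMap ∘ₗ P.lin)) = P := by
    ext a
    exact isTopFree_powerSeries.of_ofEquiv_symm _
  refine ⟨_, ⟨_, ?_, ?_, h⟩, h⟩
  · simp
  · intro g hg
    obtain ⟨c, -, rfl⟩ := List.mem_map.1 hg
    exact hf c

/-- Divisibility of δₙ(a) is tested on products of coordinates, and such a product composed with (id
- ε)^{⊗n} ∘ Δⁿ is a functional of weight n. -/
theorem mem_drinfeld_of_isWeight (hH : IsTopFree k H) {a : H}
    (h : ∀ n f, 𝓗.IsWeight n f → f a ∈ hIdeal k k⟦X⟧ n) : a ∈ 𝓗.drinfeld := by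
  -- Adaptedness plays no role here, so the submodule may be taken to be zero.
  obtain ⟨b, coord, hu, -⟩ := exists_coordinates hH ⊥
  intro n
  refine hu.mem_hIdeal_of_tensFin fun r => ?_
  rw [delta_eq_prod, tensFin_prod]
  obtain ⟨g, hg, hg'⟩ := exists_isWeight (𝓗 := 𝓗)
    (fun c => hat (coord (r c)) ∘ₗ 𝓗.augProj) (fun c => by simp [augProj_one])
  rw [← hg', ofLin_apply, hat_apply, HCompl.of_mem_hIdeal_iff]
  exact h n g hg

/-- Weights 0 and 1 already force divisibility by h^i in H; after division, which is unambiguous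
without torsion, the remaining bounds say that the quotient lies in H'. -/
theorem exists_smul_of_isWeight (hH : IsTopFree k H) {i : ℕ} {a : H}
    (h : ∀ n f, 𝓗.IsWeight n f → f a ∈ hIdeal k k⟦X⟧ (n + i)) :
    ∃ z ∈ 𝓗.drinfeld, a = (PowerSeries.X ^ i : k⟦X⟧) • z := by
  obtain ⟨b, coord, hu, -⟩ := exists_coordinates hH ⊥
  have h1 : a ∈ hIdeal k H i := hu.mem_hIdeal_of_coord fun j => by
    have h2 := h 0 _ isWeight_counit
    -- A coordinate is the sum of a weight-1 functional and its value at 1 times ε, which has weight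
    -- 0.
    have h3 := h 1 (coord j - coord j 1 • 𝓗.counit.toLinearMap)
      (isWeight_of_apply_one (by simp))
    rw [zero_add] at h2
    have h4 := Ideal.add_mem _ (hIdeal_anti k _ (Nat.le_add_left i 1) h3)
      (hIdeal_smul_mem (coord j 1) h2)
    simpa using h4
  obtain ⟨z, rfl⟩ := h1
  refine ⟨z, mem_drinfeld_of_isWeight hH fun n f hf => ?_, rfl⟩
  have := h n f hf
  rw [map_smul, add_comm] at this
  exact isTopFree_powerSeries.mem_hIdeal_of_smul this

/-! ### `(H ⊗ H)'` is the closure of `H' ⊗ H'` -/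

theorem ofFn_add_cases {α : Type*} {m n : ℕ} (F : Fin (m + n) → α) :
    List.ofFn F = (List.ofFn fun i => F (Fin.castAdd n i)) ++
      List.ofFn fun i => F (Fin.natAdd m i) := List.ofFn_add

/-- The two columns of `Fin n × Fin 2`, one after the other. -/
def colEquiv (n : ℕ) : Fin (n + n) ≃ Fin n × Fin 2 where
  toFun := Fin.addCases (fun c => (c, 0)) fun c => (c, 1)
  invFun p := if p.2 = 0 then Fin.castAdd n p.1 else Fin.natAdd n p.1
  left_inv i := by
    refine Fin.addCases (fun c => ?_) (fun c => ?_) i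
    · simp only [Fin.addCases_left, if_true]
    · simp only [Fin.addCases_right, one_ne_zero, if_false]
  right_inv := by
    rintro ⟨c, i⟩
    fin_cases i
    · exact Fin.addCases_left c
    · exact Fin.addCases_right c

/-- The continuous linear map on `(H ⊗ H)^{⊗n}` that multiplies the images under the `f c` of the
factors at the places `(c, 0)`, then the images under the `g c` of those at the places `(c, 1)`. -/
def tensCols {n : ℕ} (f g : Fin n → H →ₗ[k⟦X⟧] HCompl k B) :
    TPow k H (Fin n × Fin 2) →ₗ[k⟦X⟧] HCompl k B :=
  HCompl.lift (PiTensorProduct.lift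
    (((MultilinearMap.mkPiAlgebraFin k⟦X⟧ (n + n) (HCompl k B)).compLinearMap
      (Fin.addCases f g : Fin (n + n) → H →ₗ[k⟦X⟧] HCompl k B)).domDomCongr (colEquiv n)))

theorem tensCols_pure {n : ℕ} (f g : Fin n → H →ₗ[k⟦X⟧] HCompl k B) (a : Fin n × Fin 2 → H) :
    tensCols f g (pure k a) = (List.ofFn fun c => f c (a (c, 0))).prod *
      (List.ofFn fun c => g c (a (c, 1))).prod := by
  rw [tensCols, pure, HCompl.lift_of, PiTensorProduct.lift.tprod, MultilinearMap.domDomCongr_apply,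
    MultilinearMap.compLinearMap_apply, MultilinearMap.mkPiAlgebraFin_apply, ofFn_add_cases,
    List.prod_append]
  simp only [colEquiv, Equiv.coe_fn_mk, Fin.addCases_left, Fin.addCases_right]

theorem tensCols_place_mul_place {n : ℕ} (f g : Fin n → H →ₗ[k⟦X⟧] HCompl k B)
    (x y : TPow k H (Fin n)) :
    tensCols f g (place (Function.Embedding.sectL (Fin n) (0 : Fin 2)) x *
      place (Function.Embedding.sectL (Fin n) (1 : Fin 2)) y) = tensFin f x * tensFin g y := by
  have hext : ∀ (a : Fin n → H) (c : Fin n) (i j : Fin 2),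
      Function.extend (Function.Embedding.sectL (Fin n) i) a 1 (c, j) =
        if i = j then a c else 1 := fun a c i j => by
    split_ifs with h
    · subst h
      exact (Function.Embedding.sectL (Fin n) i).injective.extend_apply a 1 c
    · rw [Function.extend_apply']
      · rfl
      · rintro ⟨d, hd⟩
        exact h (congrArg Prod.snd hd)
  have h1 : ∀ a : Fin n → H, tensCols f g ∘ₗ
      LinearMap.mulLeft k⟦X⟧ (place (Function.Embedding.sectL (Fin n) (0 : Fin 2)) (pure k a)) ∘ₗ
      place (Function.Embedding.sectL (Fin n) (1 : Fin 2)) =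
      LinearMap.mulLeft k⟦X⟧ (tensFin f (pure k a)) ∘ₗ tensFin g := fun a => TPow.ext fun b => by
    simp [place_pure, pure_mul, tensCols_pure, tensFin_pure, hext]
  have h2 : tensCols f g ∘ₗ
      LinearMap.mulRight k⟦X⟧ (place (Function.Embedding.sectL (Fin n) (1 : Fin 2)) y) ∘ₗ
      place (Function.Embedding.sectL (Fin n) (0 : Fin 2)) =
      LinearMap.mulRight k⟦X⟧ (tensFin g y) ∘ₗ tensFin f := TPow.ext fun a => by
    simpa using LinearMap.congr_fun (h1 a) y
  exact LinearMap.congr_fun h2 x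

theorem tensCols_comulOn₂ {n : ℕ} (f g : Fin n → H →ₗ[k⟦X⟧] HCompl k B) (s : Finset (Fin n))
    (x : TPow k H (Fin 2)) : tensCols f g (𝓗.comulOn₂ s x) =
      tens (tensFin f ∘ₗ (𝓗.comulOn s).lin) (tensFin g ∘ₗ (𝓗.comulOn s).lin) x := by
  refine linearMap_comp_tens (tensCols f g) _ _ _ _ (fun a b => ?_) x
  rw [lin_apply, lin_apply, ← place_sectL_comulOn, ← place_sectL_comulOn,
    tensCols_place_mul_place]
  rfl

/-- For a proper Σ, a missing row c carries 1 in both columns, so vanishing of one of f c, g c at 1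
is enough to kill the term. -/
theorem tensCols_delta₂ {n : ℕ} {f g : Fin n → H →ₗ[k⟦X⟧] HCompl k B}
    (h : ∀ c, f c 1 = 0 ∨ g c 1 = 0) (x : TPow k H (Fin 2)) : tensCols f g (𝓗.delta₂ n x) =
      tens ((List.finRange n).map fun c => ofLin 𝓗 (f c)).prod.lin
        ((List.finRange n).map fun c => ofLin 𝓗 (g c)).prod.lin x := by
  rw [delta₂_apply, map_sum, Finset.sum_eq_single Finset.univ]
  · rw [map_smul, tensCols_comulOn₂]
    simp only [Finset.card_univ, Fintype.card_fin, Nat.sub_self, pow_zero, one_smul]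
    congr 2
    · exact LinearMap.ext fun a => tensFin_comulOn_univ f a
    · exact LinearMap.ext fun a => tensFin_comulOn_univ g a
  · intro s _ hs
    obtain ⟨c, hc⟩ := exists_notMem_of_ne_univ hs
    rw [map_smul, tensCols_comulOn₂]
    have : tens (tensFin f ∘ₗ (𝓗.comulOn s).lin) (tensFin g ∘ₗ (𝓗.comulOn s).lin) = 0 :=
      TPow.ext fun a => by
        rw [tens_pure]
        rcases h c with h | h
        · simp [tensFin_comulOn_eq_zero hc h]
        · simp [tensFin_comulOn_eq_zero hc h]
    rw [this, LinearMap.zero_apply, smul_zero]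
  · simp

theorem tens_mem_of_mem_drinfeld₂ {x : TPow k H (Fin 2)} (hx : x ∈ 𝓗.drinfeld₂)
    {l l' : List (𝓗.Conv B)} (hl : ∀ f ∈ l, f 1 = 0) (hl' : ∀ f ∈ l', f 1 = 0) :
    tens l.prod.lin l'.prod.lin x ∈ hIdeal k (HCompl k B) (l.length + l'.length) := by
  -- The two lists occupy disjoint blocks of rows, padded by ε in the other column: every row has
  -- exactly one listed map, so the orders add up.
  let f : Fin (l.length + l'.length) → H →ₗ[k⟦X⟧] HCompl k B :=
    Fin.addCases (fun c => (l.get c).lin) fun _ => (1 : 𝓗.Conv B).lin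
  let g : Fin (l.length + l'.length) → H →ₗ[k⟦X⟧] HCompl k B :=
    Fin.addCases (fun _ => (1 : 𝓗.Conv B).lin) fun c => (l'.get c).lin
  have hf : ((List.finRange _).map fun c => ofLin 𝓗 (f c)).prod = l.prod := by
    rw [← List.ofFn_eq_map, ofFn_add_cases, List.prod_append]
    simp only [f, Fin.addCases_left, Fin.addCases_right]
    have h1 : (List.ofFn fun c => ofLin 𝓗 (l.get c).lin) = l := List.ofFn_get l
    have h2 : (List.ofFn fun _ : Fin l'.length => ofLin 𝓗 (1 : 𝓗.Conv B).lin).prod = 1 :=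
      List.prod_eq_one fun y hy => by
        obtain ⟨_, rfl⟩ := List.mem_ofFn.1 hy
        rfl
    rw [h1, h2, mul_one]
  have hg : ((List.finRange _).map fun c => ofLin 𝓗 (g c)).prod = l'.prod := by
    rw [← List.ofFn_eq_map, ofFn_add_cases, List.prod_append]
    simp only [g, Fin.addCases_left, Fin.addCases_right]
    have h1 : (List.ofFn fun c => ofLin 𝓗 (l'.get c).lin) = l' := List.ofFn_get l'
    have h2 : (List.ofFn fun _ : Fin l.length => ofLin 𝓗 (1 : 𝓗.Conv B).lin).prod = 1 :=
      List.prod_eq_one fun y hy => by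
        obtain ⟨_, rfl⟩ := List.mem_ofFn.1 hy
        rfl
    rw [h1, h2, one_mul]
  rw [← hf, ← hg, ← tensCols_delta₂]
  · exact map_mem_hIdeal _ (hx _)
  · refine Fin.addCases (fun c => Or.inl ?_) (fun c => Or.inr ?_)
    · simpa [f] using hl _ (List.get_mem l c)
    · simpa [g] using hl' _ (List.get_mem l' c)

theorem apply_sliceRight_mem (hH : IsTopFree k H) {x : TPow k H (Fin 2)} (hx : x ∈ 𝓗.drinfeld₂)
    {m n : ℕ} {f g : H →ₗ[k⟦X⟧] k⟦X⟧} (hf : 𝓗.IsWeight m f) (hg : 𝓗.IsWeight n g) :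
    f (sliceRight hH g x) ∈ hIdeal k k⟦X⟧ (m + n) := by
  obtain ⟨l, rfl, hl, hfl⟩ := hf
  obtain ⟨l', rfl, hl', hgl⟩ := hg
  rw [← HCompl.of_mem_hIdeal_iff, ← hat_apply, hat_sliceRight]
  have := tens_mem_of_mem_drinfeld₂ hx hl hl'
  rwa [← hfl, ← hgl] at this

/-- Expand x along adapted coordinates as a sum of u ⊗ (coord_u ⊗ id)(x). The power h^i needed to
bring u into H' is exactly what the slice can give up while staying in H'. -/
theorem drinfeldAlg₂_le_subTPow (hH : IsTopFree k H) :
    𝓗.drinfeldAlg₂ ≤ subTPow 𝓗.drinfeldAlg (Fin 2) := by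
  classical
  intro x hx
  rw [mem_drinfeldAlg₂] at hx
  have := hH.isHSeparated
  obtain ⟨b, coord, hu, hadapt⟩ := exists_coordinates hH 𝓗.drinfeld
  have hslice : ∀ {n : ℕ} {g : H →ₗ[k⟦X⟧] k⟦X⟧}, 𝓗.IsWeight n g →
      ∃ z ∈ 𝓗.drinfeld, sliceRight hH g x = (PowerSeries.X ^ n : k⟦X⟧) • z := fun hg =>
    exists_smul_of_isWeight hH fun m f hf => apply_sliceRight_mem hH hx hf hg
  have hterm : ∀ u : b, single 0 (u : H) * single 1 (sliceLeft hH (coord u) x) ∈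
      Algebra.adjoin k⟦X⟧ {y | ∃ a : Fin 2 → H, (∀ i, a i ∈ 𝓗.drinfeldAlg) ∧ y = pure k a} := by
    intro u
    rcases hadapt u with ⟨i, hi, hdvd⟩ | h0
    · obtain ⟨r, hr, hr'⟩ := exists_smul_of_isWeight (𝓗 := 𝓗) hH (i := i)
        (a := sliceLeft hH (coord u) x) fun n g hg => by
          obtain ⟨z, hz, hz'⟩ := hslice hg
          -- Exchanging the two slices: the weight of g supplies h^n, and coord_u on H' supplies
          -- h^i.
          rw [← apply_sliceRight hH (coord u) g, hz', map_smul, mem_hIdeal_powerSeries, pow_add,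
            smul_eq_mul]
          exact mul_dvd_mul_left _ (hdvd z hz)
      refine Algebra.subset_adjoin ⟨![(PowerSeries.X ^ i : k⟦X⟧) • (u : H), r], fun j => ?_, ?_⟩
      · fin_cases j
        · exact hi
        · exact hr
      · rw [hr', pure_fin_two, map_smul, mul_smul_comm]
        simp
    · have hzero : sliceLeft hH (coord u) x = 0 :=
        -- When coord_u vanishes on H', every weighted functional kills the slice, so it is
        -- divisible by all powers of h.
        IsHSeparated.eq_zero (k := k) _ fun i => by
          obtain ⟨r, -, hr'⟩ := exists_smul_of_isWeight (𝓗 := 𝓗) hH (i := i)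
            (a := sliceLeft hH (coord u) x) fun n g hg => by
              obtain ⟨z, hz, hz'⟩ := hslice hg
              rw [← apply_sliceRight hH (coord u) g, hz', map_smul, h0 z hz, smul_zero]
              exact Ideal.zero_mem _
          exact ⟨r, hr'⟩
      rw [hzero, map_zero, mul_zero]
      exact Subalgebra.zero_mem _
  intro n
  obtain ⟨G, hG⟩ := hu.dense_pure n x
  let A : Finset b := G.support.image fun r => r 0
  -- A finite truncation of the expansion, containing all first indices of the approximation of x.
  -- It fixes that approximation, so by continuity E x agrees with x modulo h^n.
  let E : TPow k H (Fin 2) →ₗ[k⟦X⟧] TPow k H (Fin 2) := ∑ u ∈ A,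
    LinearMap.mulLeft k⟦X⟧ (single 0 (u : H)) ∘ₗ (single 1).toLinearMap ∘ₗ sliceLeft hH (coord u)
  have hE : ∀ y, E y = ∑ u ∈ A, single 0 (u : H) * single 1 (sliceLeft hH (coord u) y) :=
    fun y => by simp [E, LinearMap.sum_apply]
  refine ⟨E x, ?_, ?_⟩
  · rw [hE]
    exact Subalgebra.sum_mem _ fun u _ => hterm u
  · have h1 : E (G.sum fun r c => c • pure k fun i => (r i : H)) =
        G.sum fun r c => c • pure k fun i => (r i : H) := by
      rw [map_finsuppSum]
      refine Finset.sum_congr rfl fun r hr => ?_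
      change E (G r • pure k fun i => (r i : H)) = G r • pure k fun i => (r i : H)
      rw [map_smul, hE, Finset.sum_eq_single (r 0)]
      · rw [sliceLeft_pure, hu.coord_self, one_smul, pure_fin_two]
      · intro u _ hur
        rw [sliceLeft_pure, hu.coord_ne _ _ hur, zero_smul, map_zero, mul_zero]
      · intro h
        exact absurd (Finset.mem_image_of_mem _ hr) h
    have h2 := Ideal.sub_mem _ hG (map_mem_hIdeal E hG)
    rw [map_sub, h1] at h2
    simpa using h2

theorem subTPow_drinfeldAlg (hH : IsTopFree k H) :
    subTPow 𝓗.drinfeldAlg (Fin 2) = 𝓗.drinfeldAlg₂ :=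
  le_antisymm subTPow_drinfeldAlg_le (drinfeldAlg₂_le_subTPow hH)

end TopHopf

end

end HAdic

namespace HAdic

noncomputable section

/-! ### Inner automorphisms -/

section Conj

variable {R A : Type*} [CommRing R] [Ring A] [Algebra R A]

variable (R) in
/-- The inner endomorphism `x ↦ u x u⁻¹`. -/
def conjHom (u : Aˣ) : A →ₐ[R] A where
  toFun x := u * x * (u⁻¹ : Aˣ)
  map_one' := by simp
  map_mul' x y := by simp [mul_assoc]
  map_zero' := by simp
  map_add' x y := by rw [mul_add, add_mul]
  commutes' r := by rw [← Algebra.commutes, mul_assoc, Units.mul_inv, mul_one]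

theorem conjHom_apply (u : Aˣ) (x : A) : conjHom R u x = u * x * (u⁻¹ : Aˣ) := rfl

/-- The restriction of an inner automorphism to a subalgebra. -/
def conjEquiv (u : Aˣ) (P : Subalgebra R A) (h : ∀ x ∈ P, conjHom R u x ∈ P)
    (h' : ∀ x ∈ P, conjHom R u⁻¹ x ∈ P) : P ≃ₐ[R] P :=
  AlgEquiv.ofAlgHom (((conjHom R u).comp P.val).codRestrict P fun x => h x x.2)
    (((conjHom R u⁻¹).comp P.val).codRestrict P fun x => h' x x.2)
    (AlgHom.ext fun x => Subtype.ext (by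
      change conjHom R u (conjHom R u⁻¹ (x : A)) = x
      simp [conjHom_apply, mul_assoc]))
    (AlgHom.ext fun x => Subtype.ext (by
      change conjHom R u⁻¹ (conjHom R u (x : A)) = x
      simp [conjHom_apply, mul_assoc]))

theorem conjHom_mul (u v : Aˣ) (x : A) :
    conjHom R (u * v) x = conjHom R u (conjHom R v x) := by
  simp [conjHom_apply, mul_assoc]

theorem map_conjHom {B : Type*} [Ring B] [Algebra R B] (f : A →ₐ[R] B) (u : Aˣ) (x : A) :
    f (conjHom R u x) = conjHom R (Units.map (f : A →* B) u) (f x) := by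
  simp [conjHom_apply, ← map_inv]

end Conj

/-! ### Induced tensor powers, amplifications and closed subalgebras -/

section SubTPow

variable {k : Type*} [Field k] {H : Type*} [Ring H] [Algebra k⟦X⟧ H] {ι κ : Type*}
  {B : Type*} [Ring B] [Algebra k⟦X⟧ B] {S : Subalgebra k⟦X⟧ H}

theorem inducedContinuous_conjEquiv (u : Bˣ) (P : Subalgebra k⟦X⟧ B)
    (h : ∀ x ∈ P, conjHom k⟦X⟧ u x ∈ P) (h' : ∀ x ∈ P, conjHom k⟦X⟧ u⁻¹ x ∈ P) :
    InducedContinuous (conjEquiv u P h h') :=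
  fun n => ⟨n, fun _ hx => map_mem_hIdeal (conjHom k⟦X⟧ u).toLinearMap hx⟩

theorem inducedContinuous_conjEquiv_symm (u : Bˣ) (P : Subalgebra k⟦X⟧ B)
    (h : ∀ x ∈ P, conjHom k⟦X⟧ u x ∈ P) (h' : ∀ x ∈ P, conjHom k⟦X⟧ u⁻¹ x ∈ P) :
    InducedContinuous (conjEquiv u P h h').symm :=
  fun n => ⟨n, fun _ hx => map_mem_hIdeal (conjHom k⟦X⟧ u⁻¹).toLinearMap hx⟩

theorem pure_mem_subTPow {a : ι → H} (ha : ∀ i, a i ∈ S) : pure k a ∈ subTPow S ι :=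
  le_hClosure _ (Algebra.subset_adjoin ⟨a, ha, rfl⟩)

theorem algHom_mem_subTPow {f : TPow k H ι →ₐ[k⟦X⟧] TPow k H κ}
    (h : ∀ a : ι → H, (∀ i, a i ∈ S) → f (pure k a) ∈ subTPow S κ) {x : TPow k H ι}
    (hx : x ∈ subTPow S ι) : f x ∈ subTPow S κ := by
  refine map_mem_hClosure f.toLinearMap (fun y hy => ?_) hx
  refine (Algebra.adjoin_le (S := (subTPow S κ).comap f) ?_ : _) hy
  rintro _ ⟨a, ha, rfl⟩
  exact h a ha

theorem place_mem_subTPow (e : ι ↪ κ) {x : TPow k H ι} (hx : x ∈ subTPow S ι) :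
    place e x ∈ subTPow S κ := by
  refine algHom_mem_subTPow (f := placeHom e) (fun a ha => ?_) hx
  rw [placeHom_apply, place_pure]
  refine pure_mem_subTPow fun c => ?_
  by_cases hc : ∃ i, e i = c
  · obtain ⟨i, rfl⟩ := hc
    rw [e.injective.extend_apply]
    exact ha i
  · rw [Function.extend_apply' _ _ _ hc]
    exact S.one_mem

theorem single_mem_subTPow [DecidableEq κ] (c : κ) {a : H} (ha : a ∈ S) :
    single c a ∈ subTPow S κ := by
  rw [single_apply]
  refine pure_mem_subTPow fun d => ?_
  rw [Pi.mulSingle_apply]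
  split_ifs
  · exact ha
  · exact S.one_mem

theorem pure_eq_place_emb_mul_single [DecidableEq κ] {p q c : κ} (h : p ≠ q) (hp : p ≠ c)
    (hq : q ≠ c) (hcov : ∀ i, i = p ∨ i = q ∨ i = c) (a : κ → H) :
    pure k a = place (emb p q h) (pure k ![a p, a q]) * single c (a c) := by
  rw [place_emb_pure, single_apply, single_apply, single_apply, pure_mul, pure_mul]
  congr 1
  funext i
  rcases hcov i with rfl | rfl | rfl
  · simp [h, hp]
  · simp [h.symm, hq]
  · simp [hp.symm, hq.symm]

theorem place_emb_commute_single [DecidableEq κ] {p q c : κ} (h : p ≠ q) (hp : p ≠ c)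
    (hq : q ≠ c) (x : TPow k H (Fin 2)) (b : H) :
    Commute (place (emb p q h) x) (single c b) := by
  refine place_commute_single _ ?_ x b
  rintro ⟨i, hi⟩
  fin_cases i
  · exact hp hi
  · exact hq hi

/-- The image in `H^{⊗κ}` of an invertible element of `H ⊗ H`. -/
def embUnit {p q : κ} (h : p ≠ q) (u : (TPow k H (Fin 2))ˣ) : (TPow k H κ)ˣ :=
  Units.map (placeHom (k := k) (H := H) (emb p q h) : TPow k H (Fin 2) →* TPow k H κ) u

theorem conjHom_embUnit_place_mul_single [DecidableEq κ] {p q c : κ} (h : p ≠ q) (hp : p ≠ c)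
    (hq : q ≠ c) (u : (TPow k H (Fin 2))ˣ) (x : TPow k H (Fin 2)) (b : H) :
    conjHom k⟦X⟧ (embUnit h u) (place (emb p q h) x * single c b) =
      place (emb p q h) (conjHom k⟦X⟧ u x) * single c b := by
  rw [map_mul, ← placeHom_apply, ← placeHom_apply, map_conjHom]
  congr 1
  rw [conjHom_apply]
  have h1 : (embUnit h u : TPow k H κ) * (single c b : TPow k H κ) =
      (single c b : TPow k H κ) * (embUnit h u : TPow k H κ) :=
    place_emb_commute_single h hp hq (u : TPow k H (Fin 2)) b
  rw [h1, mul_assoc, Units.mul_inv, mul_one]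

/-- On a pure tensor, conjugation acts only on the factors at p and q, the third factor commuting
with the unit; the general case follows by multiplicativity and density. -/
theorem conjHom_embUnit_mem [DecidableEq κ] {p q c : κ} (h : p ≠ q) (hp : p ≠ c)
    (hq : q ≠ c) (hcov : ∀ i, i = p ∨ i = q ∨ i = c) {u : (TPow k H (Fin 2))ˣ}
    (hu : ∀ x ∈ subTPow S (Fin 2), conjHom k⟦X⟧ u x ∈ subTPow S (Fin 2)) {y : TPow k H κ}
    (hy : y ∈ subTPow S κ) : conjHom k⟦X⟧ (embUnit h u) y ∈ subTPow S κ := by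
  refine algHom_mem_subTPow (fun a ha => ?_) hy
  rw [pure_eq_place_emb_mul_single h hp hq hcov, conjHom_embUnit_place_mul_single h hp hq]
  refine Subalgebra.mul_mem _ (place_mem_subTPow _ (hu _ (pure_mem_subTPow fun i => ?_)))
    (single_mem_subTPow c (ha c))
  fin_cases i
  · exact ha p
  · exact ha q

/-- `f ⊗ id` as an algebra homomorphism. -/
def tensIdHom (f : H →ₐ[k⟦X⟧] TPow k H (Fin 2)) : TPow k H (Fin 2) →ₐ[k⟦X⟧] TPow k H (Fin 3) :=
  tensHom ((placeHom (emb 0 1 (by decide))).comp f) (single 2) fun a b =>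
    place_emb_commute_single _ (by decide) (by decide) (f a) b

/-- `id ⊗ f` as an algebra homomorphism. -/
def idTensHom (f : H →ₐ[k⟦X⟧] TPow k H (Fin 2)) : TPow k H (Fin 2) →ₐ[k⟦X⟧] TPow k H (Fin 3) :=
  tensHom (single 0) ((placeHom (emb 1 2 (by decide))).comp f) fun a b =>
    (place_emb_commute_single _ (by decide) (by decide) (f b) a).symm

theorem tensIdHom_apply (f : H →ₐ[k⟦X⟧] TPow k H (Fin 2)) (x : TPow k H (Fin 2)) :
    tensIdHom f x = tensId f.toLinearMap x := rfl

theorem idTensHom_apply (f : H →ₐ[k⟦X⟧] TPow k H (Fin 2)) (x : TPow k H (Fin 2)) :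
    idTensHom f x = idTens f.toLinearMap x := rfl

theorem tensIdHom_mem {f : H →ₐ[k⟦X⟧] TPow k H (Fin 2)}
    (hf : ∀ a ∈ S, f a ∈ subTPow S (Fin 2)) {x : TPow k H (Fin 2)}
    (hx : x ∈ subTPow S (Fin 2)) : tensIdHom f x ∈ subTPow S (Fin 3) := by
  refine algHom_mem_subTPow (fun a ha => ?_) hx
  rw [tensIdHom_apply, tensId, tens_pure]
  exact Subalgebra.mul_mem _ (place_mem_subTPow _ (hf _ (ha 0))) (single_mem_subTPow 2 (ha 1))

theorem idTensHom_mem {f : H →ₐ[k⟦X⟧] TPow k H (Fin 2)}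
    (hf : ∀ a ∈ S, f a ∈ subTPow S (Fin 2)) {x : TPow k H (Fin 2)}
    (hx : x ∈ subTPow S (Fin 2)) : idTensHom f x ∈ subTPow S (Fin 3) := by
  refine algHom_mem_subTPow (fun a ha => ?_) hx
  rw [idTensHom_apply, idTens, tens_pure]
  exact Subalgebra.mul_mem _ (single_mem_subTPow 0 (ha 0)) (place_mem_subTPow _ (hf _ (ha 1)))

/-- A closed subalgebra of a topologically free algebra is topologically free. -/
theorem IsTopFree.subalgebra (hH : IsTopFree k H) (hS : hClosure S = S) : IsTopFree k S := by
  have hsep := hH.isHSeparated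
  have htf := hH.torsionFree
  refine ⟨{ haus' := fun x hx => ?_, prec' := fun f hf => ?_ },
    Subtype.val_injective.moduleIsTorsionFree _ fun _ _ => rfl⟩
  · refine Subtype.ext (IsHSeparated.eq_zero (k := k) _ fun n => ?_)
    have := hx n
    rw [SModEq.zero, mem_span_X_pow_smul_top] at this
    exact map_mem_hIdeal S.val.toLinearMap this
  · have hf' : ∀ m n, m ≤ n → f n - f m ∈ hIdeal k S m := fun m n h => by
      have := hf h
      rw [SModEq.comm, SModEq.sub_mem, mem_span_X_pow_smul_top] at this
      exact this
    obtain ⟨a, ha⟩ := hH.exists_limit (f := fun n => (f n : H)) fun m n h =>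
      map_mem_hIdeal S.val.toLinearMap (hf' m n h)
    have haS : a ∈ S := by
      rw [← hS]
      exact fun n => ⟨f n, (f n).2, ha n⟩
    refine ⟨⟨a, haS⟩, fun m => ?_⟩
    rw [SModEq.comm, SModEq.sub_mem, mem_span_X_pow_smul_top]
    obtain ⟨b, hb⟩ := ha m
    refine ⟨⟨b, ?_⟩, Subtype.ext hb⟩
    rw [← hS]
    intro n
    -- The quotient b of a - f m by h^m must be shown to lie in S: it is the limit of the quotients
    -- of f (m + n) - f m, which lie in S, and cancelling h^m uses torsion-freeness.
    obtain ⟨s, hs⟩ := hf' m (m + n) (Nat.le_add_right m n)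
    refine ⟨s, s.2, hH.mem_hIdeal_of_smul (m := m) ?_⟩
    have hs' : (f (m + n) : H) - f m = (PowerSeries.X ^ m : k⟦X⟧) • (s : H) :=
      congrArg Subtype.val hs
    rw [smul_sub, ← hb, ← hs', sub_sub_sub_cancel_right]
    exact ha (m + n)

end SubTPow

/-! ### The braided Hopf algebra structure -/

namespace TopHopf

variable {k : Type*} [Field k] {H : Type*} [Ring H] [Algebra k⟦X⟧ H] {𝓗 : TopHopf k H}
  {S : Subalgebra k⟦X⟧ H} {R : (TPow k H (Fin 2))ˣ}

theorem isHopfSubalgebra_drinfeldAlg (hH : IsTopFree k H) :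
    𝓗.IsHopfSubalgebra 𝓗.drinfeldAlg where
  topFree := hH.subalgebra hClosure_drinfeldAlg
  closed := hClosure_drinfeldAlg
  comul_mem a ha := by
    rw [subTPow_drinfeldAlg hH]
    exact comul_mem_drinfeld₂ ha
  antipode_mem _ ha := antipode_mem_drinfeld ha

theorem conjHom_sub_mem {A : Type*} [Ring A] [Algebra k⟦X⟧ A] {u : Aˣ}
    (hu : (u : A) - 1 ∈ hIdeal k A 1) {n : ℕ} {x : A} (hx : x ∈ hIdeal k A n) :
    conjHom k⟦X⟧ u x - x ∈ hIdeal k A (n + 1) := by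
  have h1 : conjHom k⟦X⟧ u x - x = (((u : A) - 1) * x - x * ((u : A) - 1)) * (u⁻¹ : Aˣ) := by
    rw [conjHom_apply, sub_one_mul, mul_sub_one, sub_sub_sub_cancel_right, sub_mul, mul_assoc x,
      Units.mul_inv, mul_one]
  rw [h1]
  refine Ideal.mul_mem_right _ _ (Ideal.sub_mem _ ?_ (mul_mem_hIdeal_add hx hu))
  rw [add_comm]
  exact mul_mem_hIdeal_add hu hx

/-- If `Ad(u)`, with `u ≡ 1` modulo `h`, is the flip of `S ⊗ S`, then `S` is reduced to the
scalars. -/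
theorem eq_bot_of_conjHom_eq_flip [IsHSeparated k H] {u : (TPow k H (Fin 2))ˣ}
    (𝓗 : TopHopf k H) (hu : (u : TPow k H (Fin 2)) - 1 ∈ hIdeal k (TPow k H (Fin 2)) 1)
    (h : ∀ x ∈ subTPow S (Fin 2), conjHom k⟦X⟧ u x = flip x) : S = ⊥ := by
  have key : ∀ a ∈ S, 𝓗.counit a = 0 → a = 0 := fun a ha hε =>
    IsHSeparated.eq_zero (k := k) _ fun n => by
      induction n with
      | zero => exact mem_hIdeal_zero _
      | succ n ih =>
        -- If a is divisible by h^n, the assumption puts 1 ⊗ a - a ⊗ 1 in order n + 1; applying id ⊗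
        -- ε, with ε(a) = 0, leaves -a.
        have h1 := conjHom_sub_mem hu (map_mem_hIdeal
          (single (k := k) (H := H) (0 : Fin 2)).toLinearMap ih)
        rw [AlgHom.toLinearMap_apply, h _ (single_mem_subTPow 0 ha), flip, place_single] at h1
        have h2 := map_mem_hIdeal (tens (HCompl.of k H).toLinearMap
          (Algebra.linearMap k⟦X⟧ (HCompl k H) ∘ₗ 𝓗.counit.toLinearMap)) h1
        have h3 := tens_single_mul_single (HCompl.of k H).toLinearMap
          (Algebra.linearMap k⟦X⟧ (HCompl k H) ∘ₗ 𝓗.counit.toLinearMap) 1 a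
        have h4 := tens_single_mul_single (HCompl.of k H).toLinearMap
          (Algebra.linearMap k⟦X⟧ (HCompl k H) ∘ₗ 𝓗.counit.toLinearMap) a 1
        rw [map_one, one_mul] at h3
        rw [map_one, mul_one] at h4
        have h5 : emb (1 : Fin 2) 0 (by decide) 0 = 1 := rfl
        rw [h5, map_sub, h3, h4] at h2
        simpa [hε, ← map_neg, HCompl.of_mem_hIdeal_iff, -map_neg] using h2
  refine le_bot_iff.1 fun a ha => Algebra.mem_bot.2 ⟨𝓗.counit a, ?_⟩
  refine (sub_eq_zero.1 (key _ (S.sub_mem ha (S.algebraMap_mem (𝓗.counit a))) ?_)).symm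
  rw [map_sub, AlgHom.commutes, Algebra.algebraMap_self, RingHom.id_apply, sub_self]

theorem isAmplification_conjEquiv
    (h : ∀ x ∈ subTPow S (Fin 2), conjHom k⟦X⟧ R x ∈ subTPow S (Fin 2))
    (h' : ∀ x ∈ subTPow S (Fin 2), conjHom k⟦X⟧ R⁻¹ x ∈ subTPow S (Fin 2))
    {p q c : Fin 3} (hpq : p ≠ q) (hp : p ≠ c) (hq : q ≠ c) (hcov : ∀ i, i = p ∨ i = q ∨ i = c) :
    IsAmplification (conjEquiv R _ h h') p q hpq c
      (conjEquiv (embUnit hpq R) (subTPow S (Fin 3))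
        (fun _ hy => conjHom_embUnit_mem hpq hp hq hcov h hy)
        fun _ hy => conjHom_embUnit_mem hpq hp hq hcov h' hy) where
  continuous := inducedContinuous_conjEquiv _ _ _ _
  continuous_symm := inducedContinuous_conjEquiv_symm _ _ _ _
  apply x s :=
    ⟨⟨_, Subalgebra.mul_mem _ (place_mem_subTPow _ x.2) (single_mem_subTPow c s.2)⟩, rfl,
      conjHom_embUnit_place_mul_single hpq hp hq R x s⟩

/-- An algebra map carries conjugation by R to conjugation by the image of R; for Δ ⊗ id and id ⊗ Δ
that image is R₁₃ R₂₃, resp. R₁₃ R₁₂, and conjugation by a product is a composite. -/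
theorem IsRMatrix.isBraided (hR : 𝓗.IsRMatrix R) [IsHSeparated k H]
    (hR1 : (R : TPow k H (Fin 2)) - 1 ∈ hIdeal k (TPow k H (Fin 2)) 1)
    (hS : 𝓗.IsHopfSubalgebra S)
    (h : ∀ x ∈ subTPow S (Fin 2), conjHom k⟦X⟧ R x ∈ subTPow S (Fin 2))
    (h' : ∀ x ∈ subTPow S (Fin 2), conjHom k⟦X⟧ R⁻¹ x ∈ subTPow S (Fin 2)) :
    𝓗.IsBraided S (conjEquiv R _ h h') where
  hopf := hS
  continuous := inducedContinuous_conjEquiv _ _ _ _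
  continuous_symm := inducedContinuous_conjEquiv_symm _ _ _ _
  ne_flip hne := by
    by_contra! hflip
    exact hne (eq_bot_of_conjHom_eq_flip 𝓗 hR1 fun x hx => hflip ⟨x, hx⟩)
  comul a ha := ⟨⟨_, hS.comul_mem a ha⟩, rfl, hR.conj_comul a⟩
  hexagon := by
    refine ⟨_, _, _, isAmplification_conjEquiv h h' (by decide) (by decide) (by decide) (by decide),
      isAmplification_conjEquiv h h' (by decide) (by decide) (by decide) (by decide),
      isAmplification_conjEquiv h h' (by decide) (by decide) (by decide) (by decide),
      fun x => ⟨⟨_, tensIdHom_mem hS.comul_mem x.2⟩, rfl, ?_⟩,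
      fun x => ⟨⟨_, idTensHom_mem hS.comul_mem x.2⟩, rfl, ?_⟩⟩
    · have hu : Units.map (tensIdHom 𝓗.comul : TPow k H (Fin 2) →* TPow k H (Fin 3)) R =
          embUnit (by decide : (0 : Fin 3) ≠ 2) R * embUnit (by decide : (1 : Fin 3) ≠ 2) R :=
        Units.ext hR.comul_id
      change tensIdHom 𝓗.comul (conjHom k⟦X⟧ R (x : TPow k H (Fin 2))) = _
      rw [map_conjHom, hu, conjHom_mul]
      rfl
    · have hu : Units.map (idTensHom 𝓗.comul : TPow k H (Fin 2) →* TPow k H (Fin 3)) R =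
          embUnit (by decide : (0 : Fin 3) ≠ 2) R * embUnit (by decide : (0 : Fin 3) ≠ 1) R :=
        Units.ext hR.id_comul
      change idTensHom 𝓗.comul (conjHom k⟦X⟧ R (x : TPow k H (Fin 2))) = _
      rw [map_conjHom, hu, conjHom_mul]
      rfl

end TopHopf

end

end HAdic

theorem mainTheorem1 {k : Type*} [Field k] [CharZero k]
    {H : Type*} [Ring H] [Algebra k⟦X⟧ H] (hH : HAdic.IsTopFree k H)
    (𝓗 : HAdic.TopHopf k H)
    (R : (HAdic.TPow k H (Fin 2))ˣ) (hR : 𝓗.IsRMatrix R)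
    (hR1 : (R : HAdic.TPow k H (Fin 2)) - 1 ∈ HAdic.hIdeal k (HAdic.TPow k H (Fin 2)) 1) :
    (∀ a ∈ 𝓗.drinfeld₂,
      (R : HAdic.TPow k H (Fin 2)) * a * (R⁻¹ : (HAdic.TPow k H (Fin 2))ˣ) ∈ 𝓗.drinfeld₂) ∧
    ∃ H' : Subalgebra k⟦X⟧ H,
      Subalgebra.toSubmodule H' = 𝓗.drinfeld ∧
      Subalgebra.toSubmodule (HAdic.subTPow H' (Fin 2)) = 𝓗.drinfeld₂ ∧
      ∃ T : HAdic.subTPow H' (Fin 2) ≃ₐ[k⟦X⟧] HAdic.subTPow H' (Fin 2),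
        (∀ x : HAdic.subTPow H' (Fin 2), (T x : HAdic.TPow k H (Fin 2)) =
          R * (x : HAdic.TPow k H (Fin 2)) * (R⁻¹ : (HAdic.TPow k H (Fin 2))ˣ)) ∧
        𝓗.IsBraided H' T := by
  have hsep := hH.isHSeparated
  have hsub := HAdic.TopHopf.subTPow_drinfeldAlg (𝓗 := 𝓗) hH
  refine ⟨fun a ha => (hR.conj_mem_drinfeld₂ hR1 ha).1, 𝓗.drinfeldAlg, rfl, ?_,
    HAdic.conjEquiv R _ (fun x hx => ?_) (fun x hx => ?_), fun x => rfl,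
    hR.isBraided hR1 (HAdic.TopHopf.isHopfSubalgebra_drinfeldAlg hH) _ _⟩
  · rw [hsub]
    rfl
  · rw [hsub] at hx ⊢
    exact (hR.conj_mem_drinfeld₂ hR1 hx).1
  · rw [hsub] at hx ⊢
    exact (hR.conj_mem_drinfeld₂ hR1 hx).2
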